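/- Let $d\ge 2$ and let $\zeta\in\mathbb C$ be a primitive $d$-th root of unity. Let $B$ be the Taft algebra, the Hopf algebra over $\mathbb C$ generated by $K,E$ with relations $K^d=1$, $E^d=0$, $KE=\zeta EK$, with coproduct $\Delta(K)=K\otimes K$, $\Delta(E)=1\otimes E+E\otimes K$, counit $\varepsilon(K)=1$, $\varepsilon(E)=0$ and antipode $S(K)=K^{-1}$, $S(E)=-EK^{-1}$. Let $D(B)$ be its Drinfeld double, that is $(B^*)^{\mathrm{cop}}\otimes B$ as a coalgebra, with product $(f\otimes a)(g\otimes b)=\sum f\,g(S^{-1}(a_{3})\,?\,a_{1})\otimes a_{2}b$. Let $K^*,E^*\in B^*\subset D(B)$ be defined by $K^*(E^iK^j)=\delta_{i,0}\zeta^j$ and $E^*(E^iK^j)=\delta_{i,1}$ ($0\le i,j\le d-1$), and put $z=K^{*-1}K$, $F=\zeta E^*K^{*-1}$. Let $(\beta_{i,j})$ be the basis of $B^*$ dual to $(E^iK^j)_{0\le i,j\le d-1}$, explicitly $\beta_{i,j}=\frac{E^{*i}}{d\,(i)!_\zeta}\sum_{k=0}^{d-1}\zeta^{-k(i+j)}K^{*k}$,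 where $(n)_\zeta=1+\zeta+\cdots+\zeta^{n-1}$ and $(i)!_\zeta=\prod_{n=1}^i(n)_\zeta$. Put $R=\sum_{i,j=0}^{d-1}E^iK^j\otimes\beta_{i,j}$, $u=\sum_{i,j=0}^{d-1}S(\beta_{i,j})E^iK^j$, $\theta=K^{-1}u$ and $\theta_1=z\theta$. For two finite-dimensional $D(B)$-modules $M,N$, let $c_{M,N}:M\otimes N\to N\otimes M$, $m\otimes n\mapsto\tau(R)(n\otimes m)$, with $\tau(a\otimes b)=b\otimes a$, and for an endomorphism $f$ of $M$ let $\mathrm{Tr}_+(f)=\mathrm{Tr}(z^{-1}Kf)$ and $\mathrm{Tr}_-(f)=\mathrm{Tr}(fK^{-1}z)$, where $\mathrm{Tr}$ is the usual trace. For $l\in\{1,\dots,d\}$ and $p\in\mathbb Z/d\mathbb Z$, let $M_{l,p}$ be the simple $D(B)$-module with basis $e_1,\dots,e_l$ such that $ze_i=\zeta^{2p+l-1}e_i$, $Ke_i=\zeta^{p+l-i}e_i$, $Ee_{i+1}=\zeta^p(i)_\zeta(\zeta^{l-i}-1)e_i$, $Ee_1=0$, $Fe_i=e_{i+1}$ for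 $i<l$ and $Fe_l=0$. Identify $\{1,\dots,d\}\times\mathbb Z/d\mathbb Z$ with $\Lambda(d)=\mathbb Z/d\mathbb Z\times\mathbb Z/d\mathbb Z$, and for $\lambda\in\Lambda(d)$ let $M_\lambda$ be the corresponding module and let $\omega_\lambda(b)$ be the scalar by which an element $b$ of the centre of $D(B)$ acts on $M_\lambda$. The element $\theta_1$ is central and invertible. Define, for $\lambda,\lambda'\in\Lambda(d)$, $$\mathbb S^\pm_{\lambda,\lambda'}=\mathrm{Tr}_\pm(c_{M_{\lambda'},M_\lambda}\circ c_{M_\lambda,M_{\lambda'}}),\qquad \mathbb T^\pm_\lambda=\omega_\lambda(\theta_1^{\mp1}),$$ where $\mathbb T^\pm_\lambda$ is the $\lambda$-entry of the diagonal matrix $\mathbb T^\pm$. Then, for all $(l,p),(l',p')\in\Lambda(d)$, $$\mathbb S^+_{(l,p),(l',p')}=\frac{\zeta}{1-\zeta}\,\zeta^{-ll'-lp'-pl'-2pp'}(1-\zeta^{ll'}),\qquad \mathbb T^+_{(l,p)}=\zeta^{-p(p+l)},$$ $$\mathbb S^-_{(l,p),(l',p')}=\frac{\zeta^{2p+l+2p'+l'-1}}{1-\zeta}\,\zeta^{-ll'-lp'-pl'-2pp'}(1-\zeta^{ll'}),\qquad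 \mathbb T^-_{(l,p)}=\zeta^{p(p+l)}.$$ -/

import Mathlib

set_option linter.unusedSectionVars false
open scoped TensorProduct

namespace TaftDouble

noncomputable section

/-- The `q`-integer `(n)_ξ = 1 + ξ + ⋯ + ξ ^ (n - 1)`. -/
def qInt (ξ : ℂ) (n : ℕ) : ℂ := ∑ i ∈ Finset.range n, ξ ^ i

/-- The `q`-factorial `(n)!_ξ = (1)_ξ (2)_ξ ⋯ (n)_ξ`. -/
def qFact (ξ : ℂ) (n : ℕ) : ℂ := ∏ i ∈ Finset.range n, qInt ξ (i + 1)

/-- Gaussian binomial coefficients, only used to prove that the coproduct exists. -/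
def qBinom (ξ : ℂ) : ℕ → ℕ → ℂ
  | _, 0 => 1
  | 0, _ + 1 => 0
  | n + 1, k + 1 => qBinom ξ n k + ξ ^ (k + 1) * qBinom ξ n (k + 1)

theorem qBinom_zero_right (ξ : ℂ) (n : ℕ) : qBinom ξ n 0 = 1 := by cases n <;> rfl

theorem qBinom_succ_succ (ξ : ℂ) (n k : ℕ) :
    qBinom ξ (n + 1) (k + 1) = qBinom ξ n k + ξ ^ (k + 1) * qBinom ξ n (k + 1) := rfl

theorem qBinom_of_lt (ξ : ℂ) : ∀ n k : ℕ, n < k → qBinom ξ n k = 0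
  | 0, 0, h => absurd h (lt_irrefl 0)
  | 0, _ + 1, _ => rfl
  | n + 1, 0, h => absurd h (Nat.not_lt_zero _)
  | n + 1, k + 1, h => by
      rw [qBinom_succ_succ, qBinom_of_lt ξ n k (by omega), qBinom_of_lt ξ n (k + 1) (by omega)]
      simp

theorem qFact_succ (ξ : ℂ) (n : ℕ) : qFact ξ (n + 1) = qFact ξ n * qInt ξ (n + 1) := by
  simp [qFact, Finset.prod_range_succ]

theorem qFact_zero (ξ : ℂ) : qFact ξ 0 = 1 := by simp [qFact]

theorem qInt_add (ξ : ℂ) (m n : ℕ) : qInt ξ (m + n) = qInt ξ m + ξ ^ m * qInt ξ n := by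
  simp only [qInt, Finset.sum_range_add, pow_add, Finset.mul_sum]

theorem qBinom_mul (ξ : ℂ) : ∀ k m : ℕ,
    qBinom ξ (k + m) k * (qFact ξ k * qFact ξ m) = qFact ξ (k + m)
  | 0, m => by simp [qBinom_zero_right, qFact_zero]
  | k + 1, 0 => by
      have h := qBinom_mul ξ k 0
      rw [add_zero] at h
      rw [add_zero, qBinom_succ_succ, qBinom_of_lt ξ k (k + 1) (by omega), qFact_succ]
      linear_combination qInt ξ (k + 1) * h
  | k + 1, m + 1 => by
      have h1 := qBinom_mul ξ k (m + 1)
      have h2 := qBinom_mul ξ (k + 1) m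
      rw [show k + (m + 1) = k + 1 + m by omega] at h1
      rw [show k + 1 + (m + 1) = (k + 1 + m) + 1 by omega, qBinom_succ_succ,
        qFact_succ ξ (k + 1 + m), show k + 1 + m + 1 = (k + 1) + (m + 1) by omega,
        qInt_add ξ (k + 1) (m + 1)]
      rw [qFact_succ ξ m] at h1 ⊢
      rw [qFact_succ ξ k] at h2 ⊢
      linear_combination qInt ξ (k + 1) * h1 + ξ ^ (k + 1) * qInt ξ (m + 1) * h2

theorem qInt_ne_zero {d : ℕ} {ζ : ℂ} (h : IsPrimitiveRoot ζ d) (n : ℕ) (h0 : 0 < n) (hn : n < d) :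
    qInt ζ n ≠ 0 := by
  intro h1
  have h2 := geom_sum_mul ζ n
  rw [qInt] at h1
  rw [h1, zero_mul, eq_comm, sub_eq_zero] at h2
  exact h.pow_ne_one_of_pos_of_lt h0.ne' hn h2

theorem qFact_ne_zero {d : ℕ} {ζ : ℂ} (h : IsPrimitiveRoot ζ d) (n : ℕ) (hn : n < d) :
    qFact ζ n ≠ 0 := by
  rw [qFact, Finset.prod_ne_zero_iff]
  intro i hi
  have := Finset.mem_range.1 hi
  exact qInt_ne_zero h _ (by omega) (by omega)

theorem qBinom_self_eq_zero {d : ℕ} {ζ : ℂ} (h : IsPrimitiveRoot ζ d) (k : ℕ) (h0 : 0 < k)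
    (hk : k < d) : qBinom ζ d k = 0 := by
  have h1 := qBinom_mul ζ k (d - k)
  rw [show k + (d - k) = d by omega] at h1
  have h2 : qFact ζ d = 0 := by
    obtain ⟨e, rfl⟩ : ∃ e, d = e + 1 := ⟨d - 1, by omega⟩
    rw [qFact_succ, qInt, h.geom_sum_eq_zero (by omega), mul_zero]
  rw [h2] at h1
  exact (mul_eq_zero.1 h1).resolve_right
    (mul_ne_zero (qFact_ne_zero h _ hk) (qFact_ne_zero h _ (by omega)))

/-- The `q`-binomial theorem. -/
theorem qBinom_theorem {A : Type*} [Ring A] [Algebra ℂ A] (ξ : ℂ) (x y : A)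
    (h : y * x = ξ • (x * y)) (n : ℕ) :
    (x + y) ^ n = ∑ k ∈ Finset.range (n + 1), qBinom ξ n k • (x ^ k * y ^ (n - k)) := by
  have hk : ∀ k : ℕ, y * x ^ k = ξ ^ k • (x ^ k * y) := by
    intro k
    induction k with
    | zero => simp
    | succ k ih =>
      rw [pow_succ, ← mul_assoc, ih, smul_mul_assoc, mul_assoc, h, mul_smul_comm, smul_smul,
        ← pow_succ, mul_assoc]
  induction n with
  | zero => simp [qBinom_zero_right]
  | succ n ih =>
    rw [pow_succ', ih, add_mul, Finset.mul_sum, Finset.mul_sum, Finset.sum_range_succ' _ (n + 1)]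
    simp only [qBinom_succ_succ, add_smul, Finset.sum_add_distrib, qBinom_zero_right]
    rw [add_assoc]
    congr 1
    · refine Finset.sum_congr rfl fun k _ => ?_
      rw [mul_smul_comm, ← mul_assoc, ← pow_succ', Nat.add_sub_add_right]
    · rw [Finset.sum_range_succ' _ n, Finset.sum_range_succ _ n, qBinom_of_lt ξ n (n + 1) (by omega)]
      simp only [mul_zero, zero_smul, add_zero]
      congr 1
      · refine Finset.sum_congr rfl fun k hk' => ?_
        have := Finset.mem_range.1 hk'
        rw [mul_smul_comm, ← mul_assoc, hk, smul_mul_assoc, smul_smul, mul_assoc, ← pow_succ',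
          mul_comm (ξ ^ _), show n - (k + 1) + 1 = n + 1 - (k + 1) by omega]
      · simp [qBinom_zero_right, pow_succ']

theorem add_pow_of_qcomm {A : Type*} [Ring A] [Algebra ℂ A] {d : ℕ} {ζ : ℂ}
    (hz : IsPrimitiveRoot ζ d) (x y : A) (h : y * x = ζ • (x * y)) (hx : x ^ d = 0)
    (hy : y ^ d = 0) : (x + y) ^ d = 0 := by
  rw [qBinom_theorem ζ x y h]
  refine Finset.sum_eq_zero fun k hk => ?_
  have := Finset.mem_range.1 hk
  rcases Nat.eq_zero_or_pos k with rfl | h0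
  · simp [hy]
  rcases Nat.lt_or_ge k d with h1 | h1
  · rw [qBinom_self_eq_zero hz k h0 h1, zero_smul]
  · rw [show k = d by omega, hx]; simp

/-! ### The Taft algebra -/

/-- The two generators of the Taft algebra. -/
inductive Gen : Type
  | K : Gen
  | E : Gen

/-- The defining relations `K ^ d = 1`, `E ^ d = 0`, `K E = ζ E K`. -/
inductive TaftRel (d : ℕ) (ζ : ℂ) : FreeAlgebra ℂ Gen → FreeAlgebra ℂ Gen → Prop
  | K_pow : TaftRel d ζ (FreeAlgebra.ι ℂ Gen.K ^ d) 1
  | E_pow : TaftRel d ζ (FreeAlgebra.ι ℂ Gen.E ^ d) 0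
  | K_mul_E : TaftRel d ζ (FreeAlgebra.ι ℂ Gen.K * FreeAlgebra.ι ℂ Gen.E)
      (ζ • (FreeAlgebra.ι ℂ Gen.E * FreeAlgebra.ι ℂ Gen.K))

/-- The Taft algebra `B`, by generators and relations. -/
def Taft (d : ℕ) (ζ : ℂ) : Type := RingQuot (TaftRel d ζ)

namespace Taft

variable {d : ℕ} {ζ : ℂ}

instance : Ring (Taft d ζ) := inferInstanceAs (Ring (RingQuot (TaftRel d ζ)))

instance : Algebra ℂ (Taft d ζ) := inferInstanceAs (Algebra ℂ (RingQuot (TaftRel d ζ)))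

variable (d ζ) in
/-- The image of a generator in `B`. -/
def gen (g : Gen) : Taft d ζ := RingQuot.mkAlgHom ℂ (TaftRel d ζ) (FreeAlgebra.ι ℂ g)

variable (d ζ) in
/-- The generator `K` of `B`. -/
def K : Taft d ζ := gen d ζ Gen.K

variable (d ζ) in
/-- The generator `E` of `B`. -/
def E : Taft d ζ := gen d ζ Gen.E

theorem K_pow : K d ζ ^ d = 1 := by
  have := RingQuot.mkAlgHom_rel ℂ (TaftRel.K_pow (d := d) (ζ := ζ))
  rw [map_pow, map_one] at this
  exact this

theorem E_pow : E d ζ ^ d = 0 := by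
  have := RingQuot.mkAlgHom_rel ℂ (TaftRel.E_pow (d := d) (ζ := ζ))
  rw [map_pow, map_zero] at this
  exact this

theorem K_mul_E : K d ζ * E d ζ = ζ • (E d ζ * K d ζ) := by
  have := RingQuot.mkAlgHom_rel ℂ (TaftRel.K_mul_E (d := d) (ζ := ζ))
  rw [map_smul, map_mul, map_mul] at this
  exact this

/-- The universal property of the presentation of `B`. -/
def lift {A : Type*} [Ring A] [Algebra ℂ A] (k e : A) (hk : k ^ d = 1) (he : e ^ d = 0)
    (hke : k * e = ζ • (e * k)) : Taft d ζ →ₐ[ℂ] A :=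
  RingQuot.liftAlgHom ℂ ⟨FreeAlgebra.lift ℂ (fun g => match g with | Gen.K => k | Gen.E => e), by
    intro x y h
    cases h <;> simp [hk, he, hke]⟩

section lift

variable {A : Type*} [Ring A] [Algebra ℂ A] (k e : A) (hk : k ^ d = 1) (he : e ^ d = 0)
    (hke : k * e = ζ • (e * k))

theorem lift_K : lift k e hk he hke (K d ζ) = k := by
  have := RingQuot.liftAlgHom_mkAlgHom_apply (S := ℂ) (s := TaftRel d ζ)
    (FreeAlgebra.lift ℂ (fun g => match g with | Gen.K => k | Gen.E => e)) (by
    intro x y h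
    cases h <;> simp [hk, he, hke]) (FreeAlgebra.ι ℂ Gen.K)
  exact this.trans (by simp)

theorem lift_E : lift k e hk he hke (E d ζ) = e := by
  have := RingQuot.liftAlgHom_mkAlgHom_apply (S := ℂ) (s := TaftRel d ζ)
    (FreeAlgebra.lift ℂ (fun g => match g with | Gen.K => k | Gen.E => e)) (by
    intro x y h
    cases h <;> simp [hk, he, hke]) (FreeAlgebra.ι ℂ Gen.E)
  exact this.trans (by simp)

end lift

theorem hom_ext {A : Type*} [Semiring A] [Algebra ℂ A] {f g : Taft d ζ →ₐ[ℂ] A}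
    (hK : f (K d ζ) = g (K d ζ)) (hE : f (E d ζ) = g (E d ζ)) : f = g := by
  refine RingQuot.ringQuot_ext' ℂ f g (FreeAlgebra.hom_ext ?_)
  funext x
  cases x
  · exact hK
  · exact hE

/-- A property of elements of `B` that is stable under the algebra operations holds everywhere as
soon as it holds for the generators. -/
theorem induction {P : Taft d ζ → Prop} (hc : ∀ c : ℂ, P (algebraMap ℂ _ c)) (hK : P (K d ζ))
    (hE : P (E d ζ)) (hadd : ∀ a b, P a → P b → P (a + b)) (hmul : ∀ a b, P a → P b → P (a * b))
    (a : Taft d ζ) : P a := by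
  obtain ⟨x, rfl⟩ := RingQuot.mkAlgHom_surjective ℂ (TaftRel d ζ) a
  induction x using FreeAlgebra.induction with
  | grade0 c => rw [AlgHom.commutes]; exact hc c
  | grade1 g => cases g; exacts [hK, hE]
  | mul a b ha hb => rw [map_mul]; exact hmul _ _ ha hb
  | add a b ha hb => rw [map_add]; exact hadd _ _ ha hb

variable [Fact (2 ≤ d)] [Fact (IsPrimitiveRoot ζ d)]

variable (d) in
theorem d_ne_zero : d ≠ 0 := by have : 2 ≤ d := Fact.out; omega

variable (d ζ) in
theorem prim : IsPrimitiveRoot ζ d := Fact.out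

theorem zeta_ne_zero (d : ℕ) (ζ : ℂ) [Fact (2 ≤ d)] [Fact (IsPrimitiveRoot ζ d)] : ζ ≠ 0 :=
  (prim d ζ).ne_zero (d_ne_zero d)

variable (d ζ) in
/-- The inverse of `K`. -/
def Kinv : Taft d ζ := K d ζ ^ (d - 1)

theorem K_mul_Kinv : K d ζ * Kinv d ζ = 1 := by
  rw [Kinv, ← pow_succ', Nat.sub_add_cancel (Nat.one_le_iff_ne_zero.2 (d_ne_zero d)), K_pow]

theorem Kinv_mul_K : Kinv d ζ * K d ζ = 1 := by
  rw [Kinv, ← pow_succ, Nat.sub_add_cancel (Nat.one_le_iff_ne_zero.2 (d_ne_zero d)), K_pow]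

theorem Kinv_pow : Kinv d ζ ^ d = 1 := by
  rw [Kinv, ← pow_mul, mul_comm, pow_mul, K_pow, one_pow]

theorem E_mul_K : E d ζ * K d ζ = ζ⁻¹ • (K d ζ * E d ζ) := by
  rw [K_mul_E, smul_smul, inv_mul_cancel₀ (zeta_ne_zero d ζ), one_smul]

theorem Kinv_mul_E : Kinv d ζ * E d ζ = ζ⁻¹ • (E d ζ * Kinv d ζ) := by
  calc Kinv d ζ * E d ζ = Kinv d ζ * (E d ζ * K d ζ) * Kinv d ζ := by
        rw [mul_assoc, mul_assoc, K_mul_Kinv, mul_one]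
    _ = ζ⁻¹ • (E d ζ * Kinv d ζ) := by
        rw [E_mul_K, mul_smul_comm, smul_mul_assoc, ← mul_assoc, Kinv_mul_K, one_mul]

theorem E_mul_Kinv : E d ζ * Kinv d ζ = ζ • (Kinv d ζ * E d ζ) := by
  rw [Kinv_mul_E, smul_smul, mul_inv_cancel₀ (zeta_ne_zero d ζ), one_smul]

theorem mul_pow_eq_zero {A : Type*} [Ring A] [Algebra ℂ A] (x y : A) (c : ℂ)
    (h : y * x = c • (x * y)) (n : ℕ) (hx : x ^ n = 0) : (x * y) ^ n = 0 := by
  have hk : ∀ k : ℕ, y ^ k * x = c ^ k • (x * y ^ k) := by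
    intro k
    induction k with
    | zero => simp
    | succ k ih =>
      rw [pow_succ, mul_assoc, h, mul_smul_comm, ← mul_assoc, ih, smul_mul_assoc, smul_smul,
        mul_assoc, ← pow_succ, ← pow_succ']
  have key : ∀ k : ℕ, ∃ c' : ℂ, (x * y) ^ k = c' • (x ^ k * y ^ k) := by
    intro k
    induction k with
    | zero => exact ⟨1, by simp⟩
    | succ k ih =>
      obtain ⟨c', hc⟩ := ih
      refine ⟨c' * c ^ k, ?_⟩
      rw [pow_succ, hc, smul_mul_assoc, mul_assoc, ← mul_assoc (y ^ k), hk, smul_mul_assoc,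
        mul_smul_comm, smul_smul, mul_assoc, ← pow_succ, ← mul_assoc, ← pow_succ]
  obtain ⟨c', hc⟩ := key n
  rw [hc, hx, zero_mul, smul_zero]

variable (d ζ) in
/-- The coproduct of `B`: `Δ(K) = K ⊗ K` and `Δ(E) = 1 ⊗ E + E ⊗ K`. -/
def comulHom : Taft d ζ →ₐ[ℂ] Taft d ζ ⊗[ℂ] Taft d ζ :=
  lift (K d ζ ⊗ₜ K d ζ) (1 ⊗ₜ E d ζ + E d ζ ⊗ₜ K d ζ)
    (by rw [Algebra.TensorProduct.tmul_pow, K_pow, Algebra.TensorProduct.one_def])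
    (by
      refine add_pow_of_qcomm (prim d ζ) _ _ ?_ ?_ ?_
      · simp [K_mul_E]
      · simp [Algebra.TensorProduct.tmul_pow, E_pow]
      · simp [Algebra.TensorProduct.tmul_pow, E_pow])
    (by simp [mul_add, add_mul, K_mul_E, TensorProduct.smul_tmul'])

variable (d ζ) in
/-- The counit of `B`: `ε(K) = 1` and `ε(E) = 0`. -/
def counitHom : Taft d ζ →ₐ[ℂ] ℂ :=
  lift 1 0 (one_pow _) (zero_pow (d_ne_zero d)) (by simp)

@[simp] theorem comulHom_K : comulHom d ζ (K d ζ) = K d ζ ⊗ₜ K d ζ := lift_K ..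

@[simp] theorem comulHom_E : comulHom d ζ (E d ζ) = 1 ⊗ₜ E d ζ + E d ζ ⊗ₜ K d ζ := lift_E ..

@[simp] theorem counitHom_K : counitHom d ζ (K d ζ) = 1 := lift_K ..

@[simp] theorem counitHom_E : counitHom d ζ (E d ζ) = 0 := lift_E ..

instance : Bialgebra ℂ (Taft d ζ) :=
  Bialgebra.ofAlgHom (comulHom d ζ) (counitHom d ζ)
    (hom_ext (by simp) (by simp [TensorProduct.add_tmul, TensorProduct.tmul_add, add_assoc,
      Algebra.TensorProduct.one_def]))
    (hom_ext (by simp) (by simp))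
    (hom_ext (by simp) (by simp))

@[simp] theorem comul_K : Coalgebra.comul (R := ℂ) (K d ζ) = K d ζ ⊗ₜ K d ζ := comulHom_K

@[simp] theorem comul_E : Coalgebra.comul (R := ℂ) (E d ζ) = 1 ⊗ₜ E d ζ + E d ζ ⊗ₜ K d ζ :=
  comulHom_E

@[simp] theorem counit_K : Coalgebra.counit (R := ℂ) (K d ζ) = 1 := counitHom_K

@[simp] theorem counit_E : Coalgebra.counit (R := ℂ) (E d ζ) = 0 := counitHom_E

open MulOpposite in
variable (d ζ) in
/-- The antipode of `B`, as an anti-homomorphism: `S(K) = K⁻¹` and `S(E) = - E K⁻¹`. -/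
def antipodeHom : Taft d ζ →ₐ[ℂ] (Taft d ζ)ᵐᵒᵖ :=
  lift (op (Kinv d ζ)) (op (-(E d ζ * Kinv d ζ)))
    (by rw [← op_pow, Kinv_pow, op_one])
    (by rw [← op_pow, neg_pow, mul_pow_eq_zero _ _ _ Kinv_mul_E _ E_pow, mul_zero, op_zero])
    (by
      rw [← op_mul, ← op_mul, ← op_smul, neg_mul, mul_neg, smul_neg, ← mul_assoc, Kinv_mul_E,
        smul_mul_assoc, smul_smul, mul_inv_cancel₀ (zeta_ne_zero d ζ), one_smul])

open MulOpposite in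
variable (d ζ) in
/-- The inverse of the antipode of `B`, as an anti-homomorphism: `S⁻¹(K) = K⁻¹` and
`S⁻¹(E) = - K⁻¹ E`. -/
def antipodeInvHom : Taft d ζ →ₐ[ℂ] (Taft d ζ)ᵐᵒᵖ :=
  lift (op (Kinv d ζ)) (op (-(Kinv d ζ * E d ζ)))
    (by rw [← op_pow, Kinv_pow, op_one])
    (by
      rw [← op_pow, neg_pow, Kinv_mul_E, smul_pow, mul_pow_eq_zero _ _ _ Kinv_mul_E _ E_pow,
        smul_zero, mul_zero, op_zero])
    (by
      rw [← op_mul, ← op_mul, ← op_smul, neg_mul, mul_neg, smul_neg, mul_assoc (Kinv d ζ),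
        E_mul_Kinv, mul_smul_comm])

variable (d ζ) in
/-- The antipode of `B` as a linear map. -/
def S : Taft d ζ →ₗ[ℂ] Taft d ζ :=
  (MulOpposite.opLinearEquiv ℂ).symm.toLinearMap ∘ₗ (antipodeHom d ζ).toLinearMap

variable (d ζ) in
/-- The inverse of the antipode of `B` as a linear map. -/
def Sinv : Taft d ζ →ₗ[ℂ] Taft d ζ :=
  (MulOpposite.opLinearEquiv ℂ).symm.toLinearMap ∘ₗ (antipodeInvHom d ζ).toLinearMap

theorem S_mul (a b : Taft d ζ) : S d ζ (a * b) = S d ζ b * S d ζ a := by simp [S]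

theorem S_algebraMap (c : ℂ) : S d ζ (algebraMap ℂ _ c) = algebraMap ℂ _ c := by
  simp [S, AlgHom.commutes]

theorem Sinv_algebraMap (c : ℂ) : Sinv d ζ (algebraMap ℂ _ c) = algebraMap ℂ _ c := by
  simp [Sinv, AlgHom.commutes]

@[simp] theorem S_one : S d ζ 1 = 1 := by simp [S]

@[simp] theorem Sinv_one : Sinv d ζ 1 = 1 := by simp [Sinv]

@[simp] theorem S_K : S d ζ (K d ζ) = Kinv d ζ := by simp [S, antipodeHom, lift_K]

@[simp] theorem S_E : S d ζ (E d ζ) = -(E d ζ * Kinv d ζ) := by simp [S, antipodeHom, lift_E]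

theorem Sinv_mul (a b : Taft d ζ) : Sinv d ζ (a * b) = Sinv d ζ b * Sinv d ζ a := by simp [Sinv]

@[simp] theorem Sinv_K : Sinv d ζ (K d ζ) = Kinv d ζ := by simp [Sinv, antipodeInvHom, lift_K]

@[simp] theorem Sinv_E : Sinv d ζ (E d ζ) = -(Kinv d ζ * E d ζ) := by
  simp [Sinv, antipodeInvHom, lift_E]

theorem eq_Kinv (a : Taft d ζ) (h : a * Kinv d ζ = 1) : a = K d ζ := by
  rw [← mul_one a, ← Kinv_mul_K, ← mul_assoc, h, one_mul]

theorem S_Kinv : S d ζ (Kinv d ζ) = K d ζ :=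
  eq_Kinv _ (by nth_rw 2 [← S_K]; rw [← S_mul, K_mul_Kinv, S_one])

theorem Sinv_Kinv : Sinv d ζ (Kinv d ζ) = K d ζ :=
  eq_Kinv _ (by nth_rw 2 [← Sinv_K]; rw [← Sinv_mul, K_mul_Kinv, Sinv_one])

theorem S_Sinv (a : Taft d ζ) : S d ζ (Sinv d ζ a) = a := by
  induction a using Taft.induction with
  | hc c => rw [Sinv_algebraMap, S_algebraMap]
  | hK => rw [Sinv_K, S_Kinv]
  | hE => rw [Sinv_E, map_neg, S_mul, S_E, S_Kinv, neg_mul, neg_neg, mul_assoc, Kinv_mul_K, mul_one]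
  | hadd a b ha hb => rw [map_add, map_add, ha, hb]
  | hmul a b ha hb => rw [Sinv_mul, S_mul, ha, hb]

theorem Sinv_S (a : Taft d ζ) : Sinv d ζ (S d ζ a) = a := by
  induction a using Taft.induction with
  | hc c => rw [S_algebraMap, Sinv_algebraMap]
  | hK => rw [S_K, Sinv_Kinv]
  | hE => rw [S_E, map_neg, Sinv_mul, Sinv_E, Sinv_Kinv, mul_neg, neg_neg, ← mul_assoc, K_mul_Kinv,
      one_mul]
  | hadd a b ha hb => rw [map_add, map_add, ha, hb]
  | hmul a b ha hb => rw [S_mul, Sinv_mul, ha, hb]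

/-- `B` is a Hopf algebra. -/
instance : HopfAlgebra ℂ (Taft d ζ) where
  antipode := S d ζ
  mul_antipode_rTensor_comul := by
    ext a
    simp only [LinearMap.comp_apply, Algebra.linearMap_apply]
    induction a using Taft.induction with
    | hc c => simp [Algebra.TensorProduct.algebraMap_apply, S_algebraMap]
    | hK => simp [Kinv_mul_K]
    | hE => simp [mul_assoc, Kinv_mul_K]
    | hadd a b ha hb => simp only [map_add, ha, hb]
    | hmul a b ha hb =>
      have key : ∀ x y : Taft d ζ ⊗[ℂ] Taft d ζ, ∀ c : ℂ,
          LinearMap.mul' ℂ _ ((S d ζ).rTensor _ x) = algebraMap ℂ _ c →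
          LinearMap.mul' ℂ _ ((S d ζ).rTensor _ (x * y)) =
            c • LinearMap.mul' ℂ _ ((S d ζ).rTensor _ y) := by
        intro x y c hx
        have aux : ∀ u v : Taft d ζ, LinearMap.mul' ℂ _ ((S d ζ).rTensor _ (x * u ⊗ₜ v)) =
            S d ζ u * LinearMap.mul' ℂ _ ((S d ζ).rTensor _ x) * v := by
          intro u v
          clear hx
          induction x with
          | zero => simp
          | tmul p q => simp [S_mul, mul_assoc]
          | add p q hp hq => simp only [add_mul, map_add, hp, hq, mul_add]
        induction y with
        | zero => simp
        | tmul u v =>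
          rw [aux, hx, ← Algebra.commutes, mul_assoc, ← Algebra.smul_def]
          simp
        | add p q hp hq => rw [mul_add, map_add, map_add, hp, hq, map_add, map_add, smul_add]
      rw [Bialgebra.comul_mul, key _ _ _ ha, hb, Bialgebra.counit_mul, map_mul, Algebra.smul_def]
  mul_antipode_lTensor_comul := by
    ext a
    simp only [LinearMap.comp_apply, Algebra.linearMap_apply]
    induction a using Taft.induction with
    | hc c => simp [Algebra.TensorProduct.algebraMap_apply]
    | hK => simp [K_mul_Kinv]
    | hE => simp
    | hadd a b ha hb => simp only [map_add, ha, hb]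
    | hmul a b ha hb =>
      have key : ∀ x y : Taft d ζ ⊗[ℂ] Taft d ζ, ∀ c : ℂ,
          LinearMap.mul' ℂ _ ((S d ζ).lTensor _ y) = algebraMap ℂ _ c →
          LinearMap.mul' ℂ _ ((S d ζ).lTensor _ (x * y)) =
            c • LinearMap.mul' ℂ _ ((S d ζ).lTensor _ x) := by
        intro x y c hy
        have aux : ∀ u v : Taft d ζ, LinearMap.mul' ℂ _ ((S d ζ).lTensor _ (u ⊗ₜ v * y)) =
            u * LinearMap.mul' ℂ _ ((S d ζ).lTensor _ y) * S d ζ v := by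
          intro u v
          clear hy
          induction y with
          | zero => simp
          | tmul p q => simp [S_mul, mul_assoc]
          | add p q hp hq => simp only [add_mul, map_add, hp, hq, mul_add]
        induction x with
        | zero => simp
        | tmul u v =>
          rw [aux, hy, ← Algebra.commutes, mul_assoc, ← Algebra.smul_def]
          simp
        | add p q hp hq => rw [add_mul, map_add, map_add, hp, hq, map_add, map_add, smul_add]
      rw [Bialgebra.comul_mul, key _ _ _ hb, ha, Algebra.smul_def, ← map_mul, Bialgebra.counit_mul,
        mul_comm]

theorem E_pow_mul_K_pow_mem (i j : ℕ) :
    E d ζ ^ i * K d ζ ^ j ∈ Submodule.span ℂ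
      (Set.range fun x : Fin d × Fin d => E d ζ ^ (x.1 : ℕ) * K d ζ ^ (x.2 : ℕ)) := by
  have hd : 0 < d := Nat.pos_of_ne_zero (d_ne_zero d)
  rcases Nat.lt_or_ge i d with h | h
  · rw [← Nat.div_add_mod j d, pow_add, pow_mul, K_pow, one_pow, one_mul]
    exact Submodule.subset_span ⟨(⟨i, h⟩, ⟨j % d, Nat.mod_lt _ hd⟩), rfl⟩
  · rw [pow_eq_zero_of_le h E_pow, zero_mul]
    exact Submodule.zero_mem _

theorem K_mul_E_pow (i : ℕ) : K d ζ * E d ζ ^ i = ζ ^ i • (E d ζ ^ i * K d ζ) := by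
  induction i with
  | zero => simp
  | succ i ih =>
    rw [pow_succ, ← mul_assoc, ih, smul_mul_assoc, mul_assoc, K_mul_E, mul_smul_comm, smul_smul,
      ← pow_succ, mul_assoc]

/-- The elements `E ^ i K ^ j` with `0 ≤ i, j < d` span `B`. -/
theorem span_eq_top : Submodule.span ℂ
    (Set.range fun x : Fin d × Fin d => E d ζ ^ (x.1 : ℕ) * K d ζ ^ (x.2 : ℕ)) = ⊤ := by
  set W := Submodule.span ℂ
    (Set.range fun x : Fin d × Fin d => E d ζ ^ (x.1 : ℕ) * K d ζ ^ (x.2 : ℕ)) with hW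
  have key : ∀ a : Taft d ζ, ∀ w ∈ W, a * w ∈ W := by
    intro a
    induction a using Taft.induction with
    | hc c =>
      intro w hw
      rw [← Algebra.smul_def]
      exact W.smul_mem c hw
    | hK =>
      intro w hw
      induction hw using Submodule.span_induction with
      | mem x hx =>
        obtain ⟨⟨i, j⟩, rfl⟩ := hx
        dsimp only
        rw [← mul_assoc, K_mul_E_pow, smul_mul_assoc, mul_assoc, ← pow_succ']
        exact W.smul_mem _ (E_pow_mul_K_pow_mem _ _)
      | zero => rw [mul_zero]; exact W.zero_mem
      | add x y _ _ hx hy => rw [mul_add]; exact W.add_mem hx hy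
      | smul c x _ hx => rw [mul_smul_comm]; exact W.smul_mem c hx
    | hE =>
      intro w hw
      induction hw using Submodule.span_induction with
      | mem x hx =>
        obtain ⟨⟨i, j⟩, rfl⟩ := hx
        dsimp only
        rw [← mul_assoc, ← pow_succ']
        exact E_pow_mul_K_pow_mem _ _
      | zero => rw [mul_zero]; exact W.zero_mem
      | add x y _ _ hx hy => rw [mul_add]; exact W.add_mem hx hy
      | smul c x _ hx => rw [mul_smul_comm]; exact W.smul_mem c hx
    | hadd a b ha hb => intro w hw; rw [add_mul]; exact W.add_mem (ha w hw) (hb w hw)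
    | hmul a b ha hb => intro w hw; rw [mul_assoc]; exact ha _ (hb w hw)
  rw [eq_top_iff]
  intro a _
  have h1 : (1 : Taft d ζ) ∈ W := by simpa using E_pow_mul_K_pow_mem (d := d) (ζ := ζ) 0 0
  simpa using key a 1 h1

instance : FiniteDimensional ℂ (Taft d ζ) :=
  Module.finite_def.2 (span_eq_top (d := d) (ζ := ζ) ▸ Submodule.fg_span (Set.finite_range _))

end Taft

open Taft

variable {d : ℕ} {ζ : ℂ} [Fact (2 ≤ d)] [Fact (IsPrimitiveRoot ζ d)]

/-! ### The dual algebra -/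

variable (d ζ) in
/-- The dual `B^*` of the Taft algebra, with the convolution product
`(f g)(x) = ∑ f(x₁) g(x₂)`. -/
abbrev TaftDual : Type := WithConv (Taft d ζ →ₗ[ℂ] ℂ)

namespace TaftDual

/-- A morphism of algebras `B → ℂ` seen as an element of `B^*`. -/
def ofHom (f : Taft d ζ →ₐ[ℂ] ℂ) : TaftDual d ζ := WithConv.toConv f.toLinearMap

theorem ofHom_mul (f g : Taft d ζ →ₐ[ℂ] ℂ) :
    ofHom f * ofHom g =
      ofHom ((Algebra.TensorProduct.lift f g fun _ _ => Commute.all _ _).comp (comulHom d ζ)) := by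
  refine WithConv.ext (LinearMap.ext fun x => ?_)
  change LinearMap.mul' ℂ ℂ (TensorProduct.map f.toLinearMap g.toLinearMap (comulHom d ζ x)) =
    Algebra.TensorProduct.lift f g (fun _ _ => Commute.all _ _) (comulHom d ζ x)
  induction comulHom d ζ x with
  | zero => simp
  | tmul a b => simp
  | add a b ha hb => simp only [map_add, ha, hb]

theorem one_eq : (1 : TaftDual d ζ) = ofHom (counitHom d ζ) := rfl

variable (d ζ) in
/-- The morphism of algebras `B → ℂ` with `K ↦ ζ` and `E ↦ 0`. -/
def charK : Taft d ζ →ₐ[ℂ] ℂ :=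
  lift ζ 0 (prim d ζ).pow_eq_one (zero_pow (d_ne_zero d)) (by simp)

variable (d ζ) in
/-- The morphism of algebras `B → ℂ` with `K ↦ ζ⁻¹` and `E ↦ 0`. -/
def charKinv : Taft d ζ →ₐ[ℂ] ℂ :=
  lift ζ⁻¹ 0 (by rw [inv_pow, (prim d ζ).pow_eq_one, inv_one]) (zero_pow (d_ne_zero d)) (by simp)

variable (d ζ) in
/-- The element `K^*` of `B^*`, as a unit: `K^*(E ^ i K ^ j) = δ_{i,0} ζ ^ j`. -/
def Kst : (TaftDual d ζ)ˣ where
  val := ofHom (charK d ζ)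
  inv := ofHom (charKinv d ζ)
  val_inv := by
    rw [ofHom_mul, one_eq]
    congr 1
    exact hom_ext (by simp [charK, charKinv, lift_K, zeta_ne_zero d ζ])
      (by simp [charK, charKinv, lift_K, lift_E])
  inv_val := by
    rw [ofHom_mul, one_eq]
    congr 1
    exact hom_ext (by simp [charK, charKinv, lift_K, zeta_ne_zero d ζ])
      (by simp [charK, charKinv, lift_K, lift_E])

variable (d ζ) in
/-- The representation `K ↦ diag(ζ, 1)`, `E ↦ e₁₂` of `B` on `ℂ²`. -/
def rep2 : Taft d ζ →ₐ[ℂ] Matrix (Fin 2) (Fin 2) ℂ :=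
  lift !![ζ, 0; 0, 1] !![0, 1; 0, 0]
    (by
      have : ∀ n : ℕ, (!![ζ, 0; 0, 1] : Matrix (Fin 2) (Fin 2) ℂ) ^ n = !![ζ ^ n, 0; 0, 1] := by
        intro n
        induction n with
        | zero => simp [Matrix.one_fin_two]
        | succ n ih => rw [pow_succ, ih]; simp [pow_succ]
      rw [this, (prim d ζ).pow_eq_one, Matrix.one_fin_two])
    (by
      have h2 : (!![0, 1; 0, 0] : Matrix (Fin 2) (Fin 2) ℂ) ^ 2 = 0 := by
        rw [pow_two, Matrix.mul_fin_two]
        ext i j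
        fin_cases i <;> fin_cases j <;> simp
      exact pow_eq_zero_of_le (Fact.out : 2 ≤ d) h2)
    (by simp)

variable (d ζ) in
/-- The element `E^*` of `B^*`, the linear form with `E^*(E ^ i K ^ j) = δ_{i,1}`
(see `Est_apply`), written as a matrix coefficient. -/
def Est : TaftDual d ζ :=
  WithConv.toConv
    { toFun := fun x => rep2 d ζ x 0 1
      map_add' := fun x y => by simp
      map_smul' := fun c x => by simp }

theorem Kst_apply (i j : ℕ) :
    (Kst d ζ : TaftDual d ζ) (E d ζ ^ i * K d ζ ^ j) = if i = 0 then ζ ^ j else 0 := by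
  change charK d ζ _ = _
  rw [map_mul, map_pow, map_pow, charK, lift_K, lift_E]
  split_ifs with h
  · simp [h]
  · simp [h]

theorem Est_apply (i j : ℕ) : Est d ζ (E d ζ ^ i * K d ζ ^ j) = if i = 1 then 1 else 0 := by
  change rep2 d ζ _ 0 1 = _
  have hK : ∀ n : ℕ, (!![ζ, 0; 0, 1] : Matrix (Fin 2) (Fin 2) ℂ) ^ n = !![ζ ^ n, 0; 0, 1] := by
    intro n
    induction n with
    | zero => simp [Matrix.one_fin_two]
    | succ n ih => rw [pow_succ, ih]; simp [pow_succ]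
  rw [map_mul, map_pow, map_pow, rep2, lift_K, lift_E, hK]
  match i with
  | 0 => simp
  | 1 => simp
  | n + 2 =>
    have h2 : (!![0, 1; 0, 0] : Matrix (Fin 2) (Fin 2) ℂ) ^ 2 = 0 := by
      rw [pow_two, Matrix.mul_fin_two]
      ext i j
      fin_cases i <;> fin_cases j <;> simp
    rw [pow_add, h2]
    simp

variable (d ζ) in
/-- For `x` in `B`, the operator `g ↦ g(? x)` on `B^*`. -/
def shiftR : Taft d ζ →ₐ[ℂ] Module.End ℂ (TaftDual d ζ) where
  toFun x :=
    { toFun := fun g => WithConv.toConv (g.ofConv ∘ₗ LinearMap.mulRight ℂ x)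
      map_add' := fun _ _ => rfl
      map_smul' := fun _ _ => rfl }
  map_one' := by ext g t; simp
  map_mul' x y := by
    ext g t
    change g.ofConv (t * (x * y)) = g.ofConv (t * x * y)
    rw [mul_assoc]
  map_zero' := by ext g t; simp
  map_add' x y := by
    ext g t
    change g.ofConv (t * (x + y)) = g.ofConv (t * x) + g.ofConv (t * y)
    rw [mul_add, map_add]
  commutes' c := by ext g t; simp [Algebra.algebraMap_eq_smul_one]

variable (d ζ) in
/-- For `w` in `B`, the operator `g ↦ g(w ?)` on `B^*`. -/
def shiftL : (Taft d ζ)ᵐᵒᵖ →ₐ[ℂ] Module.End ℂ (TaftDual d ζ) where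
  toFun w :=
    { toFun := fun g => WithConv.toConv (g.ofConv ∘ₗ LinearMap.mulLeft ℂ w.unop)
      map_add' := fun _ _ => rfl
      map_smul' := fun _ _ => rfl }
  map_one' := by ext g t; simp
  map_mul' x y := by
    ext g t
    change g.ofConv (y.unop * x.unop * t) = g.ofConv (y.unop * (x.unop * t))
    rw [mul_assoc]
  map_zero' := by ext g t; simp
  map_add' x y := by
    ext g t
    change g.ofConv ((x.unop + y.unop) * t) = g.ofConv (x.unop * t) + g.ofConv (y.unop * t)
    rw [add_mul, map_add]
  commutes' c := by ext g t; simp [Algebra.algebraMap_eq_smul_one]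

theorem shiftR_apply (x : Taft d ζ) (g : TaftDual d ζ) (t : Taft d ζ) :
    (shiftR d ζ x g) t = g (t * x) := rfl

theorem shiftL_apply (w : (Taft d ζ)ᵐᵒᵖ) (g : TaftDual d ζ) (t : Taft d ζ) :
    (shiftL d ζ w g) t = g (w.unop * t) := rfl

theorem shift_commute (x : Taft d ζ) (w : (Taft d ζ)ᵐᵒᵖ) :
    Commute (shiftR d ζ x) (shiftL d ζ w) := by
  ext g t
  change g.ofConv (w.unop * (t * x)) = g.ofConv (w.unop * t * x)
  rw [mul_assoc]

theorem mul_apply_of_comul (g h : TaftDual d ζ) (t : Taft d ζ) :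
    (g * h) t = LinearMap.mul' ℂ ℂ (TensorProduct.map g.ofConv h.ofConv (comulHom d ζ t)) := rfl

theorem comulHom_Kinv : comulHom d ζ (Kinv d ζ) = Kinv d ζ ⊗ₜ Kinv d ζ := by
  rw [Kinv, map_pow, comulHom_K, Algebra.TensorProduct.tmul_pow]

theorem shiftL_K_Kinv (g : TaftDual d ζ) :
    shiftL d ζ (.op (K d ζ)) (shiftL d ζ (.op (Kinv d ζ)) g) = g := by
  rw [← Module.End.mul_apply, ← map_mul, ← MulOpposite.op_mul, Kinv_mul_K, MulOpposite.op_one,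
    map_one, Module.End.one_apply]

theorem shiftL_mul_of_groupLike (a : Taft d ζ) (ha : comulHom d ζ a = a ⊗ₜ a)
    (g h : TaftDual d ζ) :
    shiftL d ζ (.op a) (g * h) = shiftL d ζ (.op a) g * shiftL d ζ (.op a) h := by
  refine WithConv.ext (LinearMap.ext fun t => ?_)
  change (g * h) (a * t) = (shiftL d ζ (.op a) g * shiftL d ζ (.op a) h) t
  rw [mul_apply_of_comul, mul_apply_of_comul, map_mul, ha]
  induction comulHom d ζ t with
  | zero => simp
  | tmul a b => rw [Algebra.TensorProduct.tmul_mul_tmul]; rfl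
  | add a b ha hb => simp only [map_add, ha, hb, mul_add]

theorem shiftR_K_mul (g h : TaftDual d ζ) :
    shiftR d ζ (K d ζ) (g * h) = shiftR d ζ (K d ζ) g * shiftR d ζ (K d ζ) h := by
  refine WithConv.ext (LinearMap.ext fun t => ?_)
  change (g * h) (t * K d ζ) = (shiftR d ζ (K d ζ) g * shiftR d ζ (K d ζ) h) t
  rw [mul_apply_of_comul, mul_apply_of_comul, map_mul, comulHom_K]
  induction comulHom d ζ t with
  | zero => simp
  | tmul a b => rw [Algebra.TensorProduct.tmul_mul_tmul]; rfl
  | add a b ha hb => simp only [map_add, ha, hb, add_mul]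

theorem shiftL_E_mul (g h : TaftDual d ζ) :
    shiftL d ζ (.op (E d ζ)) (g * h) =
      g * shiftL d ζ (.op (E d ζ)) h +
        shiftL d ζ (.op (E d ζ)) g * shiftL d ζ (.op (K d ζ)) h := by
  refine WithConv.ext (LinearMap.ext fun t => ?_)
  change (g * h) (E d ζ * t) = (g * shiftL d ζ (.op (E d ζ)) h) t +
        (shiftL d ζ (.op (E d ζ)) g * shiftL d ζ (.op (K d ζ)) h) t
  rw [mul_apply_of_comul, mul_apply_of_comul, mul_apply_of_comul, map_mul, comulHom_E]
  induction comulHom d ζ t with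
  | zero => simp
  | tmul a b =>
    rw [add_mul, Algebra.TensorProduct.tmul_mul_tmul, Algebra.TensorProduct.tmul_mul_tmul, one_mul,
      map_add, map_add]
    rfl
  | add a b ha hb => simp only [map_add, ha, hb, mul_add]; ring

theorem shiftR_E_mul (g h : TaftDual d ζ) :
    shiftR d ζ (E d ζ) (g * h) =
      g * shiftR d ζ (E d ζ) h + shiftR d ζ (E d ζ) g * shiftR d ζ (K d ζ) h := by
  refine WithConv.ext (LinearMap.ext fun t => ?_)
  change (g * h) (t * E d ζ) = (g * shiftR d ζ (E d ζ) h) t +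
    (shiftR d ζ (E d ζ) g * shiftR d ζ (K d ζ) h) t
  rw [mul_apply_of_comul, mul_apply_of_comul, mul_apply_of_comul, map_mul, comulHom_E]
  induction comulHom d ζ t with
  | zero => simp
  | tmul a b =>
    rw [mul_add, Algebra.TensorProduct.tmul_mul_tmul, Algebra.TensorProduct.tmul_mul_tmul, mul_one,
      map_add, map_add]
    rfl
  | add a b ha hb => simp only [map_add, ha, hb, add_mul]; ring

end TaftDual

/-! ### The Drinfeld double -/

variable (d ζ) in
/-- The vector space `B^* ⊗ B`. -/
abbrev DoubleSpace : Type := TaftDual d ζ ⊗[ℂ] Taft d ζ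

namespace DoubleSpace

variable (d ζ) in
/-- The pure tensors `f ⊗ a` in `D(B)`. -/
def mk : TaftDual d ζ →ₗ[ℂ] Taft d ζ →ₗ[ℂ] DoubleSpace d ζ := TensorProduct.mk ℂ _ _

theorem induction {P : DoubleSpace d ζ → Prop} (hmk : ∀ f a, P (mk d ζ f a))
    (hadd : ∀ x y, P x → P y → P (x + y)) (x : DoubleSpace d ζ) : P x :=
  TensorProduct.induction_on (motive := P) x
    (by have := hmk 0 0; rwa [map_zero] at this) hmk hadd

variable (d ζ) in
/-- The operator `g ⊗ b ↦ g(w ? x) ⊗ y b` on `B^* ⊗ B`, as a function of `x ⊗ (y ⊗ w)`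
(see `sandwich_apply`). -/
def sandwich : Taft d ζ ⊗[ℂ] (Taft d ζ ⊗[ℂ] (Taft d ζ)ᵐᵒᵖ) →ₐ[ℂ] Module.End ℂ (DoubleSpace d ζ) :=
  Algebra.TensorProduct.lift
    ((Module.End.rTensorAlgHom ℂ (TaftDual d ζ) (Taft d ζ)).comp (TaftDual.shiftR d ζ))
    (Algebra.TensorProduct.lift
      ((Module.End.lTensorAlgHom ℂ (Taft d ζ) (TaftDual d ζ)).comp (Algebra.lmul ℂ (Taft d ζ)))
      ((Module.End.rTensorAlgHom ℂ (TaftDual d ζ) (Taft d ζ)).comp (TaftDual.shiftL d ζ))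
      (fun y w => TensorProduct.ext' fun g b => rfl))
    (fun x v => by
      refine TensorProduct.ext' fun g b => ?_
      induction v with
      | zero => simp
      | tmul y w =>
        have h := LinearMap.congr_fun (TaftDual.shift_commute x w).eq g
        exact congrArg (fun g' => g' ⊗ₜ[ℂ] (y * b)) h
      | add v v' hv hv' =>
        simp only [map_add, mul_add, add_mul, LinearMap.add_apply] at hv hv' ⊢
        rw [hv, hv'])

theorem sandwich_apply (x y w b : Taft d ζ) (g : TaftDual d ζ) :
    sandwich d ζ (x ⊗ₜ (y ⊗ₜ .op w)) (mk d ζ g b) =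
      mk d ζ (TaftDual.shiftR d ζ x (TaftDual.shiftL d ζ (.op w) g)) (y * b) := rfl

variable (d ζ) in
/-- The operator `g ⊗ b ↦ ∑ g(S⁻¹(a₃) ? a₁) ⊗ a₂ b` on `B^* ⊗ B`, as a function of `a`; it is the
left multiplication by `1 ⊗ a` in `D(B)`. -/
def leftB : Taft d ζ →ₐ[ℂ] Module.End ℂ (DoubleSpace d ζ) :=
  (sandwich d ζ).comp
    ((Algebra.TensorProduct.map (AlgHom.id ℂ _)
      ((Algebra.TensorProduct.map (AlgHom.id ℂ _) (antipodeInvHom d ζ)).comp (comulHom d ζ))).comp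
      (comulHom d ζ))

variable (d ζ) in
/-- The operator `g ⊗ b ↦ f g ⊗ b` on `B^* ⊗ B`, as a function of `f`. -/
def leftDual : TaftDual d ζ →ₐ[ℂ] Module.End ℂ (DoubleSpace d ζ) :=
  (Module.End.rTensorAlgHom ℂ (TaftDual d ζ) (Taft d ζ)).comp (Algebra.lmul ℂ (TaftDual d ζ))

theorem leftDual_mk (f g : TaftDual d ζ) (b : Taft d ζ) :
    leftDual d ζ f (mk d ζ g b) = mk d ζ (f * g) b := rfl

variable (d ζ) in
/-- The multiplication of `D(B)`:
`(f ⊗ a)(g ⊗ b) = ∑ f g(S⁻¹(a₃) ? a₁) ⊗ a₂ b`. -/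
def mulHom : DoubleSpace d ζ →ₗ[ℂ] Module.End ℂ (DoubleSpace d ζ) :=
  TensorProduct.lift ((LinearMap.mul ℂ (Module.End ℂ (DoubleSpace d ζ))).compl₁₂
    (leftDual d ζ).toLinearMap (leftB d ζ).toLinearMap)

theorem mulHom_mk (f : TaftDual d ζ) (a : Taft d ζ) :
    mulHom d ζ (mk d ζ f a) = leftDual d ζ f * leftB d ζ a := rfl

theorem leftB_K (g : TaftDual d ζ) (b : Taft d ζ) :
    leftB d ζ (K d ζ) (mk d ζ g b) =
      mk d ζ (TaftDual.shiftR d ζ (K d ζ) (TaftDual.shiftL d ζ (.op (Kinv d ζ)) g))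
        (K d ζ * b) := by
  have : leftB d ζ (K d ζ) = sandwich d ζ (K d ζ ⊗ₜ (K d ζ ⊗ₜ .op (Kinv d ζ))) := by
    simp [leftB, antipodeInvHom, lift_K]
  rw [this, sandwich_apply]

theorem leftB_E (g : TaftDual d ζ) (b : Taft d ζ) :
    leftB d ζ (E d ζ) (mk d ζ g b) =
      -mk d ζ (TaftDual.shiftL d ζ (.op (E d ζ)) (TaftDual.shiftL d ζ (.op (Kinv d ζ)) g)) b +
      mk d ζ (TaftDual.shiftL d ζ (.op (Kinv d ζ)) g) (E d ζ * b) +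
      mk d ζ (TaftDual.shiftR d ζ (E d ζ) (TaftDual.shiftL d ζ (.op (Kinv d ζ)) g))
        (K d ζ * b) := by
  have : leftB d ζ (E d ζ) = sandwich d ζ (1 ⊗ₜ (1 ⊗ₜ .op (-(Kinv d ζ * E d ζ)))) +
      sandwich d ζ (1 ⊗ₜ (E d ζ ⊗ₜ .op (Kinv d ζ))) +
      sandwich d ζ (E d ζ ⊗ₜ (K d ζ ⊗ₜ .op (Kinv d ζ))) := by
    simp [leftB, antipodeInvHom, lift_K, lift_E, TensorProduct.tmul_add]
  rw [this, LinearMap.add_apply, LinearMap.add_apply, sandwich_apply, sandwich_apply,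
    sandwich_apply]
  simp

theorem mulHom_leftB (a : Taft d ζ) (y : DoubleSpace d ζ) :
    mulHom d ζ (leftB d ζ a y) = leftB d ζ a * mulHom d ζ y := by
  induction a using Taft.induction generalizing y with
  | hc c => simp [Algebra.algebraMap_eq_smul_one]
  | hK =>
    induction y using DoubleSpace.induction with
    | hadd x y hx hy => simp only [map_add, hx, hy, mul_add]
    | hmk g b =>
      rw [leftB_K, mulHom_mk, mulHom_mk, map_mul, ← mul_assoc, ← mul_assoc]
      congr 1
      refine LinearMap.ext fun x => ?_
      induction x using DoubleSpace.induction with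
      | hadd x y hx hy => rw [map_add, map_add, hx, hy]
      | hmk h c =>
        rw [Module.End.mul_apply, Module.End.mul_apply, leftB_K, leftDual_mk, leftDual_mk, leftB_K,
          TaftDual.shiftL_mul_of_groupLike _ TaftDual.comulHom_Kinv, TaftDual.shiftR_K_mul]
  | hE =>
    induction y using DoubleSpace.induction with
    | hadd x y hx hy => simp only [map_add, hx, hy, mul_add]
    | hmk g b =>
      rw [leftB_E, map_add, map_add, map_neg, mulHom_mk, mulHom_mk, mulHom_mk, mulHom_mk, map_mul,
        map_mul]
      refine LinearMap.ext fun x => ?_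
      simp only [LinearMap.add_apply, LinearMap.neg_apply, Module.End.mul_apply]
      generalize leftB d ζ b x = x
      induction x using DoubleSpace.induction with
      | hadd x y hx hy => simp only [map_add, neg_add, ← hx, ← hy]; abel
      | hmk h c =>
        simp only [LinearMap.add_apply, leftB_K, leftB_E, leftDual_mk,
          TaftDual.shiftL_mul_of_groupLike _ TaftDual.comulHom_Kinv, TaftDual.shiftR_E_mul,
          TaftDual.shiftL_E_mul, map_add, map_neg]
        rw [TaftDual.shiftL_K_Kinv]
        abel
  | hadd a b ha hb => simp only [map_add, LinearMap.add_apply, ha, hb, add_mul]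
  | hmul a b ha hb => rw [map_mul, Module.End.mul_apply, ha, hb, mul_assoc]

theorem mulHom_leftDual (f : TaftDual d ζ) (y : DoubleSpace d ζ) :
    mulHom d ζ (leftDual d ζ f y) = leftDual d ζ f * mulHom d ζ y := by
  induction y using DoubleSpace.induction with
  | hadd x y hx hy => simp only [map_add, hx, hy, mul_add]
  | hmk g b => rw [leftDual_mk, mulHom_mk, mulHom_mk, map_mul, mul_assoc]

theorem mulHom_mulHom (x y z : DoubleSpace d ζ) :
    mulHom d ζ (mulHom d ζ x y) z = mulHom d ζ x (mulHom d ζ y z) := by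
  induction x using DoubleSpace.induction with
  | hadd x x' hx hx' => simp only [map_add, LinearMap.add_apply, hx, hx']
  | hmk f a =>
    rw [mulHom_mk, Module.End.mul_apply, mulHom_leftDual, mulHom_leftB]
    rfl

theorem leftB_one (a b : Taft d ζ) : leftB d ζ a (mk d ζ 1 b) = mk d ζ 1 (a * b) := by
  have h1 : TaftDual.shiftL d ζ (.op (Kinv d ζ)) 1 = 1 := by
    ext t
    change counitHom d ζ (Kinv d ζ * t) = counitHom d ζ t
    rw [map_mul, Kinv, map_pow, counitHom_K, one_pow, one_mul]
  have h2 : TaftDual.shiftR d ζ (K d ζ) 1 = 1 := by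
    ext t
    change counitHom d ζ (t * K d ζ) = counitHom d ζ t
    rw [map_mul, counitHom_K, mul_one]
  have h3 : TaftDual.shiftL d ζ (.op (E d ζ)) 1 = 0 := by
    ext t
    change counitHom d ζ (E d ζ * t) = 0
    rw [map_mul, counitHom_E, zero_mul]
  have h4 : TaftDual.shiftR d ζ (E d ζ) 1 = 0 := by
    ext t
    change counitHom d ζ (t * E d ζ) = 0
    rw [map_mul, counitHom_E, mul_zero]
  induction a using Taft.induction generalizing b with
  | hc c => simp [Algebra.algebraMap_eq_smul_one]
  | hK => rw [leftB_K, h1, h2]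
  | hE => simp [leftB_E, h1, h3, h4]
  | hadd x y hx hy => simp only [map_add, LinearMap.add_apply, hx, hy, add_mul]
  | hmul x y hx hy => rw [map_mul, Module.End.mul_apply, hy, hx, mul_assoc]

end DoubleSpace

variable (d ζ) in
/-- The Drinfeld double `D(B)` of the Hopf algebra `B`: the vector space `B^* ⊗ B` with the product
`(f ⊗ a)(g ⊗ b) = ∑ f g(S⁻¹(a₃) ? a₁) ⊗ a₂ b` and the unit `1 ⊗ 1`. -/
def Double : Type := DoubleSpace d ζ

namespace Double

instance : AddCommGroup (Double d ζ) := inferInstanceAs (AddCommGroup (DoubleSpace d ζ))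

instance : Module ℂ (Double d ζ) := inferInstanceAs (Module ℂ (DoubleSpace d ζ))

variable (d ζ) in
/-- The identification of `B^* ⊗ B` with the vector space underlying `D(B)`. -/
def ofSpace : DoubleSpace d ζ ≃ₗ[ℂ] Double d ζ := LinearEquiv.refl ℂ (DoubleSpace d ζ)

instance : Mul (Double d ζ) :=
  ⟨fun x y => ofSpace d ζ (DoubleSpace.mulHom d ζ ((ofSpace d ζ).symm x) ((ofSpace d ζ).symm y))⟩

instance : One (Double d ζ) := ⟨ofSpace d ζ (1 ⊗ₜ 1)⟩

theorem mul_def (x y : DoubleSpace d ζ) :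
    ofSpace d ζ x * ofSpace d ζ y = ofSpace d ζ (DoubleSpace.mulHom d ζ x y) := rfl

theorem one_def : (1 : Double d ζ) = ofSpace d ζ (DoubleSpace.mk d ζ 1 1) := rfl

instance : Ring (Double d ζ) :=
  { (inferInstance : AddCommGroup (Double d ζ)),
    (inferInstance : Mul (Double d ζ)), (inferInstance : One (Double d ζ)) with
    left_distrib := fun x y z => by
      obtain ⟨x, rfl⟩ := (ofSpace d ζ).surjective x
      obtain ⟨y, rfl⟩ := (ofSpace d ζ).surjective y
      obtain ⟨z, rfl⟩ := (ofSpace d ζ).surjective z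
      rw [← map_add, mul_def, mul_def, mul_def, ← map_add, map_add]
    right_distrib := fun x y z => by
      obtain ⟨x, rfl⟩ := (ofSpace d ζ).surjective x
      obtain ⟨y, rfl⟩ := (ofSpace d ζ).surjective y
      obtain ⟨z, rfl⟩ := (ofSpace d ζ).surjective z
      rw [← map_add, mul_def, mul_def, mul_def, ← map_add, map_add, LinearMap.add_apply]
    zero_mul := fun x => by
      obtain ⟨x, rfl⟩ := (ofSpace d ζ).surjective x
      rw [← map_zero (ofSpace d ζ), mul_def, map_zero, LinearMap.zero_apply]
    mul_zero := fun x => by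
      obtain ⟨x, rfl⟩ := (ofSpace d ζ).surjective x
      rw [← map_zero (ofSpace d ζ), mul_def, map_zero]
    mul_assoc := fun x y z => by
      obtain ⟨x, rfl⟩ := (ofSpace d ζ).surjective x
      obtain ⟨y, rfl⟩ := (ofSpace d ζ).surjective y
      obtain ⟨z, rfl⟩ := (ofSpace d ζ).surjective z
      rw [mul_def, mul_def, mul_def, mul_def, DoubleSpace.mulHom_mulHom]
    one_mul := fun x => by
      obtain ⟨x, rfl⟩ := (ofSpace d ζ).surjective x
      rw [one_def, mul_def, DoubleSpace.mulHom_mk, map_one, map_one, one_mul,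
        Module.End.one_apply]
    mul_one := fun x => by
      obtain ⟨x, rfl⟩ := (ofSpace d ζ).surjective x
      rw [one_def, mul_def]
      congr 1
      induction x using DoubleSpace.induction with
      | hadd x y hx hy => rw [map_add, LinearMap.add_apply, hx, hy]
      | hmk f a =>
        rw [DoubleSpace.mulHom_mk, Module.End.mul_apply, DoubleSpace.leftB_one,
          DoubleSpace.leftDual_mk, mul_one, mul_one] }

instance : Algebra ℂ (Double d ζ) :=
  Algebra.ofModule
    (fun c x y => by
      obtain ⟨x, rfl⟩ := (ofSpace d ζ).surjective x
      obtain ⟨y, rfl⟩ := (ofSpace d ζ).surjective y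
      rw [← map_smul, mul_def, mul_def, ← map_smul, map_smul, LinearMap.smul_apply])
    (fun c x y => by
      obtain ⟨x, rfl⟩ := (ofSpace d ζ).surjective x
      obtain ⟨y, rfl⟩ := (ofSpace d ζ).surjective y
      rw [← map_smul, mul_def, mul_def, ← map_smul, map_smul])

variable (d ζ) in
/-- The embedding `a ↦ 1 ⊗ a` of `B` in `D(B)`. -/
def inB : Taft d ζ →ₐ[ℂ] Double d ζ :=
  AlgHom.ofLinearMap ((ofSpace d ζ).toLinearMap ∘ₗ DoubleSpace.mk d ζ 1) rfl (fun a b => by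
    change ofSpace d ζ (DoubleSpace.mk d ζ 1 (a * b)) =
      ofSpace d ζ (DoubleSpace.mk d ζ 1 a) * ofSpace d ζ (DoubleSpace.mk d ζ 1 b)
    rw [mul_def, DoubleSpace.mulHom_mk, map_one (DoubleSpace.leftDual d ζ), one_mul, DoubleSpace.leftB_one])

variable (d ζ) in
/-- The embedding `f ↦ f ⊗ 1` of `B^*` in `D(B)`. -/
def inDual : TaftDual d ζ →ₐ[ℂ] Double d ζ :=
  AlgHom.ofLinearMap ((ofSpace d ζ).toLinearMap ∘ₗ (DoubleSpace.mk d ζ).flip 1) rfl (fun f g => by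
    change ofSpace d ζ (DoubleSpace.mk d ζ (f * g) 1) =
      ofSpace d ζ (DoubleSpace.mk d ζ f 1) * ofSpace d ζ (DoubleSpace.mk d ζ g 1)
    rw [mul_def, DoubleSpace.mulHom_mk, map_one (DoubleSpace.leftB d ζ), mul_one,
      DoubleSpace.leftDual_mk])

theorem inDual_mul_inB (f : TaftDual d ζ) (a : Taft d ζ) :
    inDual d ζ f * inB d ζ a = ofSpace d ζ (f ⊗ₜ a) := by
  change ofSpace d ζ (DoubleSpace.mk d ζ f 1) * ofSpace d ζ (DoubleSpace.mk d ζ 1 a) = _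
  rw [mul_def, DoubleSpace.mulHom_mk, map_one, mul_one, DoubleSpace.leftDual_mk, mul_one]
  rfl

theorem inB_mul (a : Taft d ζ) (x : DoubleSpace d ζ) :
    inB d ζ a * ofSpace d ζ x = ofSpace d ζ (DoubleSpace.leftB d ζ a x) := by
  change ofSpace d ζ (DoubleSpace.mk d ζ 1 a) * ofSpace d ζ x = _
  rw [mul_def, DoubleSpace.mulHom_mk, map_one, one_mul]

end Double

/-! ### Hopf structure, universal `R`-matrix and twist -/

namespace TaftDual

variable (d ζ) in
/-- The coproduct of `B^*`, dual to the product of `B` (see `dualDistrib_comul`). -/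
def comul : TaftDual d ζ →ₗ[ℂ] TaftDual d ζ ⊗[ℂ] TaftDual d ζ :=
  TensorProduct.map (WithConv.linearEquiv ℂ _).symm.toLinearMap
      (WithConv.linearEquiv ℂ _).symm.toLinearMap ∘ₗ
    (TensorProduct.dualDistribEquiv ℂ (Taft d ζ) (Taft d ζ)).symm.toLinearMap ∘ₗ
    (LinearMap.mul' ℂ (Taft d ζ)).dualMap ∘ₗ (WithConv.linearEquiv ℂ _).toLinearMap

theorem dualDistrib_comul (f : TaftDual d ζ) (x y : Taft d ζ) :
    TensorProduct.dualDistrib ℂ (Taft d ζ) (Taft d ζ)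
      (TensorProduct.map (WithConv.linearEquiv ℂ _).toLinearMap
        (WithConv.linearEquiv ℂ _).toLinearMap (comul d ζ f)) (x ⊗ₜ y) = f (x * y) := by
  have h : TensorProduct.map (WithConv.linearEquiv ℂ (Taft d ζ →ₗ[ℂ] ℂ)).toLinearMap
      (WithConv.linearEquiv ℂ (Taft d ζ →ₗ[ℂ] ℂ)).toLinearMap (comul d ζ f) =
      (TensorProduct.dualDistribEquiv ℂ (Taft d ζ) (Taft d ζ)).symm
        ((LinearMap.mul' ℂ (Taft d ζ)).dualMap f.ofConv) := by
    simp only [comul, LinearMap.comp_apply]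
    rw [← LinearMap.comp_apply (TensorProduct.map _ _), ← TensorProduct.map_comp]
    simp
  rw [h]
  exact LinearMap.congr_fun ((TensorProduct.dualDistribEquiv ℂ (Taft d ζ) (Taft d ζ)).apply_symm_apply
    ((LinearMap.mul' ℂ (Taft d ζ)).dualMap f.ofConv)) (x ⊗ₜ y)

variable (d ζ) in
/-- The antipode `f ↦ f ∘ S⁻¹` of the co-opposite Hopf algebra `(B^*)^cop`. -/
def antipodeCop : TaftDual d ζ →ₗ[ℂ] TaftDual d ζ where
  toFun f := WithConv.toConv (f.ofConv ∘ₗ Sinv d ζ)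
  map_add' _ _ := rfl
  map_smul' _ _ := rfl

end TaftDual

namespace Double

variable (d ζ) in
/-- The coproduct of `D(B)`: as a coalgebra, `D(B)` is `(B^*)^cop ⊗ B`, that is
`Δ(f ⊗ a) = ∑ (f₂ ⊗ a₁) ⊗ (f₁ ⊗ a₂)`. -/
def comul : Double d ζ →ₗ[ℂ] Double d ζ ⊗[ℂ] Double d ζ :=
  TensorProduct.map (ofSpace d ζ).toLinearMap (ofSpace d ζ).toLinearMap ∘ₗ
    (TensorProduct.tensorTensorTensorComm ℂ (TaftDual d ζ) (TaftDual d ζ) (Taft d ζ)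
      (Taft d ζ)).toLinearMap ∘ₗ
    TensorProduct.map ((TensorProduct.comm ℂ (TaftDual d ζ) (TaftDual d ζ)).toLinearMap ∘ₗ
      TaftDual.comul d ζ) Coalgebra.comul ∘ₗ
    (ofSpace d ζ).symm.toLinearMap

variable (d ζ) in
/-- The antipode of `D(B)`, the anti-homomorphism extending the antipodes of `B` and `(B^*)^cop`:
`S(f ⊗ a) = (1 ⊗ S(a)) (f ∘ S⁻¹ ⊗ 1)`. -/
def antipode : Double d ζ →ₗ[ℂ] Double d ζ :=
  TensorProduct.lift ((LinearMap.mul ℂ (Double d ζ)).flip.compl₁₂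
      ((inDual d ζ).toLinearMap ∘ₗ TaftDual.antipodeCop d ζ)
      ((inB d ζ).toLinearMap ∘ₗ S d ζ)) ∘ₗ
    (ofSpace d ζ).symm.toLinearMap

variable (d ζ) in
/-- The element `K` of `D(B)`, as a unit. -/
def K : (Double d ζ)ˣ :=
  Units.map (inB d ζ).toMonoidHom ⟨Taft.K d ζ, Kinv d ζ, K_mul_Kinv, Kinv_mul_K⟩

variable (d ζ) in
/-- The element `E` of `D(B)`. -/
def E : Double d ζ := inB d ζ (Taft.E d ζ)

variable (d ζ) in
/-- The element `K^*` of `D(B)`, as a unit. -/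
def Kst : (Double d ζ)ˣ := Units.map (inDual d ζ).toMonoidHom (TaftDual.Kst d ζ)

variable (d ζ) in
/-- The element `E^*` of `D(B)`. -/
def Est : Double d ζ := inDual d ζ (TaftDual.Est d ζ)

variable (d ζ) in
/-- The element `z = (K^*)⁻¹ K` of `D(B)`, as a unit. -/
def z : (Double d ζ)ˣ := (Kst d ζ)⁻¹ * K d ζ

variable (d ζ) in
/-- The element `F = ζ E^* (K^*)⁻¹` of `D(B)`. -/
def F : Double d ζ := ζ • (Est d ζ * ↑(Kst d ζ)⁻¹)

variable (d ζ) in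
/-- The element `β_{i,j}` of `B^* ⊆ D(B)`; for `0 ≤ i, j < d` these elements form the basis of `B^*`
dual to the basis `E ^ i K ^ j` of `B`. -/
def β (i j : ℕ) : Double d ζ :=
  ((d : ℂ) * qFact ζ i)⁻¹ •
    (Est d ζ ^ i * ∑ k ∈ Finset.range d, (ζ ^ (k * (i + j)))⁻¹ • (Kst d ζ : Double d ζ) ^ k)

variable (d ζ) in
/-- The universal `R`-matrix `∑ E ^ i K ^ j ⊗ β_{i,j}` of `D(B)`. -/
def R : Double d ζ ⊗[ℂ] Double d ζ :=
  ∑ i ∈ Finset.range d, ∑ j ∈ Finset.range d, (E d ζ ^ i * (K d ζ : Double d ζ) ^ j) ⊗ₜ β d ζ i j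

variable (d ζ) in
/-- The Drinfeld element `u = ∑ S(β_{i,j}) E ^ i K ^ j` of `D(B)`. -/
def u : Double d ζ :=
  ∑ i ∈ Finset.range d, ∑ j ∈ Finset.range d,
    antipode d ζ (β d ζ i j) * (E d ζ ^ i * (K d ζ : Double d ζ) ^ j)

variable (d ζ) in
/-- The element `θ = K⁻¹ u` of `D(B)`. -/
def θ : Double d ζ := ↑(K d ζ)⁻¹ * u d ζ

variable (d ζ) in
/-- The twist `θ₁ = z θ` attached to the pivot `z⁻¹ K`. -/
def θ₁ : Double d ζ := z d ζ * θ d ζ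

variable (d ζ) in
/-- The pivot `z⁻¹ K` of `D(B)`. -/
def pivot : (Double d ζ)ˣ := (z d ζ)⁻¹ * K d ζ

end Double

/-! ### Representations, braiding, quantum traces -/

section Rep

variable {V W : Type*} [AddCommGroup V] [Module ℂ V] [AddCommGroup W] [Module ℂ W]

/-- The action of `D(B) ⊗ D(B)` on `V ⊗ W`, for two `D(B)`-modules `V` and `W`. -/
def tensorAction (ρ : Double d ζ →ₐ[ℂ] Module.End ℂ V) (σ : Double d ζ →ₐ[ℂ] Module.End ℂ W) :
    Double d ζ ⊗[ℂ] Double d ζ →ₐ[ℂ] Module.End ℂ (V ⊗[ℂ] W) :=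
  (Module.endTensorEndAlgHom (R := ℂ) (S := ℂ) (A := ℂ) (M := V) (N := W)).comp
    (Algebra.TensorProduct.map ρ σ)

/-- The action of `D(B)` on `V ⊗ W`, through the coproduct of `D(B)`. -/
def tensorRep (ρ : Double d ζ →ₐ[ℂ] Module.End ℂ V) (σ : Double d ζ →ₐ[ℂ] Module.End ℂ W) :
    Double d ζ →ₗ[ℂ] Module.End ℂ (V ⊗[ℂ] W) :=
  (tensorAction ρ σ).toLinearMap ∘ₗ Double.comul d ζ

/-- The braiding `c_{V,W} : V ⊗ W → W ⊗ V`, `v ⊗ w ↦ τ(R) (w ⊗ v)`. -/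
def braiding (ρ : Double d ζ →ₐ[ℂ] Module.End ℂ V) (σ : Double d ζ →ₐ[ℂ] Module.End ℂ W) :
    V ⊗[ℂ] W →ₗ[ℂ] W ⊗[ℂ] V :=
  tensorAction σ ρ (TensorProduct.comm ℂ _ _ (Double.R d ζ)) ∘ₗ
    (TensorProduct.comm ℂ V W).toLinearMap

/-- The quantum trace `Tr₊(f) = Tr(z⁻¹ K f)`. -/
def trPos (ρ : Double d ζ →ₗ[ℂ] Module.End ℂ V) (f : Module.End ℂ V) : ℂ :=
  LinearMap.trace ℂ V (ρ (Double.pivot d ζ) * f)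

/-- The quantum trace `Tr₋(f) = Tr(f K⁻¹ z)`. -/
def trNeg (ρ : Double d ζ →ₗ[ℂ] Module.End ℂ V) (f : Module.End ℂ V) : ℂ :=
  LinearMap.trace ℂ V (f * ρ ↑(Double.pivot d ζ)⁻¹)

end Rep

/-! ### The simple modules -/

section LiftHom

variable {A : Type*} [Ring A] [Algebra ℂ A]

/-- A morphism of algebras from `D(B)` is given by two compatible morphisms of algebras from `B` and
`B^*`. The compatibility may be checked on the generators of `B`. -/
def Double.liftHom (φ : Taft d ζ →ₐ[ℂ] A) (ψ : TaftDual d ζ →ₐ[ℂ] A)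
    (hK : ∀ g, φ (Taft.K d ζ) * ψ g =
      ψ (TaftDual.shiftR d ζ (Taft.K d ζ) (TaftDual.shiftL d ζ (.op (Kinv d ζ)) g)) *
        φ (Taft.K d ζ))
    (hE : ∀ g, φ (Taft.E d ζ) * ψ g =
      -ψ (TaftDual.shiftL d ζ (.op (Taft.E d ζ)) (TaftDual.shiftL d ζ (.op (Kinv d ζ)) g)) +
      ψ (TaftDual.shiftL d ζ (.op (Kinv d ζ)) g) * φ (Taft.E d ζ) +
      ψ (TaftDual.shiftR d ζ (Taft.E d ζ) (TaftDual.shiftL d ζ (.op (Kinv d ζ)) g)) *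
        φ (Taft.K d ζ)) :
    Double d ζ →ₐ[ℂ] A :=
  let L : DoubleSpace d ζ →ₗ[ℂ] A :=
    TensorProduct.lift ((LinearMap.mul ℂ A).compl₁₂ ψ.toLinearMap φ.toLinearMap)
  have hmk : ∀ g b, L (DoubleSpace.mk d ζ g b) = ψ g * φ b := fun _ _ => rfl
  have hB : ∀ a x, L (DoubleSpace.leftB d ζ a x) = φ a * L x := by
    intro a
    induction a using Taft.induction with
    | hc c => intro x; simp [Algebra.algebraMap_eq_smul_one]
    | hK =>
      intro x
      induction x using DoubleSpace.induction with
      | hadd x y hx hy => simp only [map_add, hx, hy, mul_add]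
      | hmk g b => rw [DoubleSpace.leftB_K, hmk, hmk, map_mul, ← mul_assoc, ← mul_assoc, hK]
    | hE =>
      intro x
      induction x using DoubleSpace.induction with
      | hadd x y hx hy => simp only [map_add, hx, hy, mul_add]
      | hmk g b =>
        rw [DoubleSpace.leftB_E, map_add, map_add, map_neg, hmk, hmk, hmk, hmk, map_mul, map_mul,
          ← mul_assoc, ← mul_assoc, ← mul_assoc, hE, add_mul, add_mul, neg_mul]
    | hadd a b ha hb => intro x; simp only [map_add, LinearMap.add_apply, ha, hb, add_mul]
    | hmul a b ha hb => intro x; rw [map_mul, Module.End.mul_apply, ha, hb, map_mul, mul_assoc]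
  have hD : ∀ f x, L (DoubleSpace.leftDual d ζ f x) = ψ f * L x := by
    intro f x
    induction x using DoubleSpace.induction with
    | hadd x y hx hy => simp only [map_add, hx, hy, mul_add]
    | hmk g b => rw [DoubleSpace.leftDual_mk, hmk, hmk, map_mul, mul_assoc]
  AlgHom.ofLinearMap (L ∘ₗ (Double.ofSpace d ζ).symm.toLinearMap)
    (by
      change L (DoubleSpace.mk d ζ 1 1) = 1
      rw [hmk, map_one, map_one, one_mul])
    (by
      intro x y
      obtain ⟨x, rfl⟩ := (Double.ofSpace d ζ).surjective x
      obtain ⟨y, rfl⟩ := (Double.ofSpace d ζ).surjective y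
      rw [Double.mul_def]
      change L (DoubleSpace.mulHom d ζ x y) = L x * L y
      induction x using DoubleSpace.induction with
      | hadd x x' hx hx' => simp only [map_add, LinearMap.add_apply, hx, hx', add_mul]
      | hmk f a => rw [DoubleSpace.mulHom_mk, Module.End.mul_apply, hD, hB, hmk, mul_assoc])

variable (φ : Taft d ζ →ₐ[ℂ] A) (ψ : TaftDual d ζ →ₐ[ℂ] A) (hK) (hE)

theorem Double.liftHom_inB (a : Taft d ζ) :
    Double.liftHom φ ψ hK hE (Double.inB d ζ a) = φ a := by
  change ψ 1 * φ a = φ a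
  rw [map_one, one_mul]

theorem Double.liftHom_inDual (f : TaftDual d ζ) :
    Double.liftHom φ ψ hK hE (Double.inDual d ζ f) = ψ f := by
  change ψ f * φ 1 = ψ f
  rw [map_one, mul_one]

end LiftHom

namespace SimpleModule

/-- The scalar `ζ ^ p (a)_ζ (ζ ^ (l - a) - 1)`. -/
def eCoeff (ζ : ℂ) (l p a : ℕ) : ℂ := ζ ^ p * (qInt ζ a * (ζ ^ (l - a) - 1))

/-- The matrix `ζ ^ p diag(ζ ^ (l - 1), …, ζ, 1)` of `K`. -/
def matK (ζ : ℂ) (l p : ℕ) : Matrix (Fin l) (Fin l) ℂ :=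
  ζ ^ p • Matrix.diagonal fun i : Fin l => ζ ^ (l - 1 - (i : ℕ))

/-- The matrix `ζ ^ p J⁺((1)_ζ (ζ ^ (l - 1) - 1), …, (l - 1)_ζ (ζ - 1))` of `E`. -/
def matE (ζ : ℂ) (l p : ℕ) : Matrix (Fin l) (Fin l) ℂ :=
  ζ ^ p • Matrix.of fun i j : Fin l =>
    if (i : ℕ) + 1 = j then qInt ζ (i + 1) * (ζ ^ (l - (i + 1)) - 1) else 0

/-- The matrix `J⁻(1, …, 1)` of `F`. -/
def matF (l : ℕ) : Matrix (Fin l) (Fin l) ℂ :=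
  Matrix.of fun i j : Fin l => if (j : ℕ) + 1 = i then 1 else 0

/-- The matrix `ζ ^ (2p + l - 1) Id` of `z`. -/
def matz (ζ : ℂ) (l p : ℕ) : Matrix (Fin l) (Fin l) ℂ := ζ ^ (2 * p + l - 1) • 1

theorem matK_mul_apply (l p : ℕ) (X : Matrix (Fin l) (Fin l) ℂ) (i j : Fin l) :
    (matK ζ l p * X) i j = ζ ^ p * ζ ^ (l - 1 - (i : ℕ)) * X i j := by
  simp [matK, Matrix.diagonal_mul, mul_assoc]

theorem mul_matK_apply (l p : ℕ) (X : Matrix (Fin l) (Fin l) ℂ) (i j : Fin l) :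
    (X * matK ζ l p) i j = X i j * (ζ ^ p * ζ ^ (l - 1 - (j : ℕ))) := by
  simp [matK, Matrix.mul_diagonal]
  ring

theorem matE_apply (l p : ℕ) (i j : Fin l) :
    matE ζ l p i j = if (i : ℕ) + 1 = j then eCoeff ζ l p (i + 1) else 0 := by
  simp [matE, eCoeff]

theorem eCoeff_self (l p : ℕ) : eCoeff ζ l p l = 0 := by simp [eCoeff]

theorem eCoeff_zero (l p : ℕ) : eCoeff ζ l p 0 = 0 := by simp [eCoeff, qInt]

theorem matE_mul_apply (l p : ℕ) (X : ℕ → ℕ → ℂ) (i j : Fin l) :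
    (matE ζ l p * Matrix.of fun i j : Fin l => X i j) i j =
      eCoeff ζ l p (i + 1) * X (i + 1) j := by
  rw [Matrix.mul_apply]
  simp only [matE_apply, Matrix.of_apply]
  by_cases h : (i : ℕ) + 1 < l
  · rw [Finset.sum_eq_single (⟨i + 1, h⟩ : Fin l)]
    · simp
    · intro b _ hb
      rw [if_neg, zero_mul]
      intro h'
      exact hb (Fin.ext h'.symm)
    · simp
  · rw [show (i : ℕ) + 1 = l by omega, eCoeff_self, zero_mul]
    refine Finset.sum_eq_zero fun b _ => ?_
    rw [if_neg (by omega), zero_mul]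

theorem mul_matE_apply (l p : ℕ) (X : ℕ → ℕ → ℂ) (i j : Fin l) :
    ((Matrix.of fun i j : Fin l => X i j) * matE ζ l p) i j = X i (j - 1) * eCoeff ζ l p j := by
  rw [Matrix.mul_apply]
  simp only [matE_apply, Matrix.of_apply]
  by_cases h : (j : ℕ) = 0
  · rw [h, eCoeff_zero, mul_zero]
    refine Finset.sum_eq_zero fun b _ => ?_
    rw [if_neg (by omega), mul_zero]
  · rw [Finset.sum_eq_single (⟨j - 1, by omega⟩ : Fin l)]
    · simp only
      rw [if_pos (by omega), show (j : ℕ) - 1 + 1 = j by omega]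
    · intro b _ hb
      rw [if_neg, mul_zero]
      intro h'
      exact hb (Fin.ext (by simp only; omega))
    · simp

variable (d) in
theorem matE_pow (l p : ℕ) (hl : l ≤ d) : matE ζ l p ^ d = 0 := by
  have key : ∀ n : ℕ, ∀ i j : Fin l, (j : ℕ) < i + n → (matE ζ l p ^ n) i j = 0 := by
    intro n
    induction n with
    | zero =>
      intro i j h
      rw [pow_zero, Matrix.one_apply_ne]
      rintro rfl
      omega
    | succ n ih =>
      intro i j h
      rw [pow_succ, Matrix.mul_apply]
      refine Finset.sum_eq_zero fun b _ => ?_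
      rw [matE_apply]
      split_ifs with h'
      · rw [ih i b (by omega), zero_mul]
      · rw [mul_zero]
  ext i j
  rw [key d i j (by omega), Matrix.zero_apply]

variable (d ζ) in
/-- The action of `B` on `M_{l,p}`. -/
def repB (l p : ℕ) (hl : l ≤ d) : Taft d ζ →ₐ[ℂ] Matrix (Fin l) (Fin l) ℂ :=
  lift (matK ζ l p) (matE ζ l p)
    (by
      rw [matK, smul_pow, Matrix.diagonal_pow, ← pow_mul, mul_comm, pow_mul,
        (prim d ζ).pow_eq_one, one_pow, one_smul, ← Matrix.diagonal_one]
      congr 1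
      funext i
      rw [Pi.pow_apply, ← pow_mul, mul_comm, pow_mul, (prim d ζ).pow_eq_one, one_pow])
    (matE_pow d l p hl)
    (by
      ext i j
      rw [matK_mul_apply, Matrix.smul_apply, mul_matK_apply, matE_apply]
      split_ifs with h
      · rw [show l - 1 - (i : ℕ) = l - 1 - (j : ℕ) + 1 by omega, pow_succ, smul_eq_mul]
        ring
      · simp)

/-- The triangular numbers. -/
def tri (n : ℕ) : ℕ := ∑ i ∈ Finset.range (n + 1), i

theorem tri_zero : tri 0 = 0 := rfl

theorem tri_succ (n : ℕ) : tri (n + 1) = tri n + (n + 1) := by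
  simp [tri, Finset.sum_range_succ]

theorem tri_add (m n : ℕ) : tri (m + n) = tri m + tri n + m * n := by
  induction n with
  | zero => simp [tri_zero]
  | succ n ih => rw [← add_assoc, tri_succ, ih, tri_succ]; ring

/-- The scalar of the matrix coefficients of the `B`-comodule `M_{l,p}`. -/
def cCoeff (ζ : ℂ) (i n : ℕ) : ℂ := ζ⁻¹ ^ (i * n + tri i) * (qFact ζ i)⁻¹

variable (d ζ) in
/-- The matrix coefficients in `B` of the `B`-comodule `M_{l,p}`. -/
def coeffElt (p r a : ℕ) : Taft d ζ :=
  if a ≤ r then cCoeff ζ (r - a) (p + a) • (Taft.E d ζ ^ (r - a) * Kinv d ζ ^ (p + r)) else 0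

theorem coeffElt_self (p a : ℕ) : coeffElt d ζ p a a = Kinv d ζ ^ (p + a) := by
  simp [coeffElt, cCoeff, tri_zero, qFact_zero]

theorem K_pow_mul_Kinv_pow (m n : ℕ) : Taft.K d ζ ^ m * Kinv d ζ ^ (n + m) = Kinv d ζ ^ n := by
  have hc : Commute (Taft.K d ζ) (Kinv d ζ) := by
    rw [Commute, SemiconjBy, K_mul_Kinv, Kinv_mul_K]
  rw [add_comm, pow_add, ← mul_assoc, ← hc.mul_pow, K_mul_Kinv, one_pow, one_mul]

theorem comulHom_E_pow (n : ℕ) : comulHom d ζ (Taft.E d ζ ^ n) =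
    ∑ k ∈ Finset.range (n + 1), qBinom ζ n k •
      ((Taft.E d ζ ^ (n - k)) ⊗ₜ[ℂ] (Taft.E d ζ ^ k * Taft.K d ζ ^ (n - k))) := by
  rw [map_pow, comulHom_E, qBinom_theorem ζ]
  · refine Finset.sum_congr rfl fun k _ => ?_
    simp [Algebra.TensorProduct.tmul_pow]
  · simp [K_mul_E]

theorem cCoeff_mul (k m n : ℕ) (h : k + m < d) :
    cCoeff ζ (k + m) n * qBinom ζ (k + m) k = cCoeff ζ m (n + k) * cCoeff ζ k n := by
  have h1 := qBinom_mul ζ k m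
  have h2 := qFact_ne_zero (prim d ζ) k (by omega)
  have h3 := qFact_ne_zero (prim d ζ) m (by omega)
  have h4 := qFact_ne_zero (prim d ζ) (k + m) h
  have h5 : qBinom ζ (k + m) k = qFact ζ (k + m) * ((qFact ζ k)⁻¹ * (qFact ζ m)⁻¹) := by
    rw [← h1]
    field_simp
  rw [h5, cCoeff, cCoeff, cCoeff, tri_add,
    show (k + m) * n + (tri k + tri m + k * m) = (m * (n + k) + tri m) + (k * n + tri k) by ring,
    pow_add _ (m * (n + k) + tri m)]
  field_simp

theorem comulHom_coeffElt (l p : ℕ) (hl : l ≤ d) (r a : Fin l) :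
    comulHom d ζ (coeffElt d ζ p r a) =
      ∑ s : Fin l, coeffElt d ζ p r s ⊗ₜ[ℂ] coeffElt d ζ p s a := by
  rw [Fin.sum_univ_eq_sum_range (fun s => coeffElt d ζ p r s ⊗ₜ[ℂ] coeffElt d ζ p s a) l]
  by_cases h : (a : ℕ) ≤ r
  · obtain ⟨n, hn⟩ := Nat.exists_eq_add_of_le h
    have hlt : (r : ℕ) < l := r.2
    rw [← Finset.sum_subset (s₁ := Finset.Ico (a : ℕ) (r + 1))
      (fun x hx => Finset.mem_range.2 (by have := Finset.mem_Ico.1 hx; omega))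
      (by
        intro x _ hx
        rw [Finset.mem_Ico, not_and_or] at hx
        rcases hx with hx | hx
        · rw [coeffElt.eq_def d ζ p x a, if_neg hx, TensorProduct.tmul_zero]
        · rw [coeffElt, if_neg (by omega), TensorProduct.zero_tmul]),
      Finset.sum_Ico_eq_sum_range, coeffElt, if_pos h, map_smul, map_mul, comulHom_E_pow, map_pow,
      TaftDual.comulHom_Kinv, Finset.sum_mul, Finset.smul_sum,
      show (r : ℕ) - a = n by omega, show (r : ℕ) + 1 - a = n + 1 by omega]
    refine Finset.sum_congr rfl fun k hk => ?_
    have hk' := Finset.mem_range.1 hk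
    obtain ⟨m, rfl⟩ := Nat.exists_eq_add_of_le (show k ≤ n by omega)
    rw [coeffElt, if_pos (by omega), coeffElt, if_pos (by omega),
      show (r : ℕ) - (a + k) = m by omega, show (a : ℕ) + k - a = k by omega,
      show k + m - k = m by omega, smul_mul_assoc, Algebra.TensorProduct.tmul_pow,
      Algebra.TensorProduct.tmul_mul_tmul, mul_assoc, show p + (r : ℕ) = p + (a + k) + m by omega,
      K_pow_mul_Kinv_pow, TensorProduct.smul_tmul_smul, smul_smul,
      cCoeff_mul (d := d) k m _ (by omega), show p + (a : ℕ) + k = p + (a + k) by omega]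
  · rw [coeffElt, if_neg h, map_zero]
    symm
    refine Finset.sum_eq_zero fun s _ => ?_
    by_cases h1 : s ≤ r
    · rw [coeffElt.eq_def d ζ p s a, if_neg (by omega), TensorProduct.tmul_zero]
    · rw [coeffElt, if_neg h1, TensorProduct.zero_tmul]

variable (d ζ) in
/-- The action of `B^*` on `M_{l,p}`, coming from the structure of `B`-comodule. -/
def repDual (l p : ℕ) (hl : l ≤ d) : TaftDual d ζ →ₐ[ℂ] Matrix (Fin l) (Fin l) ℂ :=
  AlgHom.ofLinearMap
    { toFun := fun f => Matrix.of fun r a => f (coeffElt d ζ p r a)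
      map_add' := fun _ _ => rfl
      map_smul' := fun _ _ => rfl }
    (by
      ext r a
      change counitHom d ζ (coeffElt d ζ p r a) = _
      by_cases h : r = a
      · subst h
        rw [coeffElt_self, Matrix.one_apply_eq, Kinv, map_pow, map_pow, counitHom_K, one_pow,
          one_pow]
      · rw [Matrix.one_apply_ne h, coeffElt]
        have h' : (r : ℕ) ≠ a := fun h' => h (Fin.ext h')
        split_ifs with h1
        · rw [map_smul, map_mul, map_pow, counitHom_E, zero_pow (by omega), zero_mul, smul_zero]
        · rw [map_zero])
    (by
      intro f g
      ext r a
      change (f * g) (coeffElt d ζ p r a) = ∑ s : Fin l, f (coeffElt d ζ p r s) * g (coeffElt d ζ p s a)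
      rw [TaftDual.mul_apply_of_comul, comulHom_coeffElt l p hl]
      simp)

theorem repDual_apply (l p : ℕ) (hl : l ≤ d) (f : TaftDual d ζ) :
    repDual d ζ l p hl f = Matrix.of fun r a : Fin l => f (coeffElt d ζ p r a) := rfl

theorem Kinv_mul_E_pow (i : ℕ) :
    Kinv d ζ * Taft.E d ζ ^ i = ζ⁻¹ ^ i • (Taft.E d ζ ^ i * Kinv d ζ) := by
  induction i with
  | zero => simp
  | succ i ih =>
    rw [pow_succ (Taft.E d ζ), ← mul_assoc, ih, smul_mul_assoc, mul_assoc, Kinv_mul_E,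
      mul_smul_comm, smul_smul, ← pow_succ, mul_assoc]

theorem Kinv_pow_mul_E (i : ℕ) :
    Kinv d ζ ^ i * Taft.E d ζ = ζ⁻¹ ^ i • (Taft.E d ζ * Kinv d ζ ^ i) := by
  induction i with
  | zero => simp
  | succ i ih =>
    rw [pow_succ (Kinv d ζ), mul_assoc, Kinv_mul_E, mul_smul_comm, ← mul_assoc, ih,
      smul_mul_assoc, smul_smul, mul_comm, ← pow_succ, mul_assoc]

theorem cCoeff_succ (i n : ℕ) (h : i + 1 < d) :
    cCoeff ζ (i + 1) n * qInt ζ (i + 1) = ζ⁻¹ ^ (n + i + 1) * cCoeff ζ i n := by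
  have h1 := qInt_ne_zero (prim d ζ) (i + 1) (by omega) h
  have h2 := qFact_ne_zero (prim d ζ) i (by omega)
  rw [cCoeff, cCoeff, qFact_succ, tri_succ,
    show (i + 1) * n + (tri i + (i + 1)) = (n + i + 1) + (i * n + tri i) by ring, pow_add]
  field_simp

/-- The scalar identity behind the relation between `E` and `B^*` on `M_{l,p}`. -/
theorem scalar_identity (l p a i : ℕ) (h : a + i < l) (hi : i + 1 < d) :
    eCoeff ζ l p (a + i + 1) * cCoeff ζ (i + 1) (p + a) =
      -(cCoeff ζ i (p + a) * ζ⁻¹ ^ (i + 1)) +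
      cCoeff ζ (i + 1) (p + a - 1) * ζ⁻¹ ^ (i + 1) * eCoeff ζ l p a +
      cCoeff ζ i (p + a) * ζ⁻¹ ^ i * ζ⁻¹ ^ (p + (a + i) + 1) * (ζ ^ p * ζ ^ (l - 1 - a)) := by
  have hz := zeta_ne_zero d ζ
  obtain ⟨m, rfl⟩ : ∃ m, l = a + i + 1 + m := ⟨l - (a + i + 1), by omega⟩
  have hI := qInt_ne_zero (prim d ζ) (i + 1) (by omega) hi
  have h1 := cCoeff_succ (d := d) (ζ := ζ) i (p + a) hi
  have hA : qInt ζ a + ζ ^ a * qInt ζ (i + 1) = qInt ζ (i + 1) + ζ ^ (i + 1) * qInt ζ a := by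
    rw [← qInt_add, ← qInt_add, add_comm]
  have h2 : cCoeff ζ (i + 1) (p + a - 1) * qInt ζ (i + 1) * eCoeff ζ (a + i + 1 + m) p a =
      ζ⁻¹ ^ (p + a) * cCoeff ζ i (p + a) * eCoeff ζ (a + i + 1 + m) p a := by
    rcases Nat.eq_zero_or_pos a with h0 | h0
    · rw [h0, eCoeff_zero, mul_zero, mul_zero]
    · congr 1
      have h3 : cCoeff ζ (i + 1) (p + a) = ζ⁻¹ ^ (i + 1) * cCoeff ζ (i + 1) (p + a - 1) := by
        rw [cCoeff, cCoeff, show (i + 1) * (p + a) + tri (i + 1) =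
          (i + 1) + ((i + 1) * (p + a - 1) + tri (i + 1)) by
            obtain ⟨n, hn⟩ : ∃ n, p + a = n + 1 := ⟨p + a - 1, by omega⟩
            rw [hn, Nat.add_sub_cancel]
            ring, pow_add _ (i + 1), mul_assoc]
      rw [h3, add_assoc (p + a), pow_add _ (p + a)] at h1
      have hq : ζ⁻¹ ^ (i + 1) ≠ 0 := pow_ne_zero _ (inv_ne_zero hz)
      apply mul_left_cancel₀ hq
      linear_combination h1
  apply mul_right_cancel₀ hI
  have e1 : eCoeff ζ (a + i + 1 + m) p (a + i + 1) =
      ζ ^ p * ((qInt ζ a + ζ ^ a * qInt ζ (i + 1)) * (ζ ^ m - 1)) := by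
    rw [eCoeff, add_assoc a i 1, qInt_add, Nat.add_sub_cancel_left]
  have e2 : eCoeff ζ (a + i + 1 + m) p a = ζ ^ p * (qInt ζ a * (ζ ^ (m + i + 1) - 1)) := by
    rw [eCoeff, show a + i + 1 + m - a = m + i + 1 by omega]
  calc _ = eCoeff ζ (a + i + 1 + m) p (a + i + 1) *
        (ζ⁻¹ ^ (p + a + i + 1) * cCoeff ζ i (p + a)) := by rw [← h1]; ring
    _ = -(cCoeff ζ i (p + a) * ζ⁻¹ ^ (i + 1)) * qInt ζ (i + 1) +
        ζ⁻¹ ^ (i + 1) * (ζ⁻¹ ^ (p + a) * cCoeff ζ i (p + a) * eCoeff ζ (a + i + 1 + m) p a) +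
        cCoeff ζ i (p + a) * ζ⁻¹ ^ i * ζ⁻¹ ^ (p + (a + i) + 1) *
          (ζ ^ p * ζ ^ (a + i + 1 + m - 1 - a)) * qInt ζ (i + 1) := by
      rw [e1, e2, show a + i + 1 + m - 1 - a = m + i by omega]
      generalize cCoeff ζ i (p + a) = C
      generalize qInt ζ a = A at *
      generalize qInt ζ (i + 1) = I at *
      simp only [inv_pow, pow_add, pow_one] at hA ⊢
      have := pow_ne_zero p hz
      have := pow_ne_zero a hz
      have := pow_ne_zero i hz
      generalize ζ ^ p = P at *
      generalize ζ ^ a = Q at *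
      generalize ζ ^ i = J at *
      generalize ζ ^ m = M at *
      field_simp
      linear_combination C * M * hA
    _ = _ := by rw [← h2]; ring

variable (d ζ) in
/-- The simple `D(B)`-module `M_{l,p}`, in matrix form (`1 ≤ l ≤ d`). Its restrictions to `B` and `B^*`
are `repB` and `repDual`; the generators `K`, `E`, `z`, `F` of `D(B)` act by the matrices `matK`,
`matE`, `matz`, `matF`, see `repMatrix_K`, `repMatrix_E`, `repMatrix_z`, `repMatrix_F`. -/
def repMatrix (l p : ℕ) (hl : l ≤ d) : Double d ζ →ₐ[ℂ] Matrix (Fin l) (Fin l) ℂ :=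
  Double.liftHom (repB d ζ l p hl) (repDual d ζ l p hl)
    (by
      intro g
      ext r a
      rw [repB, lift_K, matK_mul_apply, mul_matK_apply, repDual_apply, repDual_apply,
        Matrix.of_apply, Matrix.of_apply]
      change _ = g (Kinv d ζ * (coeffElt d ζ p r a * Taft.K d ζ)) * _
      by_cases h : (a : ℕ) ≤ r
      · obtain ⟨i, hi⟩ := Nat.exists_eq_add_of_le h
        have hz := zeta_ne_zero d ζ
        have e1 : Kinv d ζ * (coeffElt d ζ p r a * Taft.K d ζ) =
            ζ⁻¹ ^ i • coeffElt d ζ p r a := by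
          have hc : Commute (Kinv d ζ) (Taft.K d ζ) := by
            rw [Commute, SemiconjBy, K_mul_Kinv, Kinv_mul_K]
          rw [coeffElt, if_pos h, show (r : ℕ) - a = i by omega, smul_mul_assoc, mul_smul_comm,
            smul_comm, mul_assoc (Taft.E d ζ ^ i), ← mul_assoc (Kinv d ζ), Kinv_mul_E_pow,
            smul_mul_assoc, mul_assoc, ← mul_assoc (Kinv d ζ), ← pow_succ', pow_succ, mul_assoc,
            Kinv_mul_K, mul_one]
        rw [e1, map_smul, smul_eq_mul, show l - 1 - (a : ℕ) = l - 1 - (r : ℕ) + i by omega, pow_add, inv_pow]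
        field_simp
      · simp [coeffElt, h])
    (by
      intro g
      ext r a
      rw [repB, lift_K, lift_E, Matrix.add_apply, Matrix.add_apply, Matrix.neg_apply,
        mul_matK_apply, repDual_apply, repDual_apply, repDual_apply, repDual_apply,
        matE_mul_apply l p (fun r a => g (coeffElt d ζ p r a)),
        mul_matE_apply l p (fun r a => TaftDual.shiftL d ζ (.op (Kinv d ζ)) g
          (coeffElt d ζ p r a)), Matrix.of_apply, Matrix.of_apply]
      change _ = -g (Kinv d ζ * (Taft.E d ζ * coeffElt d ζ p r a)) +
        g (Kinv d ζ * coeffElt d ζ p r (a - 1)) * _ +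
        g (Kinv d ζ * (coeffElt d ζ p r a * Taft.E d ζ)) * _
      rcases Nat.lt_trichotomy (a : ℕ) (r + 1) with h | h | h
      · obtain ⟨i, hi⟩ := Nat.exists_eq_add_of_le (Nat.le_of_lt_succ h)
        have hr := r.2
        set X : Taft d ζ := Taft.E d ζ ^ (i + 1) * Kinv d ζ ^ (p + r + 1) with hX
        have e0 : coeffElt d ζ p (r + 1) a = cCoeff ζ (i + 1) (p + a) • X := by
          rw [coeffElt, if_pos (by omega), show (r : ℕ) + 1 - a = i + 1 by omega]
          rfl
        have e1 : Kinv d ζ * (Taft.E d ζ * coeffElt d ζ p r a) =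
            (cCoeff ζ i (p + a) * ζ⁻¹ ^ (i + 1)) • X := by
          rw [coeffElt, if_pos (by omega), show (r : ℕ) - a = i by omega, mul_smul_comm,
            mul_smul_comm, ← mul_assoc (Taft.E d ζ), ← pow_succ', ← mul_assoc, Kinv_mul_E_pow,
            smul_mul_assoc, mul_assoc, ← pow_succ', smul_smul]
        have e2 : (a : ℕ) ≠ 0 → Kinv d ζ * coeffElt d ζ p r (a - 1) =
            (cCoeff ζ (i + 1) (p + a - 1) * ζ⁻¹ ^ (i + 1)) • X := by
          intro ha
          rw [coeffElt, if_pos (by omega), show (r : ℕ) - (a - 1) = i + 1 by omega, mul_smul_comm,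
            ← mul_assoc, Kinv_mul_E_pow, smul_mul_assoc, mul_assoc, ← pow_succ', smul_smul,
            show p + ((a : ℕ) - 1) = p + a - 1 by omega]
        have e3 : Kinv d ζ * (coeffElt d ζ p r a * Taft.E d ζ) =
            (cCoeff ζ i (p + a) * ζ⁻¹ ^ i * ζ⁻¹ ^ (p + (a + i) + 1)) • X := by
          rw [coeffElt, if_pos (by omega), show (r : ℕ) - a = i by omega, smul_mul_assoc,
            mul_smul_comm, ← mul_assoc, ← mul_assoc, Kinv_mul_E_pow, smul_mul_assoc,
            smul_mul_assoc, mul_assoc (Taft.E d ζ ^ i), ← pow_succ', mul_assoc, Kinv_pow_mul_E,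
            mul_smul_comm, ← mul_assoc, ← pow_succ, smul_smul, smul_smul, ← hi]
        have e2' : g (Kinv d ζ * coeffElt d ζ p r (a - 1)) * eCoeff ζ l p a =
            (cCoeff ζ (i + 1) (p + a - 1) * ζ⁻¹ ^ (i + 1)) * g X * eCoeff ζ l p a := by
          by_cases ha : (a : ℕ) = 0
          · rw [ha, eCoeff_zero, mul_zero, mul_zero]
          · rw [e2 ha, map_smul, smul_eq_mul]
        rw [e2', e0, e1, e3, map_smul, map_smul, map_smul, smul_eq_mul, smul_eq_mul, smul_eq_mul]
        by_cases hid : i + 1 < d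
        · have := scalar_identity (d := d) (ζ := ζ) l p a i (by omega) hid
          rw [hi]
          linear_combination g X * this
        · have hX0 : X = 0 := by rw [hX, pow_eq_zero_of_le (by omega) E_pow, zero_mul]
          rw [hX0, map_zero]
          ring
      · have hz : ((a : ℕ) ≤ r) = False := by simp; omega
        rw [← h, coeffElt_self, coeffElt, if_neg (by omega), show (a : ℕ) - 1 = r by omega,
          coeffElt_self, ← pow_succ', show p + (r : ℕ) + 1 = p + a by omega]
        simp
        ring
      · rw [coeffElt, if_neg (by omega), coeffElt, if_neg (by omega), coeffElt, if_neg (by omega)]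
        simp)

theorem repMatrix_K (l p : ℕ) (hl : l ≤ d) :
    repMatrix d ζ l p hl (Double.K d ζ) = matK ζ l p :=
  (Double.liftHom_inB ..).trans (lift_K ..)

theorem repMatrix_E (l p : ℕ) (hl : l ≤ d) : repMatrix d ζ l p hl (Double.E d ζ) = matE ζ l p :=
  (Double.liftHom_inB ..).trans (lift_E ..)

theorem repDual_char (l p : ℕ) (hl : l ≤ d) (f : Taft d ζ →ₐ[ℂ] ℂ) (c : ℂ)
    (hc : f (Kinv d ζ) = c) (hE : f (Taft.E d ζ) = 0) :
    repDual d ζ l p hl (TaftDual.ofHom f) = Matrix.diagonal fun i : Fin l => c ^ (p + (i : ℕ)) := by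
  ext r a
  change f (coeffElt d ζ p r a) = _
  by_cases h : r = a
  · subst h
    rw [coeffElt_self, map_pow, hc, Matrix.diagonal_apply_eq]
  · rw [Matrix.diagonal_apply_ne _ h, coeffElt]
    have h' : (r : ℕ) ≠ a := fun h' => h (Fin.ext h')
    split_ifs with h1
    · rw [map_smul, map_mul, map_pow, hE, zero_pow (by omega), zero_mul, smul_zero]
    · rw [map_zero]

theorem repMatrix_Kst_inv (l p : ℕ) (hl : l ≤ d) :
    repMatrix d ζ l p hl ↑(Double.Kst d ζ)⁻¹ =
      Matrix.diagonal fun i : Fin l => ζ ^ (p + (i : ℕ)) := by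
  refine (Double.liftHom_inDual ..).trans (repDual_char l p hl _ ζ ?_ (lift_E ..))
  have h : TaftDual.charKinv d ζ (Taft.K d ζ) * TaftDual.charKinv d ζ (Kinv d ζ) = 1 := by
    rw [← map_mul, K_mul_Kinv, map_one]
  rw [TaftDual.charKinv, lift_K] at h
  exact (eq_inv_of_mul_eq_one_right h).trans (inv_inv ζ)

theorem repMatrix_z (l p : ℕ) (hl : l ≤ d) :
    repMatrix d ζ l p hl (Double.z d ζ) = matz ζ l p := by
  rw [Double.z, Units.val_mul, map_mul, repMatrix_Kst_inv, repMatrix_K]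
  ext i j
  rw [mul_matK_apply, matz]
  by_cases h : i = j
  · subst h
    have hi := i.2
    rw [Matrix.diagonal_apply_eq, Matrix.smul_apply, Matrix.one_apply_eq, smul_eq_mul, mul_one,
      ← pow_add, ← pow_add]
    congr 1
    omega
  · rw [Matrix.diagonal_apply_ne _ h, Matrix.smul_apply, Matrix.one_apply_ne h, zero_mul, smul_zero]

theorem repMatrix_F (l p : ℕ) (hl : l ≤ d) : repMatrix d ζ l p hl (Double.F d ζ) = matF l := by
  have hz := zeta_ne_zero d ζ
  rw [Double.F, map_smul, map_mul, repMatrix_Kst_inv,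
    show repMatrix d ζ l p hl (Double.Est d ζ) = repDual d ζ l p hl (TaftDual.Est d ζ) from
      Double.liftHom_inDual ..]
  ext r a
  rw [Matrix.smul_apply, Matrix.mul_diagonal, repDual_apply, Matrix.of_apply, matF,
    Matrix.of_apply, coeffElt]
  split_ifs with h1 h2 h2
  · rw [Kinv, ← pow_mul, map_smul, TaftDual.Est_apply, if_pos (by omega), ← h2,
      Nat.add_sub_cancel_left, cCoeff]
    simp [tri, qFact, qInt, Finset.sum_range_succ, pow_add]
    field_simp
  · rw [Kinv, ← pow_mul, map_smul, TaftDual.Est_apply, if_neg (by omega)]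
    simp
  · omega
  · simp

end SimpleModule

/-! ### The `S`-matrices and `T`-matrices -/

/-- The set `Λ(d) = ℤ/dℤ × ℤ/dℤ` of parameters of the simple modules. -/
abbrev Λ (d : ℕ) : Type := ZMod d × ZMod d

/-- The representative of a class modulo `d` in `{1, …, d}`. -/
def rep (l : ZMod d) : ℕ := if l.val = 0 then d else l.val

theorem rep_le (l : ZMod d) : rep l ≤ d := by
  have : NeZero d := ⟨d_ne_zero d⟩
  rw [rep]
  split_ifs
  · exact le_rfl
  · exact (ZMod.val_lt l).le

/-- The simple `D(B)`-module `M_{l,p}`, with underlying space `ℂ ^ l`, for `l` in `{1, …, d}`. -/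
def M (lam : Λ d) : Double d ζ →ₐ[ℂ] Module.End ℂ (Fin (rep lam.1) → ℂ) :=
  (Matrix.toLinAlgEquiv' : Matrix (Fin (rep lam.1)) (Fin (rep lam.1)) ℂ ≃ₐ[ℂ] _).toAlgHom.comp
    (SimpleModule.repMatrix d ζ (rep lam.1) lam.2.val (rep_le lam.1))

variable (d ζ) in
/-- The double braiding `c_{M_μ, M_λ} ∘ c_{M_λ, M_μ}`. -/
def doubleBraiding (lam mu : Λ d) :
    Module.End ℂ ((Fin (rep lam.1) → ℂ) ⊗[ℂ] (Fin (rep mu.1) → ℂ)) :=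
  braiding (M (ζ := ζ) mu) (M (ζ := ζ) lam) ∘ₗ braiding (M (ζ := ζ) lam) (M (ζ := ζ) mu)

variable (d ζ) in
/-- The matrix `𝕊⁺`. -/
def SPos : Matrix (Λ d) (Λ d) ℂ := fun lam mu =>
  trPos (tensorRep (M (ζ := ζ) lam) (M (ζ := ζ) mu)) (doubleBraiding d ζ lam mu)

variable (d ζ) in
/-- The matrix `𝕊⁻`. -/
def SNeg : Matrix (Λ d) (Λ d) ℂ := fun lam mu =>
  trNeg (tensorRep (M (ζ := ζ) lam) (M (ζ := ζ) mu)) (doubleBraiding d ζ lam mu)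

open Classical in
/-- The scalar `ω_λ(b)` by which an element `b` of `D(B)` acts on `M_λ` (and `0` if `b` does not act
by a scalar). -/
def ω (lam : Λ d) (b : Double d ζ) : ℂ :=
  if h : ∃ c : ℂ, M lam b = c • 1 then h.choose else 0

variable (d ζ) in
/-- The diagonal matrix `𝕋⁺`, with entries `ω_λ(θ₁⁻¹)` (where `Ring.inverse θ₁` is the inverse of `θ₁`
if `θ₁` is invertible and `0` otherwise). -/
def TPos : Matrix (Λ d) (Λ d) ℂ :=
  Matrix.diagonal fun lam => ω lam (Ring.inverse (Double.θ₁ d ζ))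

variable (d ζ) in
/-- The diagonal matrix `𝕋⁻`, with entries `ω_λ(θ₁)`. -/
def TNeg : Matrix (Λ d) (Λ d) ℂ := Matrix.diagonal fun lam => ω lam (Double.θ₁ d ζ)

end

end TaftDouble

open scoped TensorProduct

namespace TaftDouble

open Taft

variable {d : ℕ} {ζ : ℂ} [Fact (2 ≤ d)] [Fact (IsPrimitiveRoot ζ d)]

/-! ### Computations in the dual algebra -/

namespace TaftDual

/-! Everything is reduced to the action of `F`. In the simple module the basis vectors are `vec l 0,
…, vec l (l - 1)`. The element `E` kills `vec l 0`, `F` sends each vector to the next, and `K` and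
`K^*` are diagonal. A quantity that is invariant under `F` can therefore be computed on an extreme
vector. There the nilpotent parts of `R` and `u` disappear and only a power of `ζ` is left.

For the `S`-matrices, the pivot `z⁻¹ K` equals `K^*` (`Double.pivot_eq`), a group-like element with
known eigenvalues. Summing over `j` in `R` collapses its torus part to one power of `ζ`
(`sum_dirac`), so `R` acts with the explicit coefficients `rCoeff` (`RAct_vec`). An identity between
`q`-integers shows that `R` carries `F ⊗ 1 + (K^*)⁻¹ ⊗ F` to the opposite expression
(`RAct_comp_FAct`), so the double braiding commutes with the former (`doubleR_comp_FAct`). In terms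
of matrix entries, a suitably weighted partial trace over one factor does not depend on the basis
vector chosen in the other (`partialTrace_right`, `partialTrace_left`), and the weights are those
produced by the pivot. For `Tr₊` the partial trace is evaluated at the first vector of the left
factor, for `Tr₋` at the last vector of the right factor. In both cases the diagonal entries are
single powers of `ζ` (`ent_diag`). Two nested geometric sums then telescope to `(1 - ζ ^ (l l')) /
(1 - ζ)`, up to a power of `ζ`.

For the `T`-matrices, `θ₁ = (K^*)⁻¹ u`, and `u` factors as a sum of terms `F ^ i E ^ i K ^ (-i)`
times a torus part (`Double.u_eq`). From the relations between generators, `θ₁` commutes with `F`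
(`Double.θ₁_mul_F`). Since `vec l 0` generates the module under `F`, the value of `θ₁` on that
vector is its value everywhere (`act_θ₁`); commutation with the other generators is not used. For
`𝕋⁺`, `θ₁` must be invertible in the double itself: this follows from the same factorisation and the
nilpotency of `F` (`isUnit_twist`).

All formulas are first obtained for natural numbers `l`, `p`. They descend to `ℤ/dℤ` because `ζ ^ m`
depends only on `m` modulo `d`. -/

theorem ext_basis {f g : TaftDual d ζ}
    (h : ∀ i j : ℕ, i < d → f (Taft.E d ζ ^ i * Taft.K d ζ ^ j) = g (Taft.E d ζ ^ i * Taft.K d ζ ^ j)) :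
    f = g := by
  refine WithConv.ext (LinearMap.ext_on span_eq_top ?_)
  rintro _ ⟨⟨i, j⟩, rfl⟩
  exact h i j i.2

/-- The `q`-binomial expansion of the coproduct of `E ^ n` makes convolution products computable. In
the products with `K^*` or `E^*` below, at most one term survives, because these forms each detect a
single power of `E`. -/
theorem mul_apply_basis (g h : TaftDual d ζ) (n m : ℕ) :
    (g * h) (Taft.E d ζ ^ n * Taft.K d ζ ^ m) = ∑ k ∈ Finset.range (n + 1), qBinom ζ n k *
      (g (Taft.E d ζ ^ (n - k) * Taft.K d ζ ^ m) *
        h (Taft.E d ζ ^ k * Taft.K d ζ ^ (n - k + m))) := by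
  rw [mul_apply_of_comul, map_mul, SimpleModule.comulHom_E_pow, map_pow, comulHom_K,
    Algebra.TensorProduct.tmul_pow, Finset.sum_mul, map_sum, map_sum]
  refine Finset.sum_congr rfl fun k _ => ?_
  rw [smul_mul_assoc, Algebra.TensorProduct.tmul_mul_tmul, mul_assoc, ← pow_add, map_smul, map_smul]
  rfl

theorem qBinom_self (n : ℕ) : qBinom ζ n n = 1 := by
  induction n with
  | zero => rfl
  | succ n ih => rw [qBinom_succ_succ, ih, qBinom_of_lt _ _ _ (by omega), mul_zero, add_zero]

theorem qBinom_succ_self (n : ℕ) : qBinom ζ (n + 1) n = qInt ζ (n + 1) := by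
  induction n with
  | zero => simp [qBinom_zero_right, qInt]
  | succ n ih =>
    rw [qBinom_succ_succ, ih, qBinom_self, mul_one, qInt, qInt, Finset.sum_range_succ _ (n + 1)]

/-- When `E^*` multiplies a power of itself, it needs exactly one `E` on the left of the coproduct
of `E ^ (n + 1)`. That term has coefficient `(n + 1)_ζ`, the next factor of the factorial. The
nilpotency of `E^*`, hence of `F`, follows. -/
theorem Est_pow_apply (i n m : ℕ) :
    (Est d ζ ^ i) (Taft.E d ζ ^ n * Taft.K d ζ ^ m) = if n = i then qFact ζ i else 0 := by
  induction i generalizing n m with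
  | zero =>
    rw [pow_zero, qFact_zero]
    change counitHom d ζ _ = _
    rw [map_mul, map_pow, map_pow, counitHom_K, counitHom_E, one_pow, mul_one, zero_pow_eq]
  | succ i ih =>
    rw [pow_succ', mul_apply_basis]
    cases n with
    | zero =>
      rw [if_neg (by omega), zero_add, Finset.sum_range_one, Est_apply, if_neg (by omega), zero_mul,
        mul_zero]
    | succ n =>
      rw [Finset.sum_eq_single n]
      · rw [Est_apply, if_pos (by omega), ih, qBinom_succ_self]
        by_cases h : n = i
        · subst h; simp [qFact_succ, mul_comm]
        · rw [if_neg h, if_neg (by omega)]; simp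
      · intro k hk hkn
        have := Finset.mem_range.1 hk
        rw [Est_apply, if_neg (by omega), zero_mul, mul_zero]
      · intro h; simp at h

theorem Est_pow : Est d ζ ^ d = 0 := by
  refine ext_basis fun i j hi => ?_
  rw [Est_pow_apply, if_neg (by omega)]
  rfl

theorem smul_apply (c : ℂ) (f : TaftDual d ζ) (t : Taft d ζ) : (c • f) t = c * f t := rfl

theorem Est_mul_Kst :
    Est d ζ * (Kst d ζ : TaftDual d ζ) = ζ • ((Kst d ζ : TaftDual d ζ) * Est d ζ) := by
  refine ext_basis fun n m hn => ?_
  rw [smul_apply, mul_apply_basis, mul_apply_basis, Finset.sum_eq_single 0, Finset.sum_eq_single n]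
  · simp only [Est_apply, Kst_apply, qBinom_zero_right, Nat.sub_zero, qBinom_self]
    by_cases h : n = 1
    · subst h; simp [pow_add]
    · simp [h]
  · intro k hk hkn
    have := Finset.mem_range.1 hk
    rw [Kst_apply, if_neg (by omega), zero_mul, mul_zero]
  · intro h; simp at h
  · intro k _ hk
    rw [Kst_apply, if_neg hk, mul_zero, mul_zero]
  · intro h; simp at h

theorem Est_mul_Kst_inv :
    Est d ζ * (↑(Kst d ζ)⁻¹ : TaftDual d ζ) = ζ⁻¹ • (↑(Kst d ζ)⁻¹ * Est d ζ) := by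
  have h := congrArg (fun x => (↑(Kst d ζ)⁻¹ : TaftDual d ζ) * x * ↑(Kst d ζ)⁻¹) (Est_mul_Kst (d := d) (ζ := ζ))
  simp only [mul_smul_comm, smul_mul_assoc, mul_assoc, Units.mul_inv, Units.inv_mul_cancel_left, mul_one] at h
  rw [h, smul_smul, inv_mul_cancel₀ (zeta_ne_zero d ζ), one_smul]

/-! ### The antipode -/

/-- Both sides reverse products (`key` for the right one), so scalars and generators suffice. This
is what makes `f ↦ f ∘ S⁻¹` reverse convolution products. -/
theorem comulHom_Sinv (t : Taft d ζ) :
    comulHom d ζ (Sinv d ζ t) =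
      TensorProduct.comm ℂ _ _ (TensorProduct.map (Sinv d ζ) (Sinv d ζ) (comulHom d ζ t)) := by
  have key : ∀ x y : Taft d ζ ⊗[ℂ] Taft d ζ,
      TensorProduct.comm ℂ _ _ (TensorProduct.map (Sinv d ζ) (Sinv d ζ) (x * y)) =
        TensorProduct.comm ℂ _ _ (TensorProduct.map (Sinv d ζ) (Sinv d ζ) y) *
          TensorProduct.comm ℂ _ _ (TensorProduct.map (Sinv d ζ) (Sinv d ζ) x) := by
    intro x y
    induction x with
    | zero => simp
    | add a b ha hb => rw [add_mul, map_add, map_add, ha, hb, map_add, map_add, mul_add]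
    | tmul a b =>
      induction y with
      | zero => simp
      | add x y hx hy => rw [mul_add, map_add, map_add, hx, hy, map_add, map_add, add_mul]
      | tmul x y => simp [Sinv_mul]
  induction t using Taft.induction with
  | hc c =>
    rw [Sinv_algebraMap, AlgHom.commutes, Algebra.TensorProduct.algebraMap_apply]
    simp [Algebra.algebraMap_eq_smul_one, TensorProduct.smul_tmul]
  | hK => simp [comulHom_Kinv]
  | hE =>
    simp [comulHom_Kinv, mul_add, add_comm, TensorProduct.tmul_neg, TensorProduct.neg_tmul,
      Kinv_mul_K]
  | hadd a b ha hb => simp only [map_add, ha, hb]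
  | hmul a b ha hb => rw [Sinv_mul, map_mul, map_mul, ha, hb, key]

theorem antipodeCop_mul (f g : TaftDual d ζ) :
    antipodeCop d ζ (f * g) = antipodeCop d ζ g * antipodeCop d ζ f := by
  refine WithConv.ext (LinearMap.ext fun t => ?_)
  change (f * g) (Sinv d ζ t) = (antipodeCop d ζ g * antipodeCop d ζ f) t
  rw [mul_apply_of_comul, mul_apply_of_comul, comulHom_Sinv]
  induction comulHom d ζ t with
  | zero => simp
  | add a b ha hb => simp only [map_add, ha, hb]
  | tmul a b =>
    change f (Sinv d ζ b) * g (Sinv d ζ a) = g (Sinv d ζ a) * f (Sinv d ζ b)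
    exact mul_comm _ _

theorem antipodeCop_one : antipodeCop d ζ 1 = 1 := by
  refine WithConv.ext (LinearMap.ext fun t => ?_)
  change counitHom d ζ (Sinv d ζ t) = counitHom d ζ t
  induction t using Taft.induction with
  | hc c => rw [Sinv_algebraMap]
  | hK => rw [Sinv_K, Kinv, map_pow, counitHom_K, one_pow]
  | hE => simp
  | hadd a b ha hb => simp only [map_add, ha, hb]
  | hmul a b ha hb => rw [Sinv_mul, map_mul, map_mul, ha, hb, mul_comm]

theorem antipodeCop_pow (f : TaftDual d ζ) (n : ℕ) :
    antipodeCop d ζ (f ^ n) = antipodeCop d ζ f ^ n := by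
  induction n with
  | zero => rw [pow_zero, pow_zero, antipodeCop_one]
  | succ n ih => rw [pow_succ, antipodeCop_mul, ih, ← pow_succ']

theorem charK_Kinv : charK d ζ (Kinv d ζ) = ζ⁻¹ := by
  have h : charK d ζ (Kinv d ζ) * charK d ζ (Taft.K d ζ) = 1 := by
    rw [← map_mul, Kinv_mul_K, map_one]
  rw [charK, lift_K] at h
  exact eq_inv_of_mul_eq_one_left h

theorem antipodeCop_Kst :
    antipodeCop d ζ (Kst d ζ) = ↑(Kst d ζ)⁻¹ := by
  refine WithConv.ext (LinearMap.ext fun t => ?_)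
  change charK d ζ (Sinv d ζ t) = charKinv d ζ t
  induction t using Taft.induction with
  | hc c => rw [Sinv_algebraMap, AlgHom.commutes, AlgHom.commutes]
  | hK => rw [Sinv_K, charK_Kinv, charKinv, lift_K]
  | hE => simp [charK, charKinv, lift_E]
  | hadd a b ha hb => simp only [map_add, ha, hb]
  | hmul a b ha hb => rw [Sinv_mul, map_mul, map_mul, ha, hb, mul_comm]

theorem Sinv_K_pow (i : ℕ) : Sinv d ζ (Taft.K d ζ ^ i) = Kinv d ζ ^ i := by
  induction i with
  | zero => simp
  | succ i ih => rw [pow_succ, Sinv_mul, ih, Sinv_K, ← pow_succ']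

/-- The scalar is left unspecified since `E^*` only sees the first power of `E`, a case computed
directly in `antipodeCop_Est`. -/
theorem exists_Sinv_E_pow (i : ℕ) :
    ∃ c : ℂ, Sinv d ζ (Taft.E d ζ ^ i) = c • (Taft.E d ζ ^ i * Kinv d ζ ^ i) := by
  induction i with
  | zero => exact ⟨1, by simp⟩
  | succ i ih =>
    obtain ⟨c, hc⟩ := ih
    refine ⟨-(c * ζ⁻¹ ^ (i + 1)), ?_⟩
    rw [pow_succ, Sinv_mul, hc, Sinv_E, mul_smul_comm, neg_mul, mul_assoc (Kinv d ζ),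
      ← mul_assoc (Taft.E d ζ), ← pow_succ', ← mul_assoc, SimpleModule.Kinv_mul_E_pow,
      smul_mul_assoc, mul_assoc, ← pow_succ', smul_neg, smul_smul, neg_smul, ← pow_succ]

theorem Kinv_pow_mul_E_pow (i j : ℕ) :
    Kinv d ζ ^ j * Taft.E d ζ ^ i = (ζ⁻¹ ^ i) ^ j • (Taft.E d ζ ^ i * Kinv d ζ ^ j) := by
  induction j with
  | zero => simp
  | succ j ih =>
    rw [pow_succ (Kinv d ζ), mul_assoc, SimpleModule.Kinv_mul_E_pow, mul_smul_comm, ← mul_assoc,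
      ih, smul_mul_assoc, smul_smul, mul_assoc, ← pow_succ, ← pow_succ']

theorem antipodeCop_Est :
    antipodeCop d ζ (Est d ζ) = (-1 : ℂ) • (Est d ζ * ↑(Kst d ζ)⁻¹) := by
  -- With the inverse of `K^*` moved to the left, only `k = 0` survives in the convolution. For `n =
  -- 1`, the power `ζ⁻¹ ^ (m + 1)` created by moving `K⁻¹` past `E` cancels the value of `K^*` at `K
  -- ^ (1 + m)`.
  have h : antipodeCop d ζ (Est d ζ) * (Kst d ζ : TaftDual d ζ) = (-1 : ℂ) • Est d ζ := by
    refine ext_basis fun n m hn => ?_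
    rw [mul_apply_basis, Finset.sum_eq_single 0]
    · rw [Kst_apply, if_pos rfl, qBinom_zero_right, one_mul, Nat.sub_zero]
      change Est d ζ (Sinv d ζ (Taft.E d ζ ^ n * Taft.K d ζ ^ m)) * _ = (-1 : ℂ) * (Est d ζ _)
      rw [Sinv_mul, Sinv_K_pow, Est_apply]
      by_cases hn1 : n = 1
      · subst hn1
        have hz := zeta_ne_zero d ζ
        have h3 := Kinv_pow_mul_E_pow (d := d) (ζ := ζ) 1 (m + 1)
        have h4 := Est_apply (d := d) (ζ := ζ) 1 ((d - 1) * (m + 1))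
        rw [pow_one] at h3 h4
        rw [pow_one, Sinv_E, mul_neg, ← mul_assoc, ← pow_succ, h3, map_neg, map_smul, Kinv,
          ← pow_mul (Taft.K d ζ), h4, if_pos rfl, smul_eq_mul, mul_one, neg_mul,
          pow_one, add_comm 1 m, ← mul_pow, inv_mul_cancel₀ hz, one_pow, mul_one]
      · obtain ⟨c, hc⟩ := exists_Sinv_E_pow (d := d) (ζ := ζ) n
        rw [hc, mul_smul_comm, ← mul_assoc, Kinv_pow_mul_E_pow, smul_mul_assoc, mul_assoc,
          ← pow_add, Kinv, ← pow_mul (Taft.K d ζ), map_smul, map_smul, Est_apply, if_neg hn1]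
        simp
    · intro k _ hk
      rw [Kst_apply, if_neg hk, mul_zero, mul_zero]
    · intro h; simp at h
  have := congrArg (fun x => x * (↑(Kst d ζ)⁻¹ : TaftDual d ζ)) h
  simpa only [mul_assoc, Units.mul_inv, mul_one, smul_mul_assoc] using this

end TaftDual

/-! ### Periodic sums, character sums and `q`-commutation. -/

theorem sum_range_shift {A : Type*} [AddCommMonoid A] (d m : ℕ) (f : ℕ → A)
    (hf : ∀ n, f (n + d) = f n) :
    ∑ i ∈ Finset.range d, f (m + i) = ∑ i ∈ Finset.range d, f i := by
  induction m with
  | zero => simp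
  | succ m ih =>
    rw [← ih]
    cases d with
    | zero => simp
    | succ e =>
      rw [Finset.sum_range_succ, Finset.sum_range_succ' (fun i => f (m + i))]
      congr 1
      · exact Finset.sum_congr rfl fun i _ => by rw [show m + 1 + i = m + (i + 1) by omega]
      · rw [← hf (m + 0)]; congr 1; omega

theorem sum_zpow_mul (m : ℤ) :
    ∑ k ∈ Finset.range d, ζ ^ (m * k) = if (d : ℤ) ∣ m then (d : ℂ) else 0 := by
  have hp := prim d ζ
  simp only [zpow_mul, zpow_natCast]
  split_ifs with h
  · rw [(hp.zpow_eq_one_iff_dvd m).2 h]; simp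
  · have h1 : ζ ^ m ≠ 1 := fun h' => h ((hp.zpow_eq_one_iff_dvd m).1 h')
    have h2 := geom_sum_mul (ζ ^ m) d
    have h3 : (ζ ^ m) ^ d = 1 := by
      rw [← zpow_natCast, ← zpow_mul, mul_comm, zpow_mul, zpow_natCast, hp.pow_eq_one, one_zpow]
    rw [h3, sub_self] at h2
    exact (mul_eq_zero.1 h2).resolve_right (sub_ne_zero.2 h1)

theorem inv_pow_mul_zpow {ζ : ℂ} (hz : ζ ≠ 0) (k j : ℕ) (s : ℤ) :
    ζ⁻¹ ^ (k * j) * (ζ ^ s) ^ k = ζ ^ ((s - j) * k) := by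
  rw [inv_pow, ← zpow_natCast, ← zpow_natCast, ← zpow_mul, ← zpow_neg, ← zpow_add₀ hz]
  congr 1
  push_cast
  ring

/-- The relations between the generators `K`, `H = K^*`, `E`, `F` of the double. -/
structure DoubleRelations {A : Type*} [Ring A] [Algebra ℂ A] (d : ℕ) (ζ : ℂ)
    (K Ki H Hi E F : A) : Prop where
  K_mul_Ki : K * Ki = 1
  Ki_mul_K : Ki * K = 1
  H_mul_Hi : H * Hi = 1
  Hi_mul_H : Hi * H = 1
  K_pow : K ^ d = 1
  H_pow : H ^ d = 1
  F_pow : F ^ d = 0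
  comm : K * H = H * K
  K_mul_E : K * E = ζ • (E * K)
  K_mul_F : K * F = ζ⁻¹ • (F * K)
  H_mul_E : H * E = ζ • (E * H)
  H_mul_F : H * F = ζ⁻¹ • (F * H)
  E_mul_F : E * F = F * E + K - Hi

theorem qcomm_pow {A : Type*} [Ring A] [Algebra ℂ A] {x y : A} {c : ℂ} (h : x * y = c • (y * x))
    (m n : ℕ) : x ^ m * y ^ n = c ^ (m * n) • (y ^ n * x ^ m) := by
  have h1 : ∀ n, x * y ^ n = c ^ n • (y ^ n * x) := by
    intro n
    induction n with
    | zero => simp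
    | succ n ih =>
      rw [pow_succ y, ← mul_assoc, ih, smul_mul_assoc, mul_assoc, h, mul_smul_comm, smul_smul,
        ← pow_succ, mul_assoc]
  induction m with
  | zero => simp
  | succ m ih =>
    rw [pow_succ x, mul_assoc, h1, mul_smul_comm, ← mul_assoc, ih, smul_mul_assoc, smul_smul,
      mul_assoc, ← pow_add, show n + m * n = (m + 1) * n by ring]

theorem qcomm_inv {A : Type*} [Ring A] [Algebra ℂ A] {x xi y : A} {c : ℂ} (hc : c ≠ 0)
    (h : x * y = c • (y * x)) (h1 : x * xi = 1) (h2 : xi * x = 1) :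
    xi * y = c⁻¹ • (y * xi) := by
  have h3 : xi * (x * y) * xi = c • (xi * (y * x) * xi) := by
    rw [h, mul_smul_comm, smul_mul_assoc]
  rw [← mul_assoc, h2, one_mul, mul_assoc, mul_assoc, h1, mul_one] at h3
  rw [h3, smul_smul, inv_mul_cancel₀ hc, one_smul]

/-! ### The Drinfeld element and the twist, from the relations alone. -/

namespace DoubleRelations

variable {A : Type*} [Ring A] [Algebra ℂ A] {K Ki H Hi E F : A}

variable (d ζ) in
/-- The spectral projection of `Hi` for the eigenvalue `ζ ^ j`. -/
noncomputable def proj (Hi : A) (j : ℕ) : A :=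
  (d : ℂ)⁻¹ • ∑ k ∈ Finset.range d, ζ⁻¹ ^ (k * j) • Hi ^ k

variable (d ζ) in
/-- The torus part of the Drinfeld element. -/
noncomputable def torus (K Hi : A) : A := ∑ j ∈ Finset.range d, proj d ζ Hi j * K ^ j

variable (ζ) in
/-- The coefficient of `F ^ i E ^ i` in the Drinfeld element. -/
noncomputable def uCoeff (i : ℕ) : ℂ := (-ζ⁻¹) ^ i * (qFact ζ i)⁻¹

variable (d ζ) in
/-- The nilpotent part of the Drinfeld element. -/
noncomputable def unip (Ki E F : A) : A :=
  ∑ i ∈ Finset.range d, uCoeff ζ i • (F ^ i * E ^ i * Ki ^ i)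

theorem proj_add_d (Hi : A) (j : ℕ) : proj d ζ Hi (j + d) = proj d ζ Hi j := by
  rw [proj, proj]
  congr 1
  refine Finset.sum_congr rfl fun k _ => ?_
  rw [mul_add, pow_add, mul_comm k d, pow_mul _ d, inv_pow ζ d, (prim d ζ).pow_eq_one, inv_one, one_pow,
    mul_one]

/-- Summing over `j` first, orthogonality of characters kills every power of `Hi` except the zeroth.
-/
theorem sum_proj (Hi : A) : ∑ j ∈ Finset.range d, proj d ζ Hi j = 1 := by
  have hd : (d : ℂ) ≠ 0 := Nat.cast_ne_zero.2 (d_ne_zero d)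
  simp only [proj]
  rw [← Finset.smul_sum, Finset.sum_comm]
  simp only [← Finset.sum_smul]
  have h : ∀ k ∈ Finset.range d, (∑ j ∈ Finset.range d, ζ⁻¹ ^ (k * j)) • Hi ^ k =
      if k = 0 then (d : ℂ) • (1 : A) else 0 := by
    intro k hk
    have h1 := sum_zpow_mul (d := d) (ζ := ζ) (-(k : ℤ))
    have h2 : ∀ j : ℕ, ζ ^ (-(k : ℤ) * j) = ζ⁻¹ ^ (k * j) := by
      intro j
      rw [inv_pow, ← zpow_natCast, ← zpow_neg]
      push_cast
      ring_nf
    simp only [h2] at h1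
    rw [h1]
    have := Finset.mem_range.1 hk
    by_cases h0 : k = 0
    · subst h0; simp
    · rw [if_neg h0, if_neg, zero_smul]
      rw [dvd_neg, Int.natCast_dvd_natCast]
      exact Nat.not_dvd_of_pos_of_lt (Nat.pos_of_ne_zero h0) this
  rw [Finset.sum_congr rfl h, Finset.sum_ite_eq' , if_pos (Finset.mem_range.2 (Nat.pos_of_ne_zero (d_ne_zero d))),
    smul_smul, inv_mul_cancel₀ hd, one_smul]

theorem commute_proj {x : A} (h : Commute x Hi) (j : ℕ) : Commute x (proj d ζ Hi j) :=
  (Commute.sum_right _ _ _ fun k _ => (h.pow_right k).smul_right _).smul_right _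

variable (r : DoubleRelations d ζ K Ki H Hi E F)
include r

theorem commute_Ki_K : Commute Ki K := by rw [Commute, SemiconjBy, r.Ki_mul_K, r.K_mul_Ki]

theorem commute_Hi_H : Commute Hi H := by rw [Commute, SemiconjBy, r.Hi_mul_H, r.H_mul_Hi]

theorem commute_K_Hi : Commute K Hi := by
  have h : Hi * (K * H) * Hi = Hi * (H * K) * Hi := by rw [r.comm]
  rw [← mul_assoc Hi H, r.Hi_mul_H, one_mul, mul_assoc, mul_assoc, r.H_mul_Hi, mul_one] at h
  exact h.symm

theorem commute_Ki_Hi : Commute Ki Hi := by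
  have h : Ki * (K * Hi) * Ki = Ki * (Hi * K) * Ki := by rw [r.commute_K_Hi.eq]
  rw [← mul_assoc Ki K, r.Ki_mul_K, one_mul, mul_assoc, mul_assoc, r.K_mul_Ki, mul_one] at h
  exact h.symm

theorem Hi_mul_F : Hi * F = ζ • (F * Hi) := by
  have := qcomm_inv (inv_ne_zero (zeta_ne_zero d ζ)) r.H_mul_F r.H_mul_Hi r.Hi_mul_H
  rwa [inv_inv] at this

theorem Hi_mul_E : Hi * E = ζ⁻¹ • (E * Hi) :=
  qcomm_inv (zeta_ne_zero d ζ) r.H_mul_E r.H_mul_Hi r.Hi_mul_H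

theorem Ki_mul_F : Ki * F = ζ • (F * Ki) := by
  have := qcomm_inv (inv_ne_zero (zeta_ne_zero d ζ)) r.K_mul_F r.K_mul_Ki r.Ki_mul_K
  rwa [inv_inv] at this

theorem Hi_pow : Hi ^ d = 1 := by
  have h := r.commute_Hi_H.symm.mul_pow d
  rw [r.H_mul_Hi, one_pow, r.H_pow, one_mul] at h
  exact h.symm

/-- Multiplication by `Hi` shifts the summation index by one, which is harmless because `Hi ^ d =
1`. -/
theorem Hi_mul_proj (j : ℕ) : Hi * proj d ζ Hi j = ζ ^ j • proj d ζ Hi j := by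
  have hz := zeta_ne_zero d ζ
  rw [proj, mul_smul_comm, smul_comm]
  congr 1
  rw [Finset.mul_sum]
  conv_rhs => rw [← sum_range_shift d 1 (fun k => ζ⁻¹ ^ (k * j) • Hi ^ k) (by
    intro n
    rw [pow_add, r.Hi_pow, mul_one, add_mul, pow_add, pow_mul _ d, inv_pow ζ d,
      (prim d ζ).pow_eq_one, inv_one, one_pow, mul_one]), Finset.smul_sum]
  refine Finset.sum_congr rfl fun k _ => ?_
  rw [mul_smul_comm, ← pow_succ', smul_smul, add_mul, pow_add ζ⁻¹, one_mul, ← mul_assoc, ← mul_pow,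
    mul_inv_cancel₀ hz, one_pow, one_mul, add_comm 1 k]

theorem Hi_pow_mul_proj (k j : ℕ) : Hi ^ k * proj d ζ Hi j = (ζ ^ j) ^ k • proj d ζ Hi j := by
  induction k with
  | zero => simp
  | succ k ih =>
    rw [pow_succ, mul_assoc, r.Hi_mul_proj, mul_smul_comm, ih, smul_smul, ← pow_succ']

theorem H_mul_proj (j : ℕ) : H * proj d ζ Hi j = ζ⁻¹ ^ j • proj d ζ Hi j := by
  have hz := zeta_ne_zero d ζ
  have h := congrArg (fun x => ζ⁻¹ ^ j • (H * x)) (r.Hi_mul_proj j)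
  rw [← mul_assoc, r.H_mul_Hi, one_mul, mul_smul_comm, smul_smul, ← mul_pow, inv_mul_cancel₀ hz,
    one_pow, one_smul] at h
  exact h.symm

theorem proj_mul_proj (i j : ℕ) (hi : i < d) (hj : j < d) :
    proj d ζ Hi i * proj d ζ Hi j = if i = j then proj d ζ Hi j else 0 := by
  have hd : (d : ℂ) ≠ 0 := Nat.cast_ne_zero.2 (d_ne_zero d)
  rw [proj, smul_mul_assoc, Finset.sum_mul]
  have h : ∀ k : ℕ, ζ⁻¹ ^ (k * i) • Hi ^ k * proj d ζ Hi j =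
      ζ ^ (((j : ℤ) - i) * k) • proj d ζ Hi j := by
    intro k
    rw [smul_mul_assoc, r.Hi_pow_mul_proj, smul_smul, ← inv_pow_mul_zpow (zeta_ne_zero d ζ), zpow_natCast]
  simp only [h]
  rw [← Finset.sum_smul, sum_zpow_mul, smul_smul]
  by_cases hij : i = j
  · subst hij
    rw [sub_self, if_pos (dvd_zero _), if_pos rfl, inv_mul_cancel₀ hd, one_smul]
  · rw [if_neg, if_neg hij, mul_zero, zero_smul]
    intro h
    have := Int.eq_zero_of_abs_lt_dvd h (by rw [abs_lt]; omega)
    omega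

/-- The torus part is `K ^ j` on the image of the `j`-th projection, so it is inverted by `Ki ^ j`
there. A right inverse is enough for `isUnit_twist`. -/
theorem exists_torus_mul_eq_one : ∃ y, torus d ζ K Hi * y = 1 := by
  refine ⟨∑ j ∈ Finset.range d, proj d ζ Hi j * Ki ^ j, ?_⟩
  have hKP : ∀ i j, Commute (K ^ i) (proj d ζ Hi j) := fun i j =>
    commute_proj (r.commute_K_Hi.pow_left i) j
  rw [torus, Finset.sum_mul, ← sum_proj (d := d) (ζ := ζ) Hi]
  refine Finset.sum_congr rfl fun i hi => ?_
  rw [Finset.mul_sum, Finset.sum_eq_single i]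
  · rw [mul_assoc, ← mul_assoc (K ^ i), (hKP i i).eq, mul_assoc, ← r.commute_Ki_K.symm.mul_pow,
      r.K_mul_Ki, one_pow, mul_one, r.proj_mul_proj _ _ (Finset.mem_range.1 hi) (Finset.mem_range.1 hi),
      if_pos rfl]
  · intro j hj hij
    rw [mul_assoc, ← mul_assoc (K ^ i), (hKP i j).eq, mul_assoc, ← mul_assoc,
      r.proj_mul_proj _ _ (Finset.mem_range.1 hi) (Finset.mem_range.1 hj), if_neg hij.symm, zero_mul]
  · intro h; exact absurd hi h

theorem proj_succ_mul_F (j : ℕ) : proj d ζ Hi (j + 1) * F = F * proj d ζ Hi j := by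
  have hz := zeta_ne_zero d ζ
  rw [proj, proj, smul_mul_assoc, mul_smul_comm, Finset.sum_mul, Finset.mul_sum]
  congr 1
  refine Finset.sum_congr rfl fun k _ => ?_
  have := qcomm_pow r.Hi_mul_F k 1
  rw [pow_one, mul_one] at this
  rw [smul_mul_assoc, this, smul_smul, mul_smul_comm, mul_add, pow_add, mul_one, mul_assoc,
    ← mul_pow, inv_mul_cancel₀ hz, one_pow, mul_one]

/-- Since `F` carries the eigenspace of index `j` of `Hi` to that of index `j + 1`, the exponent of
`K` in the torus part goes up by one: this is the factor `K`. Commuting `K ^ (j + 1)` with `F` also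
leaves `ζ⁻¹ ^ (j + 1)`, where `ζ⁻¹ ^ j` is the eigenvalue of `H` on the `j`-th projection. -/
theorem torus_mul_F : torus d ζ K Hi * F = ζ⁻¹ • (F * K * H * torus d ζ K Hi) := by
  have hper : ∀ n, proj d ζ Hi (n + d) * K ^ (n + d) = proj d ζ Hi n * K ^ n := by
    intro n
    rw [proj_add_d, pow_add, r.K_pow, mul_one]
  -- The summand is periodic in `j`, so the left sum may start at `1`; it then matches the right one
  -- term by term.
  conv_lhs => rw [torus, ← sum_range_shift d 1 (fun j => proj d ζ Hi j * K ^ j) hper]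
  rw [torus, Finset.sum_mul, Finset.mul_sum, Finset.smul_sum]
  refine Finset.sum_congr rfl fun j _ => ?_
  have h1 := qcomm_pow r.K_mul_F (1 + j) 1
  rw [pow_one, mul_one] at h1
  rw [mul_assoc, h1, mul_smul_comm, ← mul_assoc, add_comm 1 j, r.proj_succ_mul_F,
    ← mul_assoc (F * K * H), mul_assoc (F * K) H, r.H_mul_proj, mul_smul_comm, smul_mul_assoc,
    smul_smul, ← pow_succ', mul_assoc F K, (commute_proj r.commute_K_Hi j).eq, ← mul_assoc F,
    mul_assoc _ K, ← pow_succ']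

/-- Carrying `F` through the factors `E` one at a time produces `i + 1` copies of `K - Hi`. Moving
them to the right of the remaining factors `E` gives the sums of `ζ ^ s` for `K` and of `ζ⁻¹ ^ s`
for `Hi`, with `0 ≤ s ≤ i`. -/
theorem E_pow_mul_F (i : ℕ) :
    E ^ (i + 1) * F = F * E ^ (i + 1) +
      E ^ i * (qInt ζ (i + 1) • K - (ζ⁻¹ ^ i * qInt ζ (i + 1)) • Hi) := by
  have hz := zeta_ne_zero d ζ
  induction i with
  | zero => simp [qInt, r.E_mul_F, add_sub_assoc]
  | succ i ih =>
    have h1 : K * E ^ (i + 1) = ζ ^ (i + 1) • (E ^ (i + 1) * K) := by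
      have := qcomm_pow r.K_mul_E 1 (i + 1)
      rwa [pow_one, one_mul] at this
    have h2 : Hi * E ^ (i + 1) = ζ⁻¹ ^ (i + 1) • (E ^ (i + 1) * Hi) := by
      have := qcomm_pow r.Hi_mul_E 1 (i + 1)
      rwa [pow_one, one_mul] at this
    have h3 : qInt ζ (i + 1 + 1) = qInt ζ (i + 1) + ζ ^ (i + 1) := by
      rw [qInt, qInt, Finset.sum_range_succ _ (i + 1)]
    have h4 : qInt ζ (i + 1 + 1) = 1 + ζ * qInt ζ (i + 1) := by
      rw [add_comm (i + 1) 1, qInt_add]; simp [qInt]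
    have h5 : ζ⁻¹ ^ (i + 1) * qInt ζ (i + 1 + 1) = ζ⁻¹ ^ (i + 1) + ζ⁻¹ ^ i * qInt ζ (i + 1) := by
      rw [h4, pow_succ]
      field_simp
    rw [h5, h3, pow_succ' E (i + 1), mul_assoc, ih, mul_add, ← mul_assoc, r.E_mul_F, sub_mul,
      add_mul, h1, h2, mul_assoc F, ← mul_assoc E (E ^ i), ← pow_succ' E i, ← pow_succ' E (i + 1)]
    simp only [mul_add, mul_sub, mul_smul_comm, add_smul]
    abel

/-- The sum telescopes. By the commutator formula the term of index `i + 1` on the left is `X (i +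
1) - X i + Y i`, where `Y i` is `F` times the term of index `i` of the nilpotent part. The
coefficients `uCoeff` are those for which the `K`-part of the commutator cancels the previous `X`.
The two boundary terms of index `d - 1`, one on each side, contain `F ^ d = 0`. -/
theorem unip_mul_F : unip d ζ Ki E F * (F * K * H) = F * unip d ζ Ki E F := by
  have hz := zeta_ne_zero d ζ
  obtain ⟨e, he⟩ : ∃ e, d = e + 1 := ⟨d - 1, by have := d_ne_zero d; omega⟩
  have hKiF : ∀ i, Ki ^ i * F = ζ ^ i • (F * Ki ^ i) := by
    intro i
    have := qcomm_pow r.Ki_mul_F i 1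
    rwa [pow_one, mul_one] at this
  have hKKi := r.commute_Ki_K.symm
  have hKiH : Commute Ki H := by
    have h : Ki * (K * H) * Ki = Ki * (H * K) * Ki := by rw [r.comm]
    rw [← mul_assoc Ki K, r.Ki_mul_K, one_mul, mul_assoc, mul_assoc, r.K_mul_Ki, mul_one] at h
    exact h.symm
  -- the contributions of `F E ^ i` and of the commutator
  set X : ℕ → A := fun i => (uCoeff ζ i * ζ ^ i) • (F ^ (i + 1) * E ^ i * (K * H) * Ki ^ i) with hX
  set Y : ℕ → A := fun i => uCoeff ζ i • (F ^ (i + 1) * E ^ i * Ki ^ i) with hY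
  have h0 : uCoeff ζ 0 • (F ^ 0 * E ^ 0 * Ki ^ 0) * (F * K * H) = X 0 := by
    simp [hX, mul_assoc]
  have hs : ∀ i, i + 1 < d →
      uCoeff ζ (i + 1) • (F ^ (i + 1) * E ^ (i + 1) * Ki ^ (i + 1)) * (F * K * H) =
        X (i + 1) - X i + Y i := by
    intro i hi
    have hq := qInt_ne_zero (prim d ζ) (i + 1) (by omega) hi
    have hf := qFact_ne_zero (prim d ζ) i (by omega)
    -- The `q`-integer of the commutator cancels the last factor of the `q`-factorial; this needs `i
    -- + 1 < d`.
    have hc : uCoeff ζ (i + 1) * qInt ζ (i + 1) = -ζ⁻¹ * uCoeff ζ i := by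
      rw [uCoeff, uCoeff, qFact_succ, pow_succ]
      field_simp
    have e1 : F ^ (i + 1) * E ^ (i + 1) * Ki ^ (i + 1) * (F * K * H) =
        ζ ^ (i + 1) • (F ^ (i + 1) * (E ^ (i + 1) * F) * (K * H) * Ki ^ (i + 1)) := by
      have e0 : Ki ^ (i + 1) * (K * H) = K * H * Ki ^ (i + 1) :=
        (((hKKi.symm.mul_right hKiH).pow_left (i + 1))).eq
      rw [mul_assoc F K H, mul_assoc (F ^ (i + 1) * E ^ (i + 1)), ← mul_assoc (Ki ^ (i + 1)), hKiF,
        smul_mul_assoc, mul_smul_comm, mul_assoc F, e0]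
      simp only [mul_assoc]
    have e2 : K * (K * H) * Ki ^ (i + 1) = K * H * Ki ^ i := by
      rw [pow_succ', ← mul_assoc, mul_assoc K (K * H), (hKKi.symm.mul_right hKiH).symm.eq,
        ← mul_assoc K Ki, r.K_mul_Ki, one_mul]
    have e3 : Hi * (K * H) * Ki ^ (i + 1) = Ki ^ i := by
      rw [r.comm, ← mul_assoc, r.Hi_mul_H, one_mul, pow_succ', ← mul_assoc, r.K_mul_Ki, one_mul]
    have e4 : F ^ (i + 1) * (E ^ (i + 1) * F) * (K * H) * Ki ^ (i + 1) =
        F ^ (i + 1 + 1) * E ^ (i + 1) * (K * H) * Ki ^ (i + 1) +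
        qInt ζ (i + 1) • (F ^ (i + 1) * E ^ i * (K * H) * Ki ^ i) -
        (ζ⁻¹ ^ i * qInt ζ (i + 1)) • (F ^ (i + 1) * E ^ i * Ki ^ i) := by
      calc _ = F ^ (i + 1) * F * E ^ (i + 1) * (K * H) * Ki ^ (i + 1) +
            qInt ζ (i + 1) • (F ^ (i + 1) * E ^ i * (K * (K * H) * Ki ^ (i + 1))) -
            (ζ⁻¹ ^ i * qInt ζ (i + 1)) • (F ^ (i + 1) * E ^ i * (Hi * (K * H) * Ki ^ (i + 1))) := by
            rw [r.E_pow_mul_F]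
            simp only [mul_add, add_mul, mul_sub, sub_mul, mul_smul_comm, smul_mul_assoc, mul_assoc]
            abel
        _ = _ := by rw [e2, e3, ← pow_succ, ← mul_assoc (F ^ (i + 1) * E ^ i)]
    rw [smul_mul_assoc, e1, e4, smul_smul, smul_sub, smul_add, smul_smul, smul_smul]
    have c1 : uCoeff ζ (i + 1) * ζ ^ (i + 1) * qInt ζ (i + 1) = -(uCoeff ζ i * ζ ^ i) := by
      rw [mul_right_comm, hc, pow_succ]
      field_simp
    have c2 : uCoeff ζ (i + 1) * ζ ^ (i + 1) * (ζ⁻¹ ^ i * qInt ζ (i + 1)) = -uCoeff ζ i := by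
      rw [mul_comm (ζ⁻¹ ^ i), ← mul_assoc, c1, neg_mul, mul_assoc, ← mul_pow, mul_inv_cancel₀ hz,
        one_pow, mul_one]
    rw [c1, c2, hX, hY]
    simp only [neg_smul]
    abel
  have hsum : ∀ n, n < d → ∑ i ∈ Finset.range (n + 1),
      uCoeff ζ i • (F ^ i * E ^ i * Ki ^ i) * (F * K * H) = X n + ∑ i ∈ Finset.range n, Y i := by
    intro n hn
    induction n with
    | zero => rw [Finset.sum_range_one, h0]; simp
    | succ n ih =>
      rw [Finset.sum_range_succ, ih (by omega), hs n hn, Finset.sum_range_succ Y]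
      abel
  have hXe : X e = 0 := by
    simp only [hX]
    rw [← he, r.F_pow]
    simp
  rw [unip, Finset.sum_mul, Finset.mul_sum]
  nth_rw 1 [he]
  rw [hsum e (by omega), hXe, zero_add, he, Finset.sum_range_succ, ← add_zero (∑ i ∈ Finset.range e, Y i)]
  congr 1
  · refine Finset.sum_congr rfl fun i _ => ?_
    simp only [hY]
    rw [mul_smul_comm, ← mul_assoc, ← mul_assoc, ← pow_succ']
  · rw [mul_smul_comm, ← mul_assoc, ← mul_assoc, ← pow_succ', ← he, r.F_pow]
    simp

/-- The torus part turns `F` into `ζ⁻¹ F K H`, the nilpotent part turns `F K H` back into `F`, and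
passing `F` through `Hi` absorbs the scalar. -/
theorem twist_mul_F : Hi * (unip d ζ Ki E F * torus d ζ K Hi) * F =
    F * (Hi * (unip d ζ Ki E F * torus d ζ K Hi)) := by
  have hz := zeta_ne_zero d ζ
  have h : F * Hi = ζ⁻¹ • (Hi * F) := by
    rw [r.Hi_mul_F, smul_smul, inv_mul_cancel₀ hz, one_smul]
  rw [← mul_assoc F, h, smul_mul_assoc, mul_assoc Hi, mul_assoc Hi, mul_assoc (unip d ζ Ki E F), r.torus_mul_F,
    mul_smul_comm, mul_smul_comm, ← mul_assoc (unip d ζ Ki E F), r.unip_mul_F, mul_assoc F]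

/-- The nilpotent part is `1` modulo the right ideal `F A`, which gives `t b + F x = 1`. As `F`
commutes with `t`, this identity can be substituted into itself until `F ^ d = 0` appears, leaving a
right inverse of `t`. In a finite-dimensional algebra a right inverse is two-sided. -/
theorem isUnit_twist [FiniteDimensional ℂ A] :
    IsUnit (Hi * (unip d ζ Ki E F * torus d ζ K Hi)) := by
  set t := Hi * (unip d ζ Ki E F * torus d ζ K Hi) with ht
  have hcomm : t * F = F * t := r.twist_mul_F
  obtain ⟨y, hy⟩ := r.exists_torus_mul_eq_one
  obtain ⟨e, he⟩ : ∃ e, d = e + 1 := ⟨d - 1, by have := d_ne_zero d; omega⟩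
  have hbase : ∃ b x, t * b + F * x = 1 := by
    have h1 : unip d ζ Ki E F = 1 + F * ∑ i ∈ Finset.range e,
        uCoeff ζ (i + 1) • (F ^ i * E ^ (i + 1) * Ki ^ (i + 1)) := by
      conv_lhs => rw [unip, he, Finset.sum_range_succ']
      rw [add_comm, Finset.mul_sum]
      congr 1
      · simp [uCoeff, qFact_zero]
      · refine Finset.sum_congr rfl fun i _ => ?_
        rw [mul_smul_comm, ← mul_assoc, ← mul_assoc, ← pow_succ']
    set w := ∑ i ∈ Finset.range e, uCoeff ζ (i + 1) • (F ^ i * E ^ (i + 1) * Ki ^ (i + 1))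
    -- Here `y` undoes the torus part and `H` undoes `Hi`. The error term `Hi * (F * w) * H` lies in
    -- `F A` because `Hi F = ζ F Hi`.
    refine ⟨y * H, -(ζ • (Hi * w * H)), ?_⟩
    have h2 : t * (y * H) = Hi * (1 + F * w) * H := by
      rw [ht, h1, mul_assoc, mul_assoc (1 + F * w), ← mul_assoc (torus d ζ K Hi), hy, one_mul,
        mul_assoc]
    rw [h2, mul_add, mul_one, add_mul, r.Hi_mul_H, ← mul_assoc Hi F, r.Hi_mul_F, mul_neg,
      mul_smul_comm, smul_mul_assoc, smul_mul_assoc]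
    simp only [mul_assoc]
    abel
  obtain ⟨b, x, hbx⟩ := hbase
  have hn : ∀ n : ℕ, ∃ b' x', t * b' + F ^ n * x' = 1 := by
    intro n
    induction n with
    | zero => exact ⟨0, 1, by simp⟩
    | succ n ih =>
      obtain ⟨b', x', h'⟩ := ih
      have hc : t * F ^ n = F ^ n * t := (show Commute t F from hcomm).pow_right n
      refine ⟨b' + F ^ n * b * x', x * x', ?_⟩
      calc t * (b' + F ^ n * b * x') + F ^ (n + 1) * (x * x')
          = t * b' + (t * F ^ n) * b * x' + F ^ n * F * x * x' := by
            rw [pow_succ]; noncomm_ring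
        _ = t * b' + F ^ n * (t * b + F * x) * x' := by rw [hc]; noncomm_ring
        _ = 1 := by rw [hbx, mul_one, h']
  obtain ⟨b', x', h'⟩ := hn d
  rw [r.F_pow, zero_mul, add_zero] at h'
  have : IsArtinianRing A := IsArtinianRing.of_finite ℂ A
  exact IsUnit.of_mul_eq_one b' h'

end DoubleRelations

/-- The indices `i` and `j` decouple: for fixed `i` the torus part may be summed over `i + j` by
periodicity, and the extra `K ^ i` cancels `Ki ^ i`. The projections move freely since `F ^ i E ^ i`
commutes with `Hi`. -/
theorem DoubleRelations.sum_eq_unip_mul_torus {A : Type*} [Ring A] [Algebra ℂ A]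
    {K Ki H Hi E F : A} (r : DoubleRelations d ζ K Ki H Hi E F) :
    ∑ i ∈ Finset.range d, ∑ j ∈ Finset.range d,
      uCoeff ζ i • (proj d ζ Hi (i + j) * F ^ i) * (E ^ i * K ^ j) =
      unip d ζ Ki E F * torus d ζ K Hi := by
  rw [unip, Finset.sum_mul]
  refine Finset.sum_congr rfl fun i _ => ?_
  have hc : Commute (F ^ i * E ^ i) Hi := by
    have hz := zeta_ne_zero d ζ
    have h1 := qcomm_pow r.Hi_mul_F 1 i
    have h2 := qcomm_pow r.Hi_mul_E 1 i
    rw [pow_one, one_mul] at h1 h2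
    refine Commute.symm ?_
    rw [Commute, SemiconjBy, ← mul_assoc, h1, smul_mul_assoc, mul_assoc, h2, mul_smul_comm,
      smul_smul, ← mul_pow, mul_inv_cancel₀ hz, one_pow, one_smul, mul_assoc]
  have ht : torus d ζ K Hi = ∑ j ∈ Finset.range d, proj d ζ Hi (i + j) * K ^ (i + j) :=
    (sum_range_shift d i (fun j => proj d ζ Hi j * K ^ j) fun n => by
      rw [proj_add_d, pow_add, r.K_pow, mul_one]).symm
  rw [ht, Finset.mul_sum]
  refine Finset.sum_congr rfl fun j _ => ?_
  rw [smul_mul_assoc, smul_mul_assoc, mul_assoc (F ^ i * E ^ i), ← mul_assoc (Ki ^ i),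
    (commute_proj (r.commute_Ki_Hi.pow_left i) (i + j)).eq, mul_assoc _ (Ki ^ i), pow_add K,
    ← mul_assoc (Ki ^ i), ← r.commute_Ki_K.mul_pow, r.Ki_mul_K, one_pow, one_mul,
    ← mul_assoc (F ^ i * E ^ i), (commute_proj hc (i + j)).eq]
  simp only [mul_assoc]

/-! ### Relations in the double, the twist and the pivot. -/

namespace Double

theorem K_mul_inDual (g : TaftDual d ζ) :
    (K d ζ : Double d ζ) * inDual d ζ g =
      inDual d ζ (TaftDual.shiftR d ζ (Taft.K d ζ) (TaftDual.shiftL d ζ (.op (Kinv d ζ)) g)) *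
        K d ζ := by
  change inB d ζ (Taft.K d ζ) * ofSpace d ζ (DoubleSpace.mk d ζ g 1) = _ * inB d ζ (Taft.K d ζ)
  rw [inB_mul, DoubleSpace.leftB_K, inDual_mul_inB, mul_one]
  rfl

theorem E_mul_inDual (g : TaftDual d ζ) :
    E d ζ * inDual d ζ g =
      -inDual d ζ (TaftDual.shiftL d ζ (.op (Taft.E d ζ)) (TaftDual.shiftL d ζ (.op (Kinv d ζ)) g)) +
      inDual d ζ (TaftDual.shiftL d ζ (.op (Kinv d ζ)) g) * E d ζ +
      inDual d ζ (TaftDual.shiftR d ζ (Taft.E d ζ) (TaftDual.shiftL d ζ (.op (Kinv d ζ)) g)) *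
        K d ζ := by
  change inB d ζ (Taft.E d ζ) * ofSpace d ζ (DoubleSpace.mk d ζ g 1) = -ofSpace d ζ (DoubleSpace.mk d ζ _ 1) +
    _ * inB d ζ (Taft.E d ζ) + _ * inB d ζ (Taft.K d ζ)
  rw [inB_mul, DoubleSpace.leftB_E, inDual_mul_inB, inDual_mul_inB, mul_one, mul_one, map_add,
    map_add, map_neg]
  rfl

theorem shift_Kst : TaftDual.shiftL d ζ (.op (Kinv d ζ)) (TaftDual.Kst d ζ : TaftDual d ζ) =
    ζ⁻¹ • (TaftDual.Kst d ζ : TaftDual d ζ) := by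
  refine WithConv.ext (LinearMap.ext fun t => ?_)
  change TaftDual.charK d ζ (Kinv d ζ * t) = ζ⁻¹ * TaftDual.charK d ζ t
  rw [map_mul, TaftDual.charK_Kinv]

theorem shiftR_K_Kst : TaftDual.shiftR d ζ (Taft.K d ζ) (TaftDual.Kst d ζ : TaftDual d ζ) =
    ζ • (TaftDual.Kst d ζ : TaftDual d ζ) := by
  refine WithConv.ext (LinearMap.ext fun t => ?_)
  change TaftDual.charK d ζ (t * Taft.K d ζ) = ζ * TaftDual.charK d ζ t
  rw [map_mul, mul_comm, TaftDual.charK, lift_K]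

theorem shiftR_E_Kst : TaftDual.shiftR d ζ (Taft.E d ζ) (TaftDual.Kst d ζ : TaftDual d ζ) = 0 := by
  refine WithConv.ext (LinearMap.ext fun t => ?_)
  change TaftDual.charK d ζ (t * Taft.E d ζ) = 0
  rw [map_mul, TaftDual.charK, lift_E, mul_zero]

theorem shiftL_E_Kst : TaftDual.shiftL d ζ (.op (Taft.E d ζ)) (TaftDual.Kst d ζ : TaftDual d ζ) = 0 := by
  refine WithConv.ext (LinearMap.ext fun t => ?_)
  change TaftDual.charK d ζ (Taft.E d ζ * t) = 0
  rw [map_mul, TaftDual.charK, lift_E, zero_mul]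

theorem rep2_K : TaftDual.rep2 d ζ (Taft.K d ζ) = !![ζ, 0; 0, 1] := lift_K ..

theorem rep2_E : TaftDual.rep2 d ζ (Taft.E d ζ) = !![0, 1; 0, 0] := lift_E ..

theorem rep2_Kinv : TaftDual.rep2 d ζ (Kinv d ζ) = !![ζ⁻¹, 0; 0, 1] := by
  have h : TaftDual.rep2 d ζ (Kinv d ζ) * !![ζ, 0; 0, 1] = 1 := by
    rw [← rep2_K (d := d), ← map_mul, Kinv_mul_K, map_one]
  have h' : !![ζ, 0; 0, 1] * !![ζ⁻¹, 0; 0, (1 : ℂ)] = 1 := by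
    simp [Matrix.one_fin_two, zeta_ne_zero d ζ]
  exact left_inv_eq_right_inv h h'

/-- The diagonal entries identify the translates of `E^*` by `E`: multiplying by the matrix of `E`
on either side moves a diagonal entry to position `(0, 1)`. -/
theorem rep2_triangular (t : Taft d ζ) :
    TaftDual.rep2 d ζ t 0 0 = TaftDual.charK d ζ t ∧ TaftDual.rep2 d ζ t 1 0 = 0 ∧
      TaftDual.rep2 d ζ t 1 1 = counitHom d ζ t := by
  induction t using Taft.induction with
  | hc c => simp [Matrix.algebraMap_matrix_apply]
  | hK => simp [rep2_K, TaftDual.charK, lift_K]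
  | hE => simp [rep2_E, TaftDual.charK, lift_E]
  | hadd a b ha hb => simp [ha, hb]
  | hmul a b ha hb => simp [Matrix.mul_apply, Fin.sum_univ_two, ha, hb]

theorem shiftL_Kinv_Est : TaftDual.shiftL d ζ (.op (Kinv d ζ)) (TaftDual.Est d ζ) =
    ζ⁻¹ • TaftDual.Est d ζ := by
  refine WithConv.ext (LinearMap.ext fun t => ?_)
  change TaftDual.rep2 d ζ (Kinv d ζ * t) 0 1 = ζ⁻¹ * TaftDual.rep2 d ζ t 0 1
  rw [map_mul, rep2_Kinv]
  simp [Matrix.mul_apply, Fin.sum_univ_two]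

theorem shiftR_K_Est : TaftDual.shiftR d ζ (Taft.K d ζ) (TaftDual.Est d ζ) = TaftDual.Est d ζ := by
  refine WithConv.ext (LinearMap.ext fun t => ?_)
  change TaftDual.rep2 d ζ (t * Taft.K d ζ) 0 1 = TaftDual.rep2 d ζ t 0 1
  rw [map_mul, rep2_K]
  simp [Matrix.mul_apply, Fin.sum_univ_two]

theorem shiftL_E_Est : TaftDual.shiftL d ζ (.op (Taft.E d ζ)) (TaftDual.Est d ζ) = 1 := by
  refine WithConv.ext (LinearMap.ext fun t => ?_)
  change TaftDual.rep2 d ζ (Taft.E d ζ * t) 0 1 = counitHom d ζ t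
  rw [map_mul, rep2_E, ← (rep2_triangular t).2.2]
  simp [Matrix.mul_apply, Fin.sum_univ_two]

theorem shiftR_E_Est :
    TaftDual.shiftR d ζ (Taft.E d ζ) (TaftDual.Est d ζ) = (TaftDual.Kst d ζ : TaftDual d ζ) := by
  refine WithConv.ext (LinearMap.ext fun t => ?_)
  change TaftDual.rep2 d ζ (t * Taft.E d ζ) 0 1 = TaftDual.charK d ζ t
  rw [map_mul, rep2_E, ← (rep2_triangular t).1]
  simp [Matrix.mul_apply, Fin.sum_univ_two]

theorem K_mul_Kst : (K d ζ : Double d ζ) * Kst d ζ = Kst d ζ * K d ζ := by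
  change (K d ζ : Double d ζ) * inDual d ζ (TaftDual.Kst d ζ) = inDual d ζ (TaftDual.Kst d ζ) * _
  rw [K_mul_inDual, shift_Kst, map_smul, shiftR_K_Kst, smul_smul,
    inv_mul_cancel₀ (zeta_ne_zero d ζ), one_smul]

theorem K_mul_Est : (K d ζ : Double d ζ) * Est d ζ = ζ⁻¹ • (Est d ζ * K d ζ) := by
  rw [Est, K_mul_inDual, shiftL_Kinv_Est, map_smul, shiftR_K_Est, map_smul, smul_mul_assoc]

theorem E_mul_Kst : E d ζ * Kst d ζ = ζ⁻¹ • (Kst d ζ * E d ζ) := by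
  change E d ζ * inDual d ζ (TaftDual.Kst d ζ) = ζ⁻¹ • (inDual d ζ (TaftDual.Kst d ζ) * _)
  rw [E_mul_inDual, shift_Kst, map_smul, map_smul, map_smul (TaftDual.shiftR d ζ _), shiftL_E_Kst,
    shiftR_E_Kst, smul_zero, map_zero, smul_zero,
    neg_zero, zero_add, zero_mul, add_zero, map_smul, smul_mul_assoc]

theorem E_mul_Est :
    E d ζ * Est d ζ = ζ⁻¹ • (Est d ζ * E d ζ + Kst d ζ * K d ζ - 1) := by
  change _ = ζ⁻¹ • (_ + inDual d ζ (TaftDual.Kst d ζ) * _ - 1)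
  rw [Est, E_mul_inDual, shiftL_Kinv_Est, map_smul, map_smul, map_smul (TaftDual.shiftR d ζ _),
    shiftL_E_Est, shiftR_E_Est, map_smul, map_smul, map_one, smul_mul_assoc, smul_mul_assoc, smul_sub, smul_add]
  abel

theorem Est_mul_Kst_inv :
    Est d ζ * (↑(Kst d ζ)⁻¹ : Double d ζ) = ζ⁻¹ • (↑(Kst d ζ)⁻¹ * Est d ζ) := by
  change inDual d ζ (TaftDual.Est d ζ) * inDual d ζ ↑(TaftDual.Kst d ζ)⁻¹ =
    ζ⁻¹ • (inDual d ζ ↑(TaftDual.Kst d ζ)⁻¹ * inDual d ζ (TaftDual.Est d ζ))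
  rw [← map_mul, TaftDual.Est_mul_Kst_inv, map_smul, map_mul]

theorem Kst_mul_Est : (Kst d ζ : Double d ζ) * Est d ζ = ζ⁻¹ • (Est d ζ * Kst d ζ) := by
  have h := qcomm_inv (c := ζ) (x := (↑(Kst d ζ)⁻¹ : Double d ζ)) (y := Est d ζ)
    (zeta_ne_zero d ζ)
    (by rw [Est_mul_Kst_inv, smul_smul, mul_inv_cancel₀ (zeta_ne_zero d ζ), one_smul])
    (Units.inv_mul _) (Units.mul_inv _)
  exact h

theorem Kst_dual_pow : (TaftDual.Kst d ζ : TaftDual d ζ) ^ d = 1 := by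
  have h : ∀ n, ((TaftDual.Kst d ζ : TaftDual d ζ) ^ n) = TaftDual.ofHom (lift (ζ ^ n) 0
      (by rw [← pow_mul, mul_comm, pow_mul, (prim d ζ).pow_eq_one, one_pow])
      (zero_pow (d_ne_zero d)) (by simp)) := by
    intro n
    induction n with
    | zero =>
      rw [pow_zero, TaftDual.one_eq]
      refine congrArg _ ?_
      exact hom_ext (by simp [lift_K]) (by simp [lift_E])
    | succ n ih =>
      rw [pow_succ, ih]
      change _ * TaftDual.ofHom (TaftDual.charK d ζ) = _
      rw [TaftDual.ofHom_mul]
      congr 1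
      exact hom_ext (by simp [lift_K, TaftDual.charK, pow_succ])
        (by simp [lift_K, lift_E, TaftDual.charK])
  rw [h, TaftDual.one_eq]
  congr 1
  exact hom_ext (by simp [lift_K, (prim d ζ).pow_eq_one]) (by simp [lift_E])

theorem Kst_pow : (Kst d ζ : Double d ζ) ^ d = 1 := by
  change inDual d ζ (TaftDual.Kst d ζ) ^ d = 1
  rw [← map_pow, Kst_dual_pow, map_one]

theorem K_pow : (K d ζ : Double d ζ) ^ d = 1 := by
  change inB d ζ (Taft.K d ζ) ^ d = 1
  rw [← map_pow, Taft.K_pow, map_one]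

theorem Est_pow : Est d ζ ^ d = 0 := by rw [Est, ← map_pow, TaftDual.Est_pow, map_zero]

/-- The mixed relations come from the product of the double, through the translates of `K^*` and
`E^*` computed above. The factor `ζ` in `F` is what makes the commutator of `E` and `F` equal to `K
- (K^*)⁻¹` without a scalar. -/
theorem relations : DoubleRelations d ζ (K d ζ : Double d ζ) ↑(K d ζ)⁻¹ (Kst d ζ : Double d ζ)
    ↑(Kst d ζ)⁻¹ (E d ζ) (F d ζ) := by
  have hz := zeta_ne_zero d ζ
  have hKHi : (K d ζ : Double d ζ) * (↑(Kst d ζ)⁻¹ : Double d ζ) = ↑(Kst d ζ)⁻¹ * K d ζ :=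
    (Commute.units_inv_right (show Commute (K d ζ : Double d ζ) (Kst d ζ) from K_mul_Kst)).eq
  exact
  { K_mul_Ki := Units.mul_inv _
    Ki_mul_K := Units.inv_mul _
    H_mul_Hi := Units.mul_inv _
    Hi_mul_H := Units.inv_mul _
    K_pow := K_pow
    H_pow := Kst_pow
    F_pow := by
      rw [F, smul_pow, mul_pow_eq_zero (Est d ζ) _ ζ _ d Est_pow, smul_zero]
      rw [Est_mul_Kst_inv, smul_smul, mul_inv_cancel₀ hz, one_smul]
    comm := K_mul_Kst
    K_mul_E := by
      change inB d ζ (Taft.K d ζ) * inB d ζ (Taft.E d ζ) =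
        ζ • (inB d ζ (Taft.E d ζ) * inB d ζ (Taft.K d ζ))
      rw [← map_mul, Taft.K_mul_E, map_smul, map_mul]
    K_mul_F := by
      rw [F, mul_smul_comm, ← mul_assoc, K_mul_Est, smul_mul_assoc, mul_assoc, hKHi,
        smul_mul_assoc, mul_assoc, smul_comm]
    H_mul_E := by rw [E_mul_Kst, smul_smul, mul_inv_cancel₀ hz, one_smul]
    H_mul_F := by
      rw [F, mul_smul_comm, ← mul_assoc, Kst_mul_Est, smul_mul_assoc, mul_assoc, Units.mul_inv,
        smul_mul_assoc, mul_assoc, Units.inv_mul, smul_comm]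
    E_mul_F := by
      have h : E d ζ * (↑(Kst d ζ)⁻¹ : Double d ζ) = ζ • (↑(Kst d ζ)⁻¹ * E d ζ) := by
        have h1 : (Kst d ζ : Double d ζ) * E d ζ = ζ • (E d ζ * Kst d ζ) := by
          rw [E_mul_Kst, smul_smul, mul_inv_cancel₀ hz, one_smul]
        rw [qcomm_inv hz h1 (Units.mul_inv _) (Units.inv_mul _), smul_smul, mul_inv_cancel₀ hz,
          one_smul]
      rw [F, mul_smul_comm, ← mul_assoc, E_mul_Est, smul_mul_assoc, smul_smul, mul_inv_cancel₀ hz,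
        one_smul, sub_mul, add_mul, one_mul, mul_assoc, h, mul_smul_comm, ← mul_assoc,
        smul_mul_assoc, mul_assoc (Kst d ζ : Double d ζ), hKHi, Units.mul_inv_cancel_left] }

theorem antipode_inDual (f : TaftDual d ζ) :
    antipode d ζ (inDual d ζ f) = inDual d ζ (TaftDual.antipodeCop d ζ f) := by
  change inB d ζ (S d ζ 1) * inDual d ζ (TaftDual.antipodeCop d ζ f) = _
  rw [S_one, map_one, one_mul]

/-- Since the antipode reverses products and inverts `K^*`, the sum over `k` becomes a spectral
projection of `(K^*)⁻¹` standing on the left. It sends `E^*` to `-ζ⁻¹ F`, which explains the form of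
`uCoeff`. -/
theorem antipode_β (i j : ℕ) : antipode d ζ (β d ζ i j) = DoubleRelations.uCoeff ζ i •
    (DoubleRelations.proj d ζ (↑(Kst d ζ)⁻¹ : Double d ζ) (i + j) * F d ζ ^ i) := by
  have hz := zeta_ne_zero d ζ
  have h1 : β d ζ i j = inDual d ζ (((d : ℂ) * qFact ζ i)⁻¹ • (TaftDual.Est d ζ ^ i *
      ∑ k ∈ Finset.range d, (ζ ^ (k * (i + j)))⁻¹ • (TaftDual.Kst d ζ : TaftDual d ζ) ^ k)) := by
    simp only [map_smul, map_mul, map_sum, map_pow]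
    rfl
  have h2 : inDual d ζ ((-1 : ℂ) • (TaftDual.Est d ζ * ↑(TaftDual.Kst d ζ)⁻¹)) = (-ζ⁻¹) • F d ζ := by
    rw [F, smul_smul, map_smul, map_mul, neg_mul, inv_mul_cancel₀ hz]
    rfl
  rw [h1, antipode_inDual, map_smul, TaftDual.antipodeCop_mul, TaftDual.antipodeCop_pow,
    TaftDual.antipodeCop_Est, map_sum, map_smul, map_mul, map_pow, h2, smul_pow, map_sum,
    mul_smul_comm, smul_smul, DoubleRelations.proj, smul_mul_assoc, smul_smul,
    DoubleRelations.uCoeff]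
  have hk : ∀ k, inDual d ζ (TaftDual.antipodeCop d ζ
      ((ζ ^ (k * (i + j)))⁻¹ • (TaftDual.Kst d ζ : TaftDual d ζ) ^ k)) =
      ζ⁻¹ ^ (k * (i + j)) • (↑(Kst d ζ)⁻¹ : Double d ζ) ^ k := by
    intro k
    rw [map_smul, TaftDual.antipodeCop_pow, TaftDual.antipodeCop_Kst, map_smul, map_pow, inv_pow]
    rfl
  simp only [hk]
  congr 1
  rw [mul_inv]
  ring

theorem u_eq : u d ζ = DoubleRelations.unip d ζ (↑(K d ζ)⁻¹ : Double d ζ) (E d ζ) (F d ζ) *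
    DoubleRelations.torus d ζ (K d ζ : Double d ζ) ↑(Kst d ζ)⁻¹ := by
  rw [← relations.sum_eq_unip_mul_torus, u]
  simp only [antipode_β]

theorem θ₁_eq : θ₁ d ζ = ↑(Kst d ζ)⁻¹ *
    (DoubleRelations.unip d ζ (↑(K d ζ)⁻¹ : Double d ζ) (E d ζ) (F d ζ) *
      DoubleRelations.torus d ζ (K d ζ : Double d ζ) ↑(Kst d ζ)⁻¹) := by
  rw [θ₁, θ, z, Units.val_mul, mul_assoc, Units.mul_inv_cancel_left, u_eq]

theorem θ₁_mul_F : θ₁ d ζ * F d ζ = F d ζ * θ₁ d ζ := by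
  rw [θ₁_eq]
  exact relations.twist_mul_F

instance : FiniteDimensional ℂ (TaftDual d ζ) :=
  Module.Finite.equiv (WithConv.linearEquiv ℂ (Taft d ζ →ₗ[ℂ] ℂ)).symm

instance : FiniteDimensional ℂ (Double d ζ) :=
  Module.Finite.equiv (ofSpace d ζ)

/-- Without this, `Ring.inverse` in the definition of `𝕋⁺` could take its default value `0`. -/
theorem isUnit_θ₁ : IsUnit (θ₁ d ζ) := by
  rw [θ₁_eq]
  exact relations.isUnit_twist

theorem pivot_eq : pivot d ζ = Kst d ζ := by
  have h : K d ζ * Kst d ζ = Kst d ζ * K d ζ := Units.ext K_mul_Kst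
  rw [pivot, z, mul_inv_rev, inv_inv, mul_assoc, ← h, inv_mul_cancel_left]

/-- Multiplicativity of `f` says that `x ⊗ y ↦ f (x y)` is the form `f ⊗ f`, so a character of `B`
is group-like. The tensor is symmetric, so passing to the co-opposite coproduct changes nothing. -/
theorem comul_inDual_ofHom (f : Taft d ζ →ₐ[ℂ] ℂ) :
    comul d ζ (inDual d ζ (TaftDual.ofHom f)) =
      inDual d ζ (TaftDual.ofHom f) ⊗ₜ inDual d ζ (TaftDual.ofHom f) := by
  have h : TaftDual.comul d ζ (TaftDual.ofHom f) = TaftDual.ofHom f ⊗ₜ TaftDual.ofHom f := by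
    have h1 : (TensorProduct.dualDistribEquiv ℂ (Taft d ζ) (Taft d ζ)).symm
        ((LinearMap.mul' ℂ (Taft d ζ)).dualMap f.toLinearMap) = f.toLinearMap ⊗ₜ f.toLinearMap := by
      rw [LinearEquiv.symm_apply_eq]
      ext x y
      change f (x * y) = f x * f y
      exact map_mul f x y
    change TensorProduct.map _ _ ((TensorProduct.dualDistribEquiv ℂ (Taft d ζ) (Taft d ζ)).symm
        ((LinearMap.mul' ℂ (Taft d ζ)).dualMap f.toLinearMap)) = _
    rw [h1]
    rfl
  change TensorProduct.map (ofSpace d ζ).toLinearMap (ofSpace d ζ).toLinearMap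
    (TensorProduct.tensorTensorTensorComm ℂ _ _ _ _ (TensorProduct.map _ _
      (TaftDual.ofHom f ⊗ₜ (1 : Taft d ζ)))) = _
  rw [TensorProduct.map_tmul, LinearMap.comp_apply, h, Bialgebra.comul_one]
  rfl

end Double

/-! ### The action of the double on the simple modules -/

namespace SimpleModule

/-- The basis vector of index `a`, understood to be `0` if `a` is out of range. -/
def vec (l a : ℕ) : Fin l → ℂ := fun i => if (i : ℕ) = a then 1 else 0

theorem vec_of_le {l a : ℕ} (h : l ≤ a) : vec l a = 0 := by
  funext i
  rw [vec, if_neg (by omega), Pi.zero_apply]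

theorem mulVec_vec {l a : ℕ} (h : a < l) (X : Matrix (Fin l) (Fin l) ℂ) :
    X.mulVec (vec l a) = fun i => X i ⟨a, h⟩ := by
  funext i
  rw [Matrix.mulVec, dotProduct, Finset.sum_eq_single ⟨a, h⟩]
  · simp [vec]
  · intro b _ hb
    rw [vec, if_neg (fun h' => hb (Fin.ext h')), mul_zero]
  · simp

variable (d ζ) in
/-- The module `M_{l,p}` as a morphism to the endomorphisms of `ℂ ^ l`. -/
noncomputable def act (l p : ℕ) (hl : l ≤ d) : Double d ζ →ₐ[ℂ] Module.End ℂ (Fin l → ℂ) :=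
  (Matrix.toLinAlgEquiv' : Matrix (Fin l) (Fin l) ℂ ≃ₐ[ℂ] _).toAlgHom.comp (repMatrix d ζ l p hl)

variable {l p : ℕ} {hl : l ≤ d}

theorem act_apply (x : Double d ζ) (v : Fin l → ℂ) :
    act d ζ l p hl x v = (repMatrix d ζ l p hl x).mulVec v := rfl

theorem act_K (a : ℕ) : act d ζ l p hl (Double.K d ζ) (vec l a) =
    ζ ^ ((p : ℤ) + l - 1 - a) • vec l a := by
  rcases Nat.lt_or_ge a l with h | h
  · rw [act_apply, repMatrix_K, mulVec_vec h]
    funext i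
    rw [matK, Pi.smul_apply, vec, Matrix.smul_apply, Matrix.diagonal_apply]
    by_cases hi : (i : ℕ) = a
    · rw [if_pos (Fin.ext hi), if_pos hi, hi, smul_eq_mul, smul_eq_mul, mul_one, ← pow_add,
        ← zpow_natCast]
      congr 1
      omega
    · rw [if_neg (fun h' => hi (congrArg Fin.val h')), if_neg hi, smul_zero, smul_zero]
  · rw [vec_of_le h, map_zero, smul_zero]

/-- The truncated `a - 1` is harmless at `a = 0`, where the coefficient vanishes. At `a = l` the
coefficient vanishes as well, so the formula needs no bound on `a`. -/
theorem act_E (a : ℕ) : act d ζ l p hl (Double.E d ζ) (vec l a) =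
    eCoeff ζ l p a • vec l (a - 1) := by
  rcases Nat.lt_or_ge a l with h | h
  · rw [act_apply, repMatrix_E, mulVec_vec h]
    funext i
    rw [matE_apply, Pi.smul_apply, vec]
    by_cases h0 : a = 0
    · rw [if_neg (by simp only; omega), h0, eCoeff_zero, zero_smul]
    · by_cases hi : (i : ℕ) + 1 = a
      · rw [if_pos hi, if_pos (by omega), hi, smul_eq_mul, mul_one]
      · rw [if_neg hi, if_neg (by omega), smul_zero]
  · rw [vec_of_le h, map_zero]
    rcases Nat.eq_or_lt_of_le h with h | h
    · rw [← h, eCoeff_self, zero_smul]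
    · rw [vec_of_le (by omega), smul_zero]

theorem act_F (a : ℕ) : act d ζ l p hl (Double.F d ζ) (vec l a) = vec l (a + 1) := by
  rcases Nat.lt_or_ge a l with h | h
  · rw [act_apply, repMatrix_F, mulVec_vec h]
    funext i
    rw [matF, Matrix.of_apply, vec]
    simp only [eq_comm]
  · rw [vec_of_le h, vec_of_le (by omega), map_zero]

theorem act_Kst_inv (a : ℕ) : act d ζ l p hl (↑(Double.Kst d ζ)⁻¹ : Double d ζ) (vec l a) =
    ζ ^ ((p : ℤ) + a) • vec l a := by
  rcases Nat.lt_or_ge a l with h | h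
  · rw [act_apply, repMatrix_Kst_inv, mulVec_vec h]
    funext i
    rw [Pi.smul_apply, vec, Matrix.diagonal_apply]
    by_cases hi : (i : ℕ) = a
    · rw [if_pos (Fin.ext hi), if_pos hi, hi, smul_eq_mul, mul_one, ← zpow_natCast]
      push_cast
      rfl
    · rw [if_neg (fun h' => hi (congrArg Fin.val h')), if_neg hi, smul_zero]
  · rw [vec_of_le h, map_zero, smul_zero]

theorem act_Kst (a : ℕ) : act d ζ l p hl (Double.Kst d ζ : Double d ζ) (vec l a) =
    ζ ^ (-((p : ℤ) + a)) • vec l a := by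
  have hz := zeta_ne_zero d ζ
  have h := congrArg (act d ζ l p hl (Double.Kst d ζ : Double d ζ))
    (act_Kst_inv (d := d) (ζ := ζ) (l := l) (p := p) (hl := hl) a)
  rw [← Module.End.mul_apply, ← map_mul, Units.mul_inv, map_one, Module.End.one_apply,
    map_smul] at h
  conv_rhs => rw [h]
  rw [smul_smul, zpow_neg, inv_mul_cancel₀ (zpow_ne_zero _ hz), one_smul]

theorem act_Est (a : ℕ) : act d ζ l p hl (Double.Est d ζ) (vec l a) =
    ζ⁻¹ ^ (p + a + 1) • vec l (a + 1) := by
  have hz := zeta_ne_zero d ζ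
  have h : Double.Est d ζ = ζ⁻¹ • (Double.F d ζ * (Double.Kst d ζ : Double d ζ)) := by
    rw [Double.F, smul_mul_assoc, mul_assoc, Units.inv_mul, mul_one, smul_smul,
      inv_mul_cancel₀ hz, one_smul]
  rw [h, map_smul, map_mul, LinearMap.smul_apply, Module.End.mul_apply, act_Kst, map_smul, act_F,
    smul_smul, zpow_neg, ← Nat.cast_add, zpow_natCast, ← inv_pow, ← pow_succ']

theorem act_Est_pow (i a : ℕ) : act d ζ l p hl (Double.Est d ζ ^ i) (vec l a) =
    ζ⁻¹ ^ (i * (p + a) + tri i) • vec l (a + i) := by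
  induction i with
  | zero => simp [tri_zero]
  | succ i ih =>
    rw [pow_succ', map_mul, Module.End.mul_apply, ih, map_smul, act_Est, smul_smul, ← pow_add,
      tri_succ, add_assoc a i 1]
    congr 2
    ring

/-- The product `ε_a ε_{a-1} ⋯ ε_{a-i+1}` of the coefficients of `E`. -/
noncomputable def eProd (ζ : ℂ) (l p i a : ℕ) : ℂ := ∏ t ∈ Finset.range i, eCoeff ζ l p (a - t)

theorem eProd_of_lt {i a : ℕ} (h : a < i) : eProd ζ l p i a = 0 :=
  Finset.prod_eq_zero (Finset.mem_range.2 h) (by rw [Nat.sub_self, eCoeff_zero])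

theorem eProd_succ (i a : ℕ) : eProd ζ l p (i + 1) a = eProd ζ l p i a * eCoeff ζ l p (a - i) :=
  Finset.prod_range_succ _ _

theorem eProd_succ_succ (i a : ℕ) :
    eProd ζ l p (i + 1) (a + 1) = eProd ζ l p i a * eCoeff ζ l p (a + 1) := by
  rw [eProd, Finset.prod_range_succ']
  congr 1
  exact Finset.prod_congr rfl fun t _ => by rw [Nat.add_sub_add_right]

theorem act_E_pow (i a : ℕ) : act d ζ l p hl (Double.E d ζ ^ i) (vec l a) =
    eProd ζ l p i a • vec l (a - i) := by
  induction i with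
  | zero => simp [eProd]
  | succ i ih =>
    rw [pow_succ', map_mul, Module.End.mul_apply, ih, map_smul, act_E, smul_smul, eProd_succ,
      Nat.sub_sub]

theorem act_K_pow (j a : ℕ) : act d ζ l p hl ((Double.K d ζ : Double d ζ) ^ j) (vec l a) =
    ζ ^ (((p : ℤ) + l - 1 - a) * j) • vec l a := by
  induction j with
  | zero => simp
  | succ j ih =>
    rw [pow_succ', map_mul, Module.End.mul_apply, ih, map_smul, act_K, smul_smul,
      ← zpow_add₀ (zeta_ne_zero d ζ)]
    congr 2
    push_cast
    ring

theorem act_Kst_pow (k a : ℕ) : act d ζ l p hl ((Double.Kst d ζ : Double d ζ) ^ k) (vec l a) =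
    ζ ^ (-((p : ℤ) + a) * k) • vec l a := by
  induction k with
  | zero => simp
  | succ j ih =>
    rw [pow_succ', map_mul, Module.End.mul_apply, ih, map_smul, act_Kst, smul_smul,
      ← zpow_add₀ (zeta_ne_zero d ζ)]
    congr 2
    push_cast
    ring

variable (d ζ) in
/-- The discrete Dirac function `m ↦ δ_{m,0}` on `ℤ/dℤ`. -/
noncomputable def dirac (m : ℤ) : ℂ := (d : ℂ)⁻¹ * ∑ k ∈ Finset.range d, ζ ^ (m * k)

/-- The sum over powers of `K^*` tests the weight of the vector, which gives the Dirac factor. Then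
`E^*` raises the index `i` times, and the accumulated scalar divided by `(i)!_ζ` is `cCoeff`. -/
theorem act_β (i j a : ℕ) : act d ζ l p hl (Double.β d ζ i j) (vec l a) =
    (cCoeff ζ i (p + a) * dirac d ζ (-((p : ℤ) + a + i + j))) • vec l (a + i) := by
  have hz := zeta_ne_zero d ζ
  have h : act d ζ l p hl (∑ k ∈ Finset.range d, (ζ ^ (k * (i + j)))⁻¹ •
      (Double.Kst d ζ : Double d ζ) ^ k) (vec l a) =
      (∑ k ∈ Finset.range d, ζ ^ (-((p : ℤ) + a + i + j) * k)) • vec l a := by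
    rw [map_sum, LinearMap.sum_apply, Finset.sum_smul]
    refine Finset.sum_congr rfl fun k _ => ?_
    rw [map_smul, LinearMap.smul_apply, act_Kst_pow, smul_smul, ← zpow_natCast, ← zpow_neg,
      ← zpow_add₀ hz]
    congr 2
    push_cast
    ring
  rw [Double.β, map_smul, map_mul, LinearMap.smul_apply, Module.End.mul_apply, h, map_smul,
    act_Est_pow, smul_smul, smul_smul, cCoeff, dirac, mul_inv]
  congr 1
  ring

/-- Only `j ≡ -m` modulo `d` contributes, so the torus parts of `R` and `u` act on weight vectors by
one power of `ζ`. The proof exchanges the sums instead, and the surviving index is then the residue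
of `s`. -/
theorem sum_dirac (s m : ℤ) :
    ∑ j ∈ Finset.range d, dirac d ζ (-(m + j)) * ζ ^ (s * j) = ζ ^ (-(m * s)) := by
  have hz := zeta_ne_zero d ζ
  have hd : (d : ℂ) ≠ 0 := Nat.cast_ne_zero.2 (d_ne_zero d)
  have hd0 : (0 : ℤ) < d := by have := d_ne_zero d; omega
  simp only [dirac, mul_assoc, ← Finset.mul_sum]
  simp only [Finset.sum_mul]
  rw [Finset.sum_comm]
  have h : ∀ k : ℕ, ∑ j ∈ Finset.range d, ζ ^ (-(m + j) * k) * ζ ^ (s * j) =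
      ζ ^ (-(m * k)) * if (d : ℤ) ∣ s - k then (d : ℂ) else 0 := by
    intro k
    rw [← sum_zpow_mul (d := d) (ζ := ζ) (s - k), Finset.mul_sum]
    refine Finset.sum_congr rfl fun j _ => ?_
    rw [← zpow_add₀ hz, ← zpow_add₀ hz]
    congr 1
    ring
  simp only [h]
  have hmod0 := Int.emod_nonneg s hd0.ne'
  have hmod1 := Int.emod_lt_of_pos s hd0
  rw [Finset.sum_eq_single (s % d).toNat]
  · have hk : (((s % d).toNat : ℕ) : ℤ) = s % d := Int.toNat_of_nonneg hmod0
    rw [hk, if_pos (Int.dvd_self_sub_emod), mul_comm _ (d : ℂ), ← mul_assoc, inv_mul_cancel₀ hd,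
      one_mul]
    nth_rw 2 [← Int.mul_ediv_add_emod s d]
    rw [show -(m * ((d : ℤ) * (s / d) + s % d)) = (d : ℤ) * (-(m * (s / d))) + -(m * (s % d)) by ring,
      zpow_add₀ hz, zpow_mul, zpow_natCast, (prim d ζ).pow_eq_one, one_zpow, one_mul]
  · intro k hk hne
    have := Finset.mem_range.1 hk
    rw [if_neg, mul_zero]
    intro hdvd
    apply hne
    have h1 : s % d = (k : ℤ) % d := (Int.modEq_iff_dvd.2 hdvd).symm
    rw [h1, Int.emod_eq_of_lt (by omega) (by omega), Int.toNat_natCast]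
  · intro hn
    exact absurd (Finset.mem_range.2 (by omega)) hn

end SimpleModule

/-! ### The double braiding of two simple modules -/

namespace SimpleModule

variable {l p : ℕ} {hl : l ≤ d} {l' p' : ℕ} {hl' : l' ≤ d}

theorem tensorAction_tmul {V W : Type*} [AddCommGroup V] [Module ℂ V] [AddCommGroup W] [Module ℂ W]
    (ρ : Double d ζ →ₐ[ℂ] Module.End ℂ V) (σ : Double d ζ →ₐ[ℂ] Module.End ℂ W)
    (x y : Double d ζ) : tensorAction ρ σ (x ⊗ₜ y) = TensorProduct.map (ρ x) (σ y) := rfl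

variable (d ζ) in
/-- The action of `R` on the tensor product of two simple modules. -/
noncomputable def RAct (l p : ℕ) (hl : l ≤ d) (l' p' : ℕ) (hl' : l' ≤ d) :
    Module.End ℂ ((Fin l → ℂ) ⊗[ℂ] (Fin l' → ℂ)) :=
  tensorAction (act d ζ l p hl) (act d ζ l' p' hl') (Double.R d ζ)

/-- Moving the flip to the other side replaces `τ(R)` by `R`, so the double braiding alternates `R`
and flips, as in `doubleR`. -/
theorem braiding_eq {V W : Type*} [AddCommGroup V] [Module ℂ V] [AddCommGroup W] [Module ℂ W]
    (ρ : Double d ζ →ₐ[ℂ] Module.End ℂ V) (σ : Double d ζ →ₐ[ℂ] Module.End ℂ W) :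
    braiding ρ σ = (TensorProduct.comm ℂ V W).toLinearMap ∘ₗ
      tensorAction ρ σ (Double.R d ζ) := by
  rw [braiding]
  induction Double.R d ζ with
  | zero => simp
  | add x y hx hy => simp only [map_add, LinearMap.add_comp, LinearMap.comp_add, hx, hy]
  | tmul x y => exact TensorProduct.ext' fun v w => rfl

/-- The coefficient of the action of `R` on `M_{l,p} ⊗ M_{l',p'}`. -/
noncomputable def rCoeff (ζ : ℂ) (l p p' i a b : ℕ) : ℂ :=
  eProd ζ l p i a * cCoeff ζ i (p' + b) * ζ ^ (-(((p' : ℤ) + b + i) * ((p : ℤ) + l - 1 - a)))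

theorem RAct_vec (a b : ℕ) : RAct d ζ l p hl l' p' hl' (vec l a ⊗ₜ vec l' b) =
    ∑ i ∈ Finset.range d, rCoeff ζ l p p' i a b • (vec l (a - i) ⊗ₜ[ℂ] vec l' (b + i)) := by
  rw [RAct, Double.R, map_sum, LinearMap.sum_apply]
  refine Finset.sum_congr rfl fun i _ => ?_
  rw [map_sum, LinearMap.sum_apply]
  have h : ∀ j : ℕ, tensorAction (act d ζ l p hl) (act d ζ l' p' hl')
      ((Double.E d ζ ^ i * (Double.K d ζ : Double d ζ) ^ j) ⊗ₜ Double.β d ζ i j)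
        (vec l a ⊗ₜ vec l' b) =
      (eProd ζ l p i a * cCoeff ζ i (p' + b) *
        (dirac d ζ (-((p' : ℤ) + b + i + j)) * ζ ^ (((p : ℤ) + l - 1 - a) * j))) •
          (vec l (a - i) ⊗ₜ[ℂ] vec l' (b + i)) := by
    intro j
    rw [tensorAction_tmul, TensorProduct.map_tmul, map_mul, Module.End.mul_apply, act_K_pow,
      map_smul, act_E_pow, act_β, smul_smul, TensorProduct.smul_tmul_smul]
    congr 1
    ring
  simp only [h]
  rw [← Finset.sum_smul, ← Finset.mul_sum, sum_dirac, rCoeff]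

/-- The identity expressing that `R` intertwines the coproduct of `F` and its opposite. -/
theorem rCoeff_identity (i a b : ℕ) (ha : a < l) (hi : i + 1 < d) :
    rCoeff ζ l p p' (i + 1) (a + 1) b + ζ ^ ((p : ℤ) + a) * rCoeff ζ l p p' i a (b + 1) =
      rCoeff ζ l p p' i a b + rCoeff ζ l p p' (i + 1) a b * ζ ^ ((p' : ℤ) + b + i + 1) := by
  have hz := zeta_ne_zero d ζ
  rcases Nat.lt_or_ge a i with h | h
  · simp only [rCoeff, eProd_of_lt h, eProd_of_lt (show a < i + 1 by omega),
      eProd_of_lt (show a + 1 < i + 1 by omega)]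
    ring
  obtain ⟨n, rfl⟩ := Nat.exists_eq_add_of_le h
  obtain ⟨m, rfl⟩ : ∃ m, l = i + n + 1 + m := ⟨l - (i + n + 1), by omega⟩
  have hq := qInt_ne_zero (prim d ζ) (i + 1) (by omega) hi
  have hc : cCoeff ζ (i + 1) (p' + b) =
      cCoeff ζ i (p' + b) * ζ ^ (-((p' : ℤ) + b + i + 1)) * (qInt ζ (i + 1))⁻¹ := by
    have h1 := cCoeff_succ (d := d) (ζ := ζ) i (p' + b) hi
    rw [inv_pow, ← zpow_natCast, ← zpow_neg] at h1
    rw [mul_comm (cCoeff ζ i (p' + b)), eq_mul_inv_iff_mul_eq₀ hq, h1]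
    push_cast
    rfl
  have hc' : cCoeff ζ i (p' + (b + 1)) = cCoeff ζ i (p' + b) * ζ ^ (-(i : ℤ)) := by
    rw [cCoeff, cCoeff, zpow_neg, zpow_natCast, ← inv_pow,
      show i * (p' + (b + 1)) + tri i = (i * (p' + b) + tri i) + i by ring, pow_add]
    ring
  have e1 : eCoeff ζ (i + n + 1 + m) p (i + n + 1) =
      ζ ^ p * (qInt ζ (n + (i + 1)) * (ζ ^ m - 1)) := by
    rw [eCoeff, Nat.add_sub_cancel_left, show i + n + 1 = n + (i + 1) by ring]
  have e2 : eCoeff ζ (i + n + 1 + m) p n = ζ ^ p * (qInt ζ n * (ζ ^ m * ζ ^ (i + 1) - 1)) := by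
    rw [eCoeff, show i + n + 1 + m - n = m + (i + 1) by omega, pow_add]
  have hA := qInt_add ζ n (i + 1)
  have hB := qInt_add ζ (i + 1) n
  rw [add_comm (i + 1) n] at hB
  -- all powers of `ζ` in terms of a common one
  set y : ℤ := (p' : ℤ) + b with hy
  set x : ℤ := (p : ℤ) + m with hx
  have z1 : ζ ^ (-((y + ((i + 1 : ℕ) : ℤ)) * ((p : ℤ) + ((i + n + 1 + m : ℕ) : ℤ) - 1 - ((i + n + 1 : ℕ) : ℤ)))) =
      ζ ^ (-((y + i) * x)) * ζ ^ (-x) * ζ ^ (y + i + 1) := by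
    rw [← zpow_add₀ hz, ← zpow_add₀ hz]
    congr 1
    rw [hx]; push_cast; ring
  have z2 : ζ ^ (-(((p' : ℤ) + ((b + 1 : ℕ) : ℤ) + i) * ((p : ℤ) + ((i + n + 1 + m : ℕ) : ℤ) - 1 - ((i + n : ℕ) : ℤ)))) =
      ζ ^ (-((y + i) * x)) * ζ ^ (-x) := by
    rw [← zpow_add₀ hz]
    congr 1
    rw [hx, hy]; push_cast; ring
  have z3 : ζ ^ (-((y + i) * ((p : ℤ) + ((i + n + 1 + m : ℕ) : ℤ) - 1 - ((i + n : ℕ) : ℤ)))) =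
      ζ ^ (-((y + i) * x)) := by
    congr 1
    rw [hx]; push_cast; ring
  have z4 : ζ ^ (-((y + ((i + 1 : ℕ) : ℤ)) * ((p : ℤ) + ((i + n + 1 + m : ℕ) : ℤ) - 1 - ((i + n : ℕ) : ℤ)))) =
      ζ ^ (-((y + i) * x)) * ζ ^ (-x) := by
    rw [← zpow_add₀ hz]
    congr 1
    rw [hx]; push_cast; ring
  have z5 : ζ ^ ((p : ℤ) + ((i + n : ℕ) : ℤ)) = ζ ^ p * ζ ^ n * ζ ^ (i : ℤ) := by
    rw [← zpow_natCast, ← zpow_natCast, ← zpow_add₀ hz, ← zpow_add₀ hz]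
    congr 1
    push_cast; ring
  have z6 : ζ ^ p * ζ ^ m * ζ ^ (-x) = 1 := by
    rw [← zpow_natCast, ← zpow_natCast, ← zpow_add₀ hz, ← zpow_add₀ hz, hx]
    simp
  have z7 : ζ ^ (-(y + i + 1)) * ζ ^ (y + i + 1) = 1 := by rw [← zpow_add₀ hz, neg_add_cancel, zpow_zero]
  have z8 : ζ ^ (-(i : ℤ)) * ζ ^ (i : ℤ) = 1 := by rw [← zpow_add₀ hz, neg_add_cancel, zpow_zero]
  rw [rCoeff, rCoeff, rCoeff, rCoeff, eProd_succ_succ, eProd_succ, hc, hc', z1, z2, z3, z4, z5,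
    Nat.add_sub_cancel_left, e1, e2]
  generalize eProd ζ (i + n + 1 + m) p i (i + n) = P
  generalize cCoeff ζ i (p' + b) = C
  generalize ζ ^ (-((y + i) * x)) = Z
  generalize ζ ^ (-x) = X at *
  generalize ζ ^ (-(y + i + 1)) = Yi at *
  generalize ζ ^ (y + i + 1) = Y at *
  generalize ζ ^ (-(i : ℤ)) = Ji at *
  generalize ζ ^ (i : ℤ) = J at *
  generalize ζ ^ p = Q at *
  generalize ζ ^ m = M at *
  generalize ζ ^ n = N at *
  generalize ζ ^ (i + 1) = I at *
  generalize qInt ζ (n + (i + 1)) = T at *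
  generalize qInt ζ n = U at *
  generalize qInt ζ (i + 1) = V at *
  -- This is the identity with the common factor `P * C * Z` removed and multiplied by `(i + 1)_ζ`.
  have hmain : Q * (T * (M - 1)) * X + Q * N * X * V = V + Q * (U * (M * I - 1)) * X := by
    linear_combination Q * M * X * hB - Q * X * hA + V * z6
  have hV : V⁻¹ * V = 1 := inv_mul_cancel₀ hq
  linear_combination P * C * Z * V⁻¹ * hmain + P * C * Z * (1 - Q * N * X) * hV +
    P * C * Z * X * V⁻¹ * (Q * (T * (M - 1)) - Q * (U * (M * I - 1))) * z7 + P * C * Z * X * Q * N * z8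

variable (d ζ) in
/-- The action of `Δ(F) = F ⊗ 1 + (K^*)⁻¹ ⊗ F` on a tensor product of simple modules. -/
noncomputable def FAct (l p : ℕ) (hl : l ≤ d) (l' p' : ℕ) (hl' : l' ≤ d) :
    Module.End ℂ ((Fin l → ℂ) ⊗[ℂ] (Fin l' → ℂ)) :=
  TensorProduct.map (act d ζ l p hl (Double.F d ζ)) LinearMap.id +
    TensorProduct.map (act d ζ l p hl (↑(Double.Kst d ζ)⁻¹ : Double d ζ))
      (act d ζ l' p' hl' (Double.F d ζ))

variable (d ζ) in
/-- The action of the opposite coproduct of `F` on a tensor product of simple modules. -/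
noncomputable def FActOp (l p : ℕ) (hl : l ≤ d) (l' p' : ℕ) (hl' : l' ≤ d) :
    Module.End ℂ ((Fin l → ℂ) ⊗[ℂ] (Fin l' → ℂ)) :=
  TensorProduct.map LinearMap.id (act d ζ l' p' hl' (Double.F d ζ)) +
    TensorProduct.map (act d ζ l p hl (Double.F d ζ))
      (act d ζ l' p' hl' (↑(Double.Kst d ζ)⁻¹ : Double d ζ))

theorem FAct_vec (a b : ℕ) : FAct d ζ l p hl l' p' hl' (vec l a ⊗ₜ vec l' b) =
    vec l (a + 1) ⊗ₜ vec l' b + ζ ^ ((p : ℤ) + a) • (vec l a ⊗ₜ[ℂ] vec l' (b + 1)) := by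
  rw [FAct, LinearMap.add_apply, TensorProduct.map_tmul, TensorProduct.map_tmul, act_F, act_F,
    act_Kst_inv, TensorProduct.smul_tmul', LinearMap.id_apply]

theorem FActOp_vec (a b : ℕ) : FActOp d ζ l p hl l' p' hl' (vec l a ⊗ₜ vec l' b) =
    vec l a ⊗ₜ vec l' (b + 1) + ζ ^ ((p' : ℤ) + b) • (vec l (a + 1) ⊗ₜ[ℂ] vec l' b) := by
  rw [FActOp, LinearMap.add_apply, TensorProduct.map_tmul, TensorProduct.map_tmul, act_F, act_F,
    act_Kst_inv, TensorProduct.tmul_smul, LinearMap.id_apply]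

theorem ext_vec {N : Type*} [AddCommGroup N] [Module ℂ N]
    {f g : (Fin l → ℂ) ⊗[ℂ] (Fin l' → ℂ) →ₗ[ℂ] N}
    (h : ∀ a b, a < l → b < l' → f (vec l a ⊗ₜ vec l' b) = g (vec l a ⊗ₜ vec l' b)) : f = g := by
  refine ((Pi.basisFun ℂ (Fin l)).tensorProduct (Pi.basisFun ℂ (Fin l'))).ext fun ⟨a, b⟩ => ?_
  have hv : ∀ (n : ℕ) (i : Fin n), Pi.basisFun ℂ (Fin n) i = vec n i := by
    intro n i
    funext j
    rw [Pi.basisFun_apply, Pi.single_apply, vec]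
    simp only [Fin.ext_iff]
  rw [Module.Basis.tensorProduct_apply, hv, hv]
  exact h a b a.2 b.2

/-- Each side splits into two sums over `i`; a term of index `i + 1` in one is grouped with the term
of index `i` in the other, and `rCoeff_identity` compares the groups. The ungrouped terms are `i =
0`, handled by `h0`, and `i = d - 1`, which push the second factor out of range because `l' ≤ d`. -/
theorem RAct_comp_FAct : RAct d ζ l p hl l' p' hl' ∘ₗ FAct d ζ l p hl l' p' hl' =
    FActOp d ζ l p hl l' p' hl' ∘ₗ RAct d ζ l p hl l' p' hl' := by
  refine ext_vec fun a b ha hb => ?_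
  have hz := zeta_ne_zero d ζ
  rw [LinearMap.comp_apply, LinearMap.comp_apply, FAct_vec, map_add, map_smul, RAct_vec, RAct_vec,
    RAct_vec, map_sum]
  simp only [map_smul, FActOp_vec, smul_add, Finset.sum_add_distrib, smul_smul]
  obtain ⟨e, he⟩ : ∃ e, d = e + 1 := ⟨d - 1, by have := d_ne_zero d; omega⟩
  have hr : Finset.range d = Finset.range (e + 1) := by rw [he]
  have hv : vec l' (b + 1 + e) = 0 := vec_of_le (by omega)
  have hv' : vec l' (b + e + 1) = 0 := vec_of_le (by omega)
  rw [hr, Finset.sum_range_succ', Finset.sum_range_succ (fun i => rCoeff ζ l p p' i a (b + 1) • _) e,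
    Finset.sum_range_succ (fun i => rCoeff ζ l p p' i a b • _) e,
    Finset.sum_range_succ' (fun i => (rCoeff ζ l p p' i a b * _) • _), hv, hv']
  have h0 : rCoeff ζ l p p' 0 (a + 1) b = rCoeff ζ l p p' 0 a b * ζ ^ ((p' : ℤ) + ((b + 0 : ℕ) : ℤ)) := by
    simp only [rCoeff, eProd, Finset.prod_range_zero, mul_assoc]
    rw [← zpow_add₀ hz]
    congr 3
    push_cast
    ring
  have hterm : ∀ i ∈ Finset.range e,
      rCoeff ζ l p p' (i + 1) (a + 1) b • (vec l (a + 1 - (i + 1)) ⊗ₜ[ℂ] vec l' (b + (i + 1))) +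
        ζ ^ ((p : ℤ) + a) • rCoeff ζ l p p' i a (b + 1) •
          (vec l (a - i) ⊗ₜ[ℂ] vec l' (b + 1 + i)) =
      rCoeff ζ l p p' i a b • (vec l (a - i) ⊗ₜ[ℂ] vec l' (b + i + 1)) +
        (rCoeff ζ l p p' (i + 1) a b * ζ ^ ((p' : ℤ) + ((b + (i + 1) : ℕ) : ℤ))) •
          (vec l (a - (i + 1) + 1) ⊗ₜ[ℂ] vec l' (b + (i + 1))) := by
    intro i hi
    have hi' := Finset.mem_range.1 hi
    have hid := rCoeff_identity (d := d) (ζ := ζ) (l := l) (p := p) (p' := p') i a b ha (by omega)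
    rw [Nat.add_sub_add_right, show b + 1 + i = b + i + 1 by ring, show b + (i + 1) = b + i + 1 by ring,
      show (p' : ℤ) + ((b + i + 1 : ℕ) : ℤ) = (p' : ℤ) + b + i + 1 by push_cast; ring, smul_smul,
      ← add_smul, hid]
    rcases Nat.lt_or_ge a (i + 1) with h | h
    -- The truncated index `a - (i + 1) + 1` is not `a - i` here, but its coefficient is zero.
    · have h1 : rCoeff ζ l p p' (i + 1) a b = 0 := by rw [rCoeff, eProd_of_lt h]; ring
      rw [h1, zero_mul, zero_smul, add_zero, add_zero]
    · rw [show a - (i + 1) + 1 = a - i by omega, ← add_smul]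
  have hsum := Finset.sum_congr rfl hterm
  rw [Finset.sum_add_distrib, Finset.sum_add_distrib, ← Finset.smul_sum] at hsum
  simp only [TensorProduct.tmul_zero, smul_zero, add_zero, Nat.sub_zero] at hsum ⊢
  rw [add_right_comm, hsum, h0, ← add_assoc]
  simp

variable (d ζ) in
/-- The double braiding of two simple modules. -/
noncomputable def doubleR (l p : ℕ) (hl : l ≤ d) (l' p' : ℕ) (hl' : l' ≤ d) :
    Module.End ℂ ((Fin l → ℂ) ⊗[ℂ] (Fin l' → ℂ)) :=
  (TensorProduct.comm ℂ _ _).toLinearMap ∘ₗ RAct d ζ l' p' hl' l p hl ∘ₗ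
    (TensorProduct.comm ℂ _ _).toLinearMap ∘ₗ RAct d ζ l p hl l' p' hl'

theorem comm_comp_FActOp :
    (TensorProduct.comm ℂ _ _).toLinearMap ∘ₗ FActOp d ζ l p hl l' p' hl' =
      FAct d ζ l' p' hl' l p hl ∘ₗ (TensorProduct.comm ℂ _ _).toLinearMap :=
  TensorProduct.ext' fun v w => by simp [FAct, FActOp]

/-- Each `R` turns the coproduct of `F` into its opposite, and each flip turns the opposite back
with the two factors exchanged; after two rounds the original operator returns. -/
theorem doubleR_comp_FAct : doubleR d ζ l p hl l' p' hl' ∘ₗ FAct d ζ l p hl l' p' hl' =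
    FAct d ζ l p hl l' p' hl' ∘ₗ doubleR d ζ l p hl l' p' hl' := by
  rw [doubleR, LinearMap.comp_assoc, LinearMap.comp_assoc, LinearMap.comp_assoc, RAct_comp_FAct,
    ← LinearMap.comp_assoc (RAct d ζ l p hl l' p' hl'), comm_comp_FActOp, LinearMap.comp_assoc,
    ← LinearMap.comp_assoc _ (FAct d ζ l' p' hl' l p hl), RAct_comp_FAct, LinearMap.comp_assoc,
    ← LinearMap.comp_assoc _ (FActOp d ζ l' p' hl' l p hl), comm_comp_FActOp,
    LinearMap.comp_assoc]

end SimpleModule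

namespace SimpleModule

variable {l p : ℕ} {hl : l ≤ d} {l' p' : ℕ} {hl' : l' ≤ d}

/-! ### Matrix entries and traces -/

/-- The coordinate of index `a`, understood to be `0` if `a` is out of range. -/
noncomputable def co (l a : ℕ) : (Fin l → ℂ) →ₗ[ℂ] ℂ :=
  if h : a < l then LinearMap.proj ⟨a, h⟩ else 0

theorem co_vec {a : ℕ} (h : a < l) (b : ℕ) : co l a (vec l b) = if a = b then 1 else 0 := by
  rw [co, dif_pos h]
  rfl

theorem ext_vec_single {N : Type*} [AddCommGroup N] [Module ℂ N] {f g : (Fin l → ℂ) →ₗ[ℂ] N}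
    (h : ∀ a, a < l → f (vec l a) = g (vec l a)) : f = g := by
  refine (Pi.basisFun ℂ (Fin l)).ext fun a => ?_
  have hv : Pi.basisFun ℂ (Fin l) a = vec l a := by
    funext j
    rw [Pi.basisFun_apply, Pi.single_apply, vec]
    simp only [Fin.ext_iff]
  rw [hv]
  exact h a a.2

theorem co_comp_F {a : ℕ} (h : a < l) : co l a ∘ₗ act d ζ l p hl (Double.F d ζ) =
    if a = 0 then 0 else co l (a - 1) := by
  refine ext_vec_single fun b _ => ?_
  rw [LinearMap.comp_apply, act_F, co_vec h]
  by_cases h0 : a = 0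
  · rw [if_pos h0, if_neg (by omega)]; rfl
  · rw [if_neg h0, co_vec (by omega)]
    congr 1
    exact propext ⟨fun _ => by omega, fun _ => by omega⟩

theorem co_comp_Kst_inv {a : ℕ} (h : a < l) :
    co l a ∘ₗ act d ζ l p hl (↑(Double.Kst d ζ)⁻¹ : Double d ζ) = ζ ^ ((p : ℤ) + a) • co l a := by
  refine ext_vec_single fun b _ => ?_
  rw [LinearMap.comp_apply, act_Kst_inv, map_smul, LinearMap.smul_apply, co_vec h]
  by_cases hb : a = b
  · rw [hb]
  · rw [if_neg hb, smul_zero, smul_zero]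

theorem co_comp_Kst {a : ℕ} (h : a < l) :
    co l a ∘ₗ act d ζ l p hl (Double.Kst d ζ : Double d ζ) = ζ ^ (-((p : ℤ) + a)) • co l a := by
  refine ext_vec_single fun b _ => ?_
  rw [LinearMap.comp_apply, act_Kst, map_smul, LinearMap.smul_apply, co_vec h]
  by_cases hb : a = b
  · rw [hb]
  · rw [if_neg hb, smul_zero, smul_zero]

/-- The coordinate of index `(a, b)` on a tensor product. -/
noncomputable def coord (l l' a b : ℕ) : (Fin l → ℂ) ⊗[ℂ] (Fin l' → ℂ) →ₗ[ℂ] ℂ :=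
  LinearMap.mul' ℂ ℂ ∘ₗ TensorProduct.map (co l a) (co l' b)

theorem coord_tmul (a b : ℕ) (v : Fin l → ℂ) (w : Fin l' → ℂ) :
    coord l l' a b (v ⊗ₜ w) = co l a v * co l' b w := rfl

theorem coord_comp_FAct {a b : ℕ} (ha : a < l) (hb : b < l') :
    coord l l' a b ∘ₗ FAct d ζ l p hl l' p' hl' =
      (if a = 0 then 0 else coord l l' (a - 1) b) +
        ζ ^ ((p : ℤ) + a) • (if b = 0 then 0 else coord l l' a (b - 1)) := by
  refine TensorProduct.ext' fun v w => ?_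
  have h1 := LinearMap.congr_fun (co_comp_F (d := d) (ζ := ζ) (p := p) (hl := hl) ha) v
  have h2 := LinearMap.congr_fun (co_comp_F (d := d) (ζ := ζ) (p := p') (hl := hl') hb) w
  have h3 := LinearMap.congr_fun (co_comp_Kst_inv (d := d) (ζ := ζ) (p := p) (hl := hl) ha) v
  rw [LinearMap.comp_apply] at h1 h2 h3
  rw [LinearMap.comp_apply, FAct, LinearMap.add_apply, map_add, TensorProduct.map_tmul,
    TensorProduct.map_tmul, coord_tmul, coord_tmul, h1, h2, h3, LinearMap.add_apply,
    LinearMap.smul_apply, LinearMap.smul_apply, smul_eq_mul, smul_eq_mul, LinearMap.id_apply, mul_assoc]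
  congr 1
  · by_cases h : a = 0
    · rw [if_pos h, if_pos h]; simp
    · rw [if_neg h, if_neg h]; rfl
  · congr 1
    by_cases h : b = 0
    · rw [if_pos h, if_pos h]; simp
    · rw [if_neg h, if_neg h]; rfl

variable (d ζ) in
/-- The matrix entries of the double braiding. -/
noncomputable def ent (l p : ℕ) (hl : l ≤ d) (l' p' : ℕ) (hl' : l' ≤ d) (a' b' a b : ℕ) : ℂ :=
  coord l l' a' b' (doubleR d ζ l p hl l' p' hl' (vec l a ⊗ₜ vec l' b))

theorem ent_relation {a' b' : ℕ} (ha : a' < l) (hb : b' < l') (a b : ℕ) :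
    ent d ζ l p hl l' p' hl' a' b' (a + 1) b +
        ζ ^ ((p : ℤ) + a) * ent d ζ l p hl l' p' hl' a' b' a (b + 1) =
      (if a' = 0 then 0 else ent d ζ l p hl l' p' hl' (a' - 1) b' a b) +
        ζ ^ ((p : ℤ) + a') * (if b' = 0 then 0 else ent d ζ l p hl l' p' hl' a' (b' - 1) a b) := by
  have h := congrArg (coord l l' a' b') (LinearMap.congr_fun
    (doubleR_comp_FAct (d := d) (ζ := ζ) (l := l) (p := p) (hl := hl) (l' := l') (p' := p')
      (hl' := hl')) (vec l a ⊗ₜ vec l' b))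
  rw [LinearMap.comp_apply, LinearMap.comp_apply, FAct_vec, map_add, map_add, map_smul, map_smul,
    ← LinearMap.comp_apply (coord l l' a' b') (FAct d ζ l p hl l' p' hl'), coord_comp_FAct ha hb,
    LinearMap.add_apply, LinearMap.smul_apply] at h
  refine h.trans ?_
  congr 1
  · split_ifs <;> rfl
  · rw [smul_eq_mul]
    congr 1
    split_ifs <;> rfl

theorem ent_eq_zero_left {a : ℕ} (h : l ≤ a) (a' b' b : ℕ) :
    ent d ζ l p hl l' p' hl' a' b' a b = 0 := by
  rw [ent, vec_of_le h, TensorProduct.zero_tmul, map_zero, map_zero]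

theorem ent_eq_zero_right {b : ℕ} (h : l' ≤ b) (a' b' a : ℕ) :
    ent d ζ l p hl l' p' hl' a' b' a b = 0 := by
  rw [ent, vec_of_le h, TensorProduct.tmul_zero, map_zero, map_zero]

/-- The partial quantum trace of the double braiding over the right factor is a scalar. -/
theorem partialTrace_right {a : ℕ} (ha : a < l) :
    ∑ b ∈ Finset.range l', ζ ^ (-(b : ℤ)) * ent d ζ l p hl l' p' hl' a b a b =
      ∑ b ∈ Finset.range l', ζ ^ (-(b : ℤ)) * ent d ζ l p hl l' p' hl' 0 b 0 b := by
  have hz := zeta_ne_zero d ζ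
  induction a with
  | zero => rfl
  | succ a ih =>
    rw [← ih (by omega)]
    -- The weight `ζ ^ (-b)` is the one for which the off-diagonal entries cancel: replacing `b` by
    -- `b + 1` costs a factor `ζ⁻¹`, compensated by passing from `p + a` to `p + a + 1`. The end
    -- terms vanish since `vec l' l' = 0`.
    have h : ∑ b ∈ Finset.range l', ζ ^ (-(b : ℤ)) *
          (ζ ^ ((p : ℤ) + a) * ent d ζ l p hl l' p' hl' (a + 1) b a (b + 1)) =
        ∑ b ∈ Finset.range l', ζ ^ (-(b : ℤ)) * (ζ ^ ((p : ℤ) + ((a + 1 : ℕ) : ℤ)) *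
          (if b = 0 then 0 else ent d ζ l p hl l' p' hl' (a + 1) (b - 1) a b)) := by
      cases l' with
      | zero => simp
      | succ n =>
        rw [Finset.sum_range_succ, Finset.sum_range_succ' _ n, ent_eq_zero_right le_rfl, if_pos rfl]
        simp only [mul_zero, add_zero]
        refine Finset.sum_congr rfl fun b _ => ?_
        rw [if_neg (by omega), Nat.add_sub_cancel, ← mul_assoc, ← mul_assoc, ← zpow_add₀ hz,
          ← zpow_add₀ hz]
        congr 2
        push_cast
        ring
    have h2 : ∑ b ∈ Finset.range l', ζ ^ (-(b : ℤ)) * (ent d ζ l p hl l' p' hl' (a + 1) b (a + 1) b +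
          ζ ^ ((p : ℤ) + a) * ent d ζ l p hl l' p' hl' (a + 1) b a (b + 1)) =
        ∑ b ∈ Finset.range l', ζ ^ (-(b : ℤ)) * (ent d ζ l p hl l' p' hl' a b a b +
          ζ ^ ((p : ℤ) + ((a + 1 : ℕ) : ℤ)) *
            (if b = 0 then 0 else ent d ζ l p hl l' p' hl' (a + 1) (b - 1) a b)) := by
      refine Finset.sum_congr rfl fun b hb => ?_
      rw [ent_relation ha (Finset.mem_range.1 hb), if_neg (by omega), Nat.add_sub_cancel]
    simp only [mul_add, Finset.sum_add_distrib] at h2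
    rw [h] at h2
    exact add_right_cancel h2

/-- The partial quantum trace of the double braiding over the left factor is a scalar. -/
theorem partialTrace_left {b : ℕ} (hb : b < l') :
    ∑ a ∈ Finset.range l, ζ ^ (a : ℤ) * ent d ζ l p hl l' p' hl' a b a b =
      ∑ a ∈ Finset.range l, ζ ^ (a : ℤ) * ent d ζ l p hl l' p' hl' a 0 a 0 := by
  have hz := zeta_ne_zero d ζ
  induction b with
  | zero => rfl
  | succ b ih =>
    rw [← ih (by omega)]
    -- On this side the off-diagonal entries carry no power of `ζ` and cancel by a plain shift of
    -- `a`. The weight `ζ ^ a` comes from the diagonal entries, which carry `ζ ^ (p + a)`.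
    have h : ∑ a ∈ Finset.range l, ent d ζ l p hl l' p' hl' a (b + 1) (a + 1) b =
        ∑ a ∈ Finset.range l,
          (if a = 0 then 0 else ent d ζ l p hl l' p' hl' (a - 1) (b + 1) a b) := by
      cases l with
      | zero => simp
      | succ n =>
        rw [Finset.sum_range_succ, Finset.sum_range_succ' _ n, ent_eq_zero_left le_rfl, if_pos rfl]
        refine congrArg (· + 0) (Finset.sum_congr rfl fun a _ => ?_)
        rw [if_neg (by omega), Nat.add_sub_cancel]
    have h2 := Finset.sum_congr (rfl : Finset.range l = _) fun a ha =>
      ent_relation (d := d) (ζ := ζ) (p := p) (hl := hl) (p' := p') (hl' := hl')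
        (Finset.mem_range.1 ha) hb a b
    rw [Finset.sum_add_distrib, Finset.sum_add_distrib, h] at h2
    have h3 := add_left_cancel h2
    have h4 : ∀ f : ℕ → ℂ, ∑ a ∈ Finset.range l, ζ ^ ((p : ℤ) + a) * f a =
        ζ ^ (p : ℤ) * ∑ a ∈ Finset.range l, ζ ^ (a : ℤ) * f a := by
      intro f
      rw [Finset.mul_sum]
      exact Finset.sum_congr rfl fun a _ => by rw [zpow_add₀ hz, mul_assoc]
    simp only [Nat.add_sub_cancel, Nat.succ_ne_zero, if_false] at h3
    rw [h4, h4] at h3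
    exact mul_left_cancel₀ (zpow_ne_zero _ hz) h3

/-- The hypothesis leaves only `i = 0` in the first action of `R`. In the second, a term with `i >
0` raises `a` to `a + i` and misses the diagonal. The two torus scalars remain. -/
theorem ent_diag {a b : ℕ} (ha : a < l) (hb : b < l')
    (h : ∀ i, 0 < i → rCoeff ζ l p p' i a b • (vec l (a - i) ⊗ₜ[ℂ] vec l' (b + i)) = 0) :
    ent d ζ l p hl l' p' hl' a b a b = ζ ^ (-(((p' : ℤ) + b) * ((p : ℤ) + l - 1 - a)) -
      ((p : ℤ) + a) * ((p' : ℤ) + l' - 1 - b)) := by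
  have hz := zeta_ne_zero d ζ
  have h0 : 0 ∈ Finset.range d := Finset.mem_range.2 (Nat.pos_of_ne_zero (d_ne_zero d))
  have hr : ∀ (l p p' a b : ℕ), rCoeff ζ l p p' 0 a b =
      ζ ^ (-(((p' : ℤ) + b) * ((p : ℤ) + l - 1 - a))) := by
    intro l p p' a b
    simp [rCoeff, eProd, cCoeff, tri_zero, qFact_zero]
  rw [ent, doubleR, LinearMap.comp_apply, LinearMap.comp_apply, LinearMap.comp_apply, RAct_vec,
    Finset.sum_eq_single_of_mem 0 h0 (fun i _ hi => h i (Nat.pos_of_ne_zero hi)), hr, Nat.sub_zero,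
    add_zero, map_smul, map_smul, map_smul, map_smul, LinearEquiv.coe_coe, LinearEquiv.coe_coe,
    TensorProduct.comm_tmul, RAct_vec, map_sum, map_sum, Finset.sum_eq_single_of_mem 0 h0]
  · rw [hr, map_smul, map_smul, TensorProduct.comm_tmul, coord_tmul, add_zero,
      Nat.sub_zero, co_vec ha, co_vec hb, if_pos rfl, if_pos rfl, smul_eq_mul, smul_eq_mul, mul_one,
      mul_one, ← zpow_add₀ hz, ← sub_eq_add_neg]
  · intro i _ hi
    rw [map_smul, map_smul, TensorProduct.comm_tmul, coord_tmul, co_vec ha,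
      if_neg (by omega), zero_mul, smul_zero]

theorem trace_eq (f : Module.End ℂ ((Fin l → ℂ) ⊗[ℂ] (Fin l' → ℂ))) :
    LinearMap.trace ℂ _ f = ∑ a ∈ Finset.range l, ∑ b ∈ Finset.range l',
      coord l l' a b (f (vec l a ⊗ₜ vec l' b)) := by
  have hv : ∀ (n : ℕ) (i : Fin n), Pi.basisFun ℂ (Fin n) i = vec n i := by
    intro n i
    funext j
    rw [Pi.basisFun_apply, Pi.single_apply, vec]
    simp only [Fin.ext_iff]
  have hc : ∀ (a : Fin l) (b : Fin l') (y : (Fin l → ℂ) ⊗[ℂ] (Fin l' → ℂ)),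
      ((Pi.basisFun ℂ (Fin l)).tensorProduct (Pi.basisFun ℂ (Fin l'))).repr y (a, b) =
        coord l l' a b y := by
    intro a b y
    induction y with
    | zero => simp
    | add x y hx hy => rw [map_add, map_add, Finsupp.add_apply, hx, hy]
    | tmul v w =>
      rw [Module.Basis.tensorProduct_repr_tmul_apply, coord_tmul, co, co, dif_pos a.2, dif_pos b.2]
      simp [mul_comm]
  rw [LinearMap.trace_eq_matrix_trace ℂ
    ((Pi.basisFun ℂ (Fin l)).tensorProduct (Pi.basisFun ℂ (Fin l'))), Matrix.trace,
    Fintype.sum_prod_type, ← Fin.sum_univ_eq_sum_range (fun a => ∑ b ∈ Finset.range l',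
      coord l l' a b (f (vec l a ⊗ₜ vec l' b)))]
  refine Finset.sum_congr rfl fun a _ => ?_
  rw [← Fin.sum_univ_eq_sum_range (fun b => coord l l' a b (f (vec l a ⊗ₜ vec l' b)))]
  refine Finset.sum_congr rfl fun b _ => ?_
  rw [Matrix.diag_apply, LinearMap.toMatrix_apply, hc, Module.Basis.tensorProduct_apply, hv, hv]

theorem tensorRep_Kst {V W : Type*} [AddCommGroup V] [Module ℂ V] [AddCommGroup W] [Module ℂ W]
    (ρ : Double d ζ →ₐ[ℂ] Module.End ℂ V) (σ : Double d ζ →ₐ[ℂ] Module.End ℂ W) :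
    tensorRep ρ σ (Double.Kst d ζ : Double d ζ) =
      TensorProduct.map (ρ (Double.Kst d ζ : Double d ζ)) (σ (Double.Kst d ζ : Double d ζ)) := by
  change tensorAction ρ σ (Double.comul d ζ (Double.inDual d ζ (TaftDual.ofHom (TaftDual.charK d ζ)))) = _
  rw [Double.comul_inDual_ofHom]
  rfl

theorem tensorRep_Kst_inv {V W : Type*} [AddCommGroup V] [Module ℂ V] [AddCommGroup W]
    [Module ℂ W] (ρ : Double d ζ →ₐ[ℂ] Module.End ℂ V) (σ : Double d ζ →ₐ[ℂ] Module.End ℂ W) :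
    tensorRep ρ σ (↑(Double.Kst d ζ)⁻¹ : Double d ζ) =
      TensorProduct.map (ρ (↑(Double.Kst d ζ)⁻¹ : Double d ζ))
        (σ (↑(Double.Kst d ζ)⁻¹ : Double d ζ)) := by
  change tensorAction ρ σ (Double.comul d ζ
    (Double.inDual d ζ (TaftDual.ofHom (TaftDual.charKinv d ζ)))) = _
  rw [Double.comul_inDual_ofHom]
  rfl

/-- The factor `x ^ m - 1` produced by the first geometric sum is the one that telescopes the
second. It is used with `ζ⁻¹` for `Tr₊` and with `ζ` for `Tr₋`. -/
theorem geom_sum_mul_geom_sum (x : ℂ) (m n : ℕ) :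
    (∑ a ∈ Finset.range m, x ^ a) * (∑ b ∈ Finset.range n, (x ^ m) ^ b) * (x - 1) =
      x ^ (m * n) - 1 := by
  rw [mul_right_comm, geom_sum_mul, mul_comm, geom_sum_mul, pow_mul]

theorem one_sub_zeta_ne_zero (d : ℕ) (ζ : ℂ) [Fact (2 ≤ d)] [Fact (IsPrimitiveRoot ζ d)] :
    1 - ζ ≠ 0 := by
  have h2 : 2 ≤ d := Fact.out
  exact sub_ne_zero.2 (Ne.symm ((prim d ζ).ne_one (by omega)))

/-- The pivot contributes `ζ ^ (-(p + a + p' + b))`, whose dependence on `b` is the weight of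
`partialTrace_right`. The inner sum may then be taken at `a = 0`, where `E` acts by zero and
`ent_diag` applies. -/
theorem trPos_doubleR (h1 : 0 < l) :
    trPos (tensorRep (act d ζ l p hl) (act d ζ l' p' hl')) (doubleR d ζ l p hl l' p' hl') =
      ζ / (1 - ζ) * ζ ^ (-((l : ℤ) * l') - l * p' - p * l' - 2 * p * p') *
        (1 - ζ ^ ((l : ℤ) * l')) := by
  have hz := zeta_ne_zero d ζ
  have hz1 := one_sub_zeta_ne_zero d ζ
  have hterm : ∀ a ∈ Finset.range l, ∑ b ∈ Finset.range l', coord l l' a b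
      ((tensorRep (act d ζ l p hl) (act d ζ l' p' hl') (Double.Kst d ζ : Double d ζ) *
        doubleR d ζ l p hl l' p' hl') (vec l a ⊗ₜ vec l' b)) =
      ζ⁻¹ ^ a * (ζ ^ (-(2 * (p : ℤ) * p') - l * p' - p * l') *
        ∑ b ∈ Finset.range l', (ζ⁻¹ ^ l) ^ b) := by
    intro a ha
    have ha' := Finset.mem_range.1 ha
    have e1 : ∀ b ∈ Finset.range l', coord l l' a b
        ((tensorRep (act d ζ l p hl) (act d ζ l' p' hl') (Double.Kst d ζ : Double d ζ) *
          doubleR d ζ l p hl l' p' hl') (vec l a ⊗ₜ vec l' b)) =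
        ζ ^ (-((p : ℤ) + a + p')) * (ζ ^ (-(b : ℤ)) * ent d ζ l p hl l' p' hl' a b a b) := by
      intro b hb
      have hb' := Finset.mem_range.1 hb
      rw [tensorRep_Kst, Module.End.mul_apply, ent]
      generalize doubleR d ζ l p hl l' p' hl' (vec l a ⊗ₜ vec l' b) = y
      rw [← mul_assoc, ← zpow_add₀ hz]
      induction y with
      | zero => simp
      | add x y hx hy => rw [map_add, map_add, hx, hy, map_add, mul_add]
      | tmul v w =>
        have h1 := LinearMap.congr_fun (co_comp_Kst (d := d) (ζ := ζ) (p := p) (hl := hl) ha') v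
        have h2 := LinearMap.congr_fun (co_comp_Kst (d := d) (ζ := ζ) (p := p') (hl := hl') hb') w
        rw [LinearMap.comp_apply, LinearMap.smul_apply, smul_eq_mul] at h1 h2
        rw [TensorProduct.map_tmul, coord_tmul, h1, h2, coord_tmul, mul_mul_mul_comm,
          ← zpow_add₀ hz]
        congr 2
        ring
    rw [Finset.sum_congr rfl e1, ← Finset.mul_sum, partialTrace_right ha', Finset.mul_sum,
      Finset.mul_sum, Finset.mul_sum]
    refine Finset.sum_congr rfl fun b hb => ?_
    rw [ent_diag h1 (Finset.mem_range.1 hb) (fun i hi => by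
      rw [rCoeff, eProd_of_lt hi, zero_mul, zero_mul, zero_smul]), ← pow_mul, inv_pow, inv_pow,
      ← zpow_natCast ζ a, ← zpow_natCast ζ (l * b), ← zpow_neg, ← zpow_neg, ← zpow_add₀ hz,
      ← zpow_add₀ hz, ← zpow_add₀ hz, ← zpow_add₀ hz]
    congr 1
    push_cast
    ring
  rw [trPos, Double.pivot_eq, trace_eq, Finset.sum_congr rfl hterm, ← Finset.sum_mul]
  have hg := geom_sum_mul_geom_sum ζ⁻¹ l l'
  have e2 : ζ ^ (-((l : ℤ) * l') - l * p' - p * l' - 2 * p * p') =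
      ζ ^ (-(2 * (p : ℤ) * p') - l * p' - p * l') * ζ⁻¹ ^ (l * l') := by
    rw [inv_pow, ← zpow_natCast, ← zpow_neg, ← zpow_add₀ hz]
    congr 1
    push_cast
    ring
  have e3 : ζ ^ ((l : ℤ) * l') * ζ⁻¹ ^ (l * l') = 1 := by
    rw [← Nat.cast_mul, zpow_natCast, ← mul_pow, mul_inv_cancel₀ hz, one_pow]
  rw [e2]
  generalize ζ ^ (-(2 * (p : ℤ) * p') - l * p' - p * l') = C
  generalize ∑ a ∈ Finset.range l, ζ⁻¹ ^ a = A at *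
  generalize ∑ b ∈ Finset.range l', (ζ⁻¹ ^ l) ^ b = B at *
  generalize ζ⁻¹ ^ (l * l') = X at *
  generalize ζ ^ ((l : ℤ) * l') = Y at *
  field_simp at hg ⊢
  linear_combination C * hg + C * ζ * e3

theorem trNeg_doubleR (h1 : 0 < l') :
    trNeg (tensorRep (act d ζ l p hl) (act d ζ l' p' hl')) (doubleR d ζ l p hl l' p' hl') =
      ζ ^ (2 * (p : ℤ) + l + 2 * p' + l' - 1) / (1 - ζ) *
        ζ ^ (-((l : ℤ) * l') - l * p' - p * l' - 2 * p * p') * (1 - ζ ^ ((l : ℤ) * l')) := by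
  have hz := zeta_ne_zero d ζ
  have hz1 := one_sub_zeta_ne_zero d ζ
  have hterm : ∀ b ∈ Finset.range l', ∑ a ∈ Finset.range l, coord l l' a b
      ((doubleR d ζ l p hl l' p' hl' * tensorRep (act d ζ l p hl) (act d ζ l' p' hl')
        (↑(Double.Kst d ζ)⁻¹ : Double d ζ)) (vec l a ⊗ₜ vec l' b)) =
      ζ ^ b * (ζ ^ (2 * (p : ℤ) + l + 2 * p' + l' - 1 - l * l' - l * p' - p * l' - 2 * p * p') *
        ∑ a ∈ Finset.range l, (ζ ^ l') ^ a) := by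
    intro b hb
    have hb' := Finset.mem_range.1 hb
    have e1 : ∀ a ∈ Finset.range l, coord l l' a b
        ((doubleR d ζ l p hl l' p' hl' * tensorRep (act d ζ l p hl) (act d ζ l' p' hl')
          (↑(Double.Kst d ζ)⁻¹ : Double d ζ)) (vec l a ⊗ₜ vec l' b)) =
        ζ ^ ((p : ℤ) + b + p') * (ζ ^ (a : ℤ) * ent d ζ l p hl l' p' hl' a b a b) := by
      intro a ha
      rw [tensorRep_Kst_inv, Module.End.mul_apply, TensorProduct.map_tmul, act_Kst_inv, act_Kst_inv,
        TensorProduct.smul_tmul_smul, map_smul, map_smul, ← zpow_add₀ hz, ← mul_assoc,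
        ← zpow_add₀ hz, ent, smul_eq_mul]
      congr 2
      ring
    -- The convenient index is the last one: for `i > 0`, `β_{i,j}` pushes `vec l' (l' - 1)` out of
    -- range, which supplies the hypothesis of `ent_diag` for every `a`. The partial trace is moved
    -- there through its value at `0`.
    have hlast : l' - 1 < l' := by omega
    rw [Finset.sum_congr rfl e1, ← Finset.mul_sum, partialTrace_left hb', ← partialTrace_left hlast,
      Finset.mul_sum, Finset.mul_sum, Finset.mul_sum]
    refine Finset.sum_congr rfl fun a ha => ?_
    rw [ent_diag (Finset.mem_range.1 ha) hlast (fun i hi => by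
      rw [vec_of_le (show l' ≤ l' - 1 + i by omega), TensorProduct.tmul_zero, smul_zero]),
      ← pow_mul, ← zpow_natCast ζ b, ← zpow_natCast ζ (l' * a), ← zpow_add₀ hz, ← zpow_add₀ hz,
      ← zpow_add₀ hz, ← zpow_add₀ hz]
    congr 1
    rw [Nat.cast_sub (show 1 ≤ l' from h1)]
    push_cast
    ring
  rw [trNeg, Double.pivot_eq, trace_eq, Finset.sum_comm, Finset.sum_congr rfl hterm,
    ← Finset.sum_mul]
  have hg := geom_sum_mul_geom_sum ζ l' l
  have e2 : ζ ^ (2 * (p : ℤ) + l + 2 * p' + l' - 1) / (1 - ζ) *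
      ζ ^ (-((l : ℤ) * l') - l * p' - p * l' - 2 * p * p') =
      ζ ^ (2 * (p : ℤ) + l + 2 * p' + l' - 1 - l * l' - l * p' - p * l' - 2 * p * p') / (1 - ζ) := by
    rw [div_mul_eq_mul_div, ← zpow_add₀ hz]
    congr 2
    ring
  have e3 : ζ ^ ((l : ℤ) * l') = ζ ^ (l' * l) := by
    rw [← Nat.cast_mul, zpow_natCast, mul_comm]
  rw [e2, e3]
  generalize ζ ^ (2 * (p : ℤ) + l + 2 * p' + l' - 1 - l * l' - l * p' - p * l' - 2 * p * p') = C
  generalize ∑ a ∈ Finset.range l', ζ ^ a = A at *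
  generalize ∑ b ∈ Finset.range l, (ζ ^ l') ^ b = B at *
  generalize ζ ^ (l' * l) = X at *
  rw [div_mul_eq_mul_div, eq_div_iff hz1]
  linear_combination -C * hg

/-! ### The twist -/

/-- On `vec l 0` the operator `(K^*)⁻¹` has eigenvalue `ζ ^ p`, so only the projection of index `p`
modulo `d` survives and the torus part acts as `K ^ p`. -/
theorem act_torus_vec_zero : act d ζ l p hl (DoubleRelations.torus d ζ (Double.K d ζ : Double d ζ)
    ↑(Double.Kst d ζ)⁻¹) (vec l 0) = ζ ^ ((p : ℤ) * (p + l - 1)) • vec l 0 := by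
  have hz := zeta_ne_zero d ζ
  have hHi : ∀ k : ℕ, act d ζ l p hl ((↑(Double.Kst d ζ)⁻¹ : Double d ζ) ^ k) (vec l 0) =
      (ζ ^ (p : ℤ)) ^ k • vec l 0 := by
    intro k
    induction k with
    | zero => simp
    | succ k ih =>
      rw [pow_succ, map_mul, Module.End.mul_apply, act_Kst_inv, map_smul, ih, smul_smul,
        Nat.cast_zero, add_zero, ← pow_succ']
  have hproj : ∀ j : ℕ, act d ζ l p hl
      (DoubleRelations.proj d ζ (↑(Double.Kst d ζ)⁻¹ : Double d ζ) j) (vec l 0) =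
      dirac d ζ (-(-(p : ℤ) + j)) • vec l 0 := by
    intro j
    rw [DoubleRelations.proj, map_smul, map_sum, LinearMap.smul_apply, LinearMap.sum_apply, dirac,
      mul_smul, Finset.sum_smul]
    congr 1
    refine Finset.sum_congr rfl fun k _ => ?_
    rw [map_smul, LinearMap.smul_apply, hHi, smul_smul, inv_pow_mul_zpow hz]
    congr 2
    ring
  have h := sum_dirac (d := d) (ζ := ζ) ((p : ℤ) + l - 1) (-(p : ℤ))
  rw [DoubleRelations.torus, map_sum, LinearMap.sum_apply]
  rw [neg_mul, neg_neg] at h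
  rw [← h, Finset.sum_smul]
  refine Finset.sum_congr rfl fun j _ => ?_
  rw [map_mul, Module.End.mul_apply, act_K_pow, map_smul, hproj, smul_smul, mul_comm, Nat.cast_zero,
    sub_zero]

theorem act_unip_vec_zero : act d ζ l p hl (DoubleRelations.unip d ζ
    (↑(Double.K d ζ)⁻¹ : Double d ζ) (Double.E d ζ) (Double.F d ζ)) (vec l 0) = vec l 0 := by
  have hz := zeta_ne_zero d ζ
  have h0 : 0 ∈ Finset.range d := Finset.mem_range.2 (Nat.pos_of_ne_zero (d_ne_zero d))
  have hKi : ∃ c : ℂ, act d ζ l p hl (↑(Double.K d ζ)⁻¹ : Double d ζ) (vec l 0) = c • vec l 0 := by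
    refine ⟨(ζ ^ ((p : ℤ) + l - 1 - (0 : ℕ)))⁻¹, ?_⟩
    have h := congrArg (act d ζ l p hl (↑(Double.K d ζ)⁻¹ : Double d ζ))
      (act_K (d := d) (ζ := ζ) (l := l) (p := p) (hl := hl) 0)
    rw [← Module.End.mul_apply, ← map_mul, Units.inv_mul, map_one, Module.End.one_apply,
      map_smul] at h
    conv_rhs => rw [h]
    rw [smul_smul, inv_mul_cancel₀ (zpow_ne_zero _ hz), one_smul]
  obtain ⟨c, hc⟩ := hKi
  have hKin : ∀ i : ℕ, act d ζ l p hl ((↑(Double.K d ζ)⁻¹ : Double d ζ) ^ i) (vec l 0) =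
      c ^ i • vec l 0 := by
    intro i
    induction i with
    | zero => simp
    | succ i ih =>
      rw [pow_succ, map_mul, Module.End.mul_apply, hc, map_smul, ih, smul_smul, ← pow_succ']
  rw [DoubleRelations.unip, map_sum, LinearMap.sum_apply, Finset.sum_eq_single_of_mem 0 h0]
  · simp [DoubleRelations.uCoeff, qFact_zero]
  · intro i _ hi
    rw [map_smul, map_mul, map_mul, LinearMap.smul_apply, Module.End.mul_apply,
      Module.End.mul_apply, hKin, map_smul, act_E_pow, eProd_of_lt (Nat.pos_of_ne_zero hi),
      zero_smul, smul_zero, map_zero, smul_zero]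

/-- Commutation with `F` propagates the value on `vec l 0` to the whole basis. On that vector the
nilpotent part is `1`, the torus part gives `ζ ^ (p (p + l - 1))`, and `(K^*)⁻¹` supplies the
missing `ζ ^ p`. -/
theorem act_θ₁ : act d ζ l p hl (Double.θ₁ d ζ) = ζ ^ ((p : ℤ) * (p + l)) • 1 := by
  have hz := zeta_ne_zero d ζ
  refine ext_vec_single fun a _ => ?_
  rw [LinearMap.smul_apply, Module.End.one_apply]
  induction a with
  | zero =>
    rw [Double.θ₁_eq, map_mul, map_mul, Module.End.mul_apply, Module.End.mul_apply,
      act_torus_vec_zero, map_smul, act_unip_vec_zero, map_smul, act_Kst_inv, smul_smul,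
      ← zpow_add₀ hz]
    congr 2
    push_cast
    ring
  | succ a ih =>
    rw [← act_F (d := d) (ζ := ζ) (p := p) (hl := hl), ← Module.End.mul_apply, ← map_mul,
      Double.θ₁_mul_F, map_mul, Module.End.mul_apply, ih (by omega), map_smul]

theorem act_inverse_θ₁ : act d ζ l p hl (Ring.inverse (Double.θ₁ d ζ)) =
    ζ ^ (-((p : ℤ) * (p + l))) • 1 := by
  have hz := zeta_ne_zero d ζ
  have h := congrArg (act d ζ l p hl) (Ring.mul_inverse_cancel _ (Double.isUnit_θ₁ (d := d) (ζ := ζ)))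
  rw [map_mul, act_θ₁, map_one, smul_mul_assoc, one_mul] at h
  rw [← h, smul_smul, zpow_neg, inv_mul_cancel₀ (zpow_ne_zero _ hz), one_smul]

end SimpleModule

/-! ### Passage to residue classes modulo `d`. -/

open SimpleModule

theorem rep_pos (x : ZMod d) : 0 < rep x := by
  have := d_ne_zero d
  rw [rep]
  split_ifs <;> omega

theorem natCast_rep (x : ZMod d) : ((rep x : ℕ) : ZMod d) = x := by
  have : NeZero d := ⟨d_ne_zero d⟩
  rw [rep]
  split_ifs with h
  · rw [ZMod.natCast_self, (ZMod.val_eq_zero x).1 h]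
  · exact ZMod.natCast_zmod_val x

/-- This allows the representatives `rep l` and `p.val` to be replaced by arbitrary integers of the
same class in every exponent. -/
theorem zpow_eq_of_intCast_eq {m n : ℤ} (h : (m : ZMod d) = n) : ζ ^ m = ζ ^ n := by
  have h1 := (ZMod.intCast_eq_intCast_iff_dvd_sub m n d).1 h
  have h2 := ((prim d ζ).zpow_eq_one_iff_dvd _).2 h1
  rwa [zpow_sub₀ (zeta_ne_zero d ζ), div_eq_one_iff_eq (zpow_ne_zero _ (zeta_ne_zero d ζ)), eq_comm] at h2

/-- The scalar chosen in `ω` is the only possible one because the module is nonzero: `rep` takes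
values in `{1, …, d}`, so `vec _ 0` is a nonzero vector. -/
theorem ω_eq {lam : Λ d} {b : Double d ζ} {c : ℂ} (h : M lam b = c • 1) : ω lam b = c := by
  have hex : ∃ c : ℂ, M lam b = c • 1 := ⟨c, h⟩
  rw [ω, dif_pos hex]
  have h1 := h.symm.trans hex.choose_spec
  have h2 := congrFun (LinearMap.congr_fun h1 (vec _ 0)) ⟨0, rep_pos lam.1⟩
  simpa [vec] using h2.symm

theorem doubleBraiding_eq (lam mu : Λ d) : doubleBraiding d ζ lam mu =
    doubleR d ζ (rep lam.1) lam.2.val (rep_le lam.1) (rep mu.1) mu.2.val (rep_le mu.1) := by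
  rw [doubleBraiding, braiding_eq, braiding_eq]
  rfl

end TaftDouble

theorem mainTheorem5 (d : ℕ) (ζ : ℂ) [Fact (2 ≤ d)] [Fact (IsPrimitiveRoot ζ d)]
    (l p l' p' : ℤ) :
    TaftDouble.SPos d ζ ((l : ZMod d), (p : ZMod d)) ((l' : ZMod d), (p' : ZMod d)) =
        ζ / (1 - ζ) * ζ ^ (-(l * l') - l * p' - p * l' - 2 * p * p') * (1 - ζ ^ (l * l')) ∧
    TaftDouble.TPos d ζ ((l : ZMod d), (p : ZMod d)) ((l : ZMod d), (p : ZMod d)) =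
        ζ ^ (-(p * (p + l))) ∧
    TaftDouble.SNeg d ζ ((l : ZMod d), (p : ZMod d)) ((l' : ZMod d), (p' : ZMod d)) =
        ζ ^ (2 * p + l + 2 * p' + l' - 1) / (1 - ζ) *
          ζ ^ (-(l * l') - l * p' - p * l' - 2 * p * p') * (1 - ζ ^ (l * l')) ∧
    TaftDouble.TNeg d ζ ((l : ZMod d), (p : ZMod d)) ((l : ZMod d), (p : ZMod d)) =
        ζ ^ (p * (p + l)) := by
  have : NeZero d := ⟨TaftDouble.Taft.d_ne_zero d⟩
  have hl (x : ℤ) : ((TaftDouble.rep (x : ZMod d) : ℕ) : ZMod d) = x := TaftDouble.natCast_rep _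
  have hp (x : ℤ) : (((x : ZMod d).val : ℕ) : ZMod d) = x := ZMod.natCast_zmod_val _
  refine ⟨?_, ?_, ?_, ?_⟩
  · rw [TaftDouble.SPos, TaftDouble.doubleBraiding_eq]
    refine (TaftDouble.SimpleModule.trPos_doubleR (TaftDouble.rep_pos _)).trans ?_
    congr 1
    · congr 1
      exact TaftDouble.zpow_eq_of_intCast_eq (d := d) (by push_cast; simp only [hl, hp])
    · congr 1
      exact TaftDouble.zpow_eq_of_intCast_eq (d := d) (by push_cast; simp only [hl])
  · rw [TaftDouble.TPos, Matrix.diagonal_apply_eq, TaftDouble.ω_eq TaftDouble.SimpleModule.act_inverse_θ₁]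
    exact TaftDouble.zpow_eq_of_intCast_eq (d := d) (by push_cast; simp only [hl, hp])
  · rw [TaftDouble.SNeg, TaftDouble.doubleBraiding_eq]
    refine (TaftDouble.SimpleModule.trNeg_doubleR (TaftDouble.rep_pos _)).trans ?_
    congr 1
    · congr 1
      · congr 1
        exact TaftDouble.zpow_eq_of_intCast_eq (d := d) (by push_cast; simp only [hl, hp])
      · exact TaftDouble.zpow_eq_of_intCast_eq (d := d) (by push_cast; simp only [hl, hp])
    · congr 1
      exact TaftDouble.zpow_eq_of_intCast_eq (d := d) (by push_cast; simp only [hl])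
  · rw [TaftDouble.TNeg, Matrix.diagonal_apply_eq, TaftDouble.ω_eq TaftDouble.SimpleModule.act_θ₁]
    exact TaftDouble.zpow_eq_of_intCast_eq (d := d) (by push_cast; simp only [hl, hp])
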